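/- Let $M$ be a compact connected surface, possibly with boundary, with $\chi(M)<0$, and let $\mathfrak T$ be a triangular decomposition of $M$, i.e. a cell decomposition of $M$ into finitely many triangles which lifts to a triangulation of the universal cover of $M$. Let $V$, $E$, $F$ be its sets of vertices, edges and triangles, let $\partial V$, $\partial E$ be the sets of boundary vertices and boundary edges, and let $\mathbb R^{3F}$ be the real vector space with one coordinate for each angle slot (corner of a triangle). Let $\mathfrak V\subset\mathbb R^{3F}$ be the affine flat of all $x$ for which the sum of the angles in the slots at $v$ is $2\pi$ for every $v\in V\setminus\partial V$ and $\pi$ for every $v\in\partial V$. For a triangle $t$ let $d^t(x)=\{A^1,A^2,A^3\}$ be the unordered triple of its angles and $k^t(x)=A^1+A^2+A^3-\pi$. An angle system is a point of $$\mathfrak N=\{x\in\mathfrak V \mid k^t(x)<0 \text{ for all } t, \text{ and every angle of } x \text{ lies in } (0,\pi)\},$$ and $\partial\mathfrak N=\overline{\mathfrak N}\setminus\mathfrak N$ denotes its boundary in $\mathfrak V$. An angle system $u$ is uniform if geodesic triangles of the hyperbolic plane with the angles $d^t(u)$ at their corresponding vertices fit together, along the gluing of $\mathfrak T$, to form a hyperbolic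 structure with geodesic boundary on $M$. For $e\in E\setminus\partial E$ let $w_e\in\mathbb R^{3F}$ be the vector with coefficient $+1$ at the two slots adjacent to $e$ on one side of $e$, $-1$ at the two slots adjacent to $e$ on the other side, and $0$ elsewhere (contributions to the same slot being added). Let $C=\operatorname{span}\{w_e \mid e\in E\setminus\partial E\}$, and call $x$ and $y$ conformally equivalent if $x-y\in C$. A triangle $t$ is legal with respect to $x\in\partial\mathfrak N$ if $d^t(x)\neq\{0,0,\pi\}$ and either $k^t(x)=0$ or some angle of $t$ in $x$ is $0$. Let $$\mathfrak B=\{x\in\partial\mathfrak N \mid \text{no triangle is legal with respect to } x\}.$$ Theorem. (1) For every $x\in\mathbb R^{3F}$, at most one uniform angle system is conformally equivalent to $x$. (2) If $x$ is an angle system with $(x+C)\cap\mathfrak B=\emptyset$, then there exists a uniform angle system conformally equivalent to $x$. -/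

import Mathlib

open Set Filter Topology UpperHalfPlane

universe u v

noncomputable section

/-! ### The standard triangle -/

/-- The standard closed triangle, in barycentric coordinates. -/
abbrev StdTriangle : Type := stdSimplex ℝ (Fin 3)

/-- The `i`-th vertex of the standard triangle. -/
def StdTriangle.vertex (i : Fin 3) : StdTriangle :=
  ⟨Pi.single i 1, single_mem_stdSimplex ℝ i⟩

/-- The closed face of the standard triangle spanned by the vertices in `a`
(empty if `a` is empty). -/
def StdTriangle.face (a : Set (Fin 3)) : Set StdTriangle :=
  {x | ∀ i, i ∉ a → x.1 i = 0}

/-! ### Triangular decompositions of surfaces -/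

/-- The elementary identifications of points of the disjoint union of the triangles (indexed by `T`)
that are prescribed by a side pairing. The pair `s = (t, i)` stands for the side of the triangle `t`
opposite to its `i`-th vertex; this side is glued affinely to the side `glue s`,
in such a way that the vertex `j` of the first triangle goes to the vertex `perm s j` of the
second one, for the two ends `j ≠ i` of the side. -/
def SideGluing {T : Type v} (glue : T × Fin 3 → T × Fin 3)
    (perm : T × Fin 3 → Equiv.Perm (Fin 3)) (p q : T × StdTriangle) : Prop :=
  ∃ i : Fin 3, p.2.1 i = 0 ∧ q.1 = (glue (p.1, i)).1 ∧
    ∀ j, q.2.1 (perm (p.1, i) j) = p.2.1 j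

/-- `char t` is the characteristic map of the triangle `t` of a cell decomposition of `M`.
The cell decomposition lifts to a triangulation of the universal cover: in the universal cover `X`,
every lifted triangle is embedded and any two lifted triangles meet in a common face
(possibly empty). -/
def LiftsToTriangulation {M : Type u} [TopologicalSpace M] {T : Type v}
    (char : T → C(StdTriangle, M)) : Prop :=
  ∃ (X : Type u) (_ : TopologicalSpace X) (_ : SimplyConnectedSpace X) (p : X → M),
    IsCoveringMap p ∧ Function.Surjective p ∧
    (∀ (t : T) (f : C(StdTriangle, X)), p ∘ f = char t → Function.Injective f) ∧
    (∀ (t t' : T) (f f' : C(StdTriangle, X)), p ∘ f = char t → p ∘ f' = char t' →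
      ∃ a b : Set (Fin 3),
        range f ∩ range f' = f '' StdTriangle.face a ∧
        range f ∩ range f' = f' '' StdTriangle.face b)

/-- A triangular decomposition of the surface `M`, with triangles indexed by `T`: a cell
decomposition of `M` into triangles glued along sides which lifts to a triangulation of the
universal cover. A side which is fixed by `glue` is a boundary side; every other side is glued to
exactly one other side. -/
structure TriangularDecomposition (M : Type u) [TopologicalSpace M] (T : Type v) where
  /-- The characteristic map of each triangle. -/
  char : T → C(StdTriangle, M)
  /-- The pairing of the sides. -/
  glue : T × Fin 3 → T × Fin 3
  /-- The matching of the vertices along the glued sides. -/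
  perm : T × Fin 3 → Equiv.Perm (Fin 3)
  glue_glue : ∀ s, glue (glue s) = s
  perm_side : ∀ s, perm s s.2 = (glue s).2
  perm_glue : ∀ s, perm (glue s) = (perm s)⁻¹
  perm_boundary : ∀ s, glue s = s → perm s = 1
  /-- The triangles cover `M`. -/
  char_surjective : ∀ m : M, ∃ t x, char t x = m
  /-- The points of the triangles are identified in `M` exactly as prescribed by the gluing. -/
  char_eq_iff : ∀ t x t' x', char t x = char t' x' ↔
    Relation.EqvGen (SideGluing glue perm) (t, x) (t', x')
  lifts : LiftsToTriangulation char

namespace TriangularDecomposition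

variable {M : Type u} [TopologicalSpace M] {T : Type v} (D : TriangularDecomposition M T)

/-- The vertex of the decomposition at which the angle slot `q = (t, i)`
(the corner of `t` at its `i`-th vertex) sits. -/
def slotVertex (q : T × Fin 3) : M := D.char q.1 (StdTriangle.vertex q.2)

/-- The set `V` of vertices. -/
def vertices : Set M := range D.slotVertex

/-- The set `∂V` of boundary vertices: the ends of boundary sides. -/
def boundaryVertices : Set M :=
  {m | ∃ s : T × Fin 3, D.glue s = s ∧ ∃ j, j ≠ s.2 ∧ m = D.slotVertex (s.1, j)}

/-- The set `E` of edges; an edge is given by the (one or two) triangle sides glued to it. -/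
def edges : Set (Set (T × Fin 3)) := range fun s => {s, D.glue s}

/-- The Euler characteristic `V - E + F`. -/
def eulerChar : ℤ := (D.vertices.ncard : ℤ) - (D.edges.ncard : ℤ) + (Nat.card T : ℤ)

/-! ### Angle systems

The space of formal angles is `T × Fin 3 → ℝ`, one coordinate for each angle slot. -/

open Classical in
/-- The covector `p^v`: the sum of the angles in all the slots at `v`. -/
def vertexSum [Fintype T] (m : M) (x : T × Fin 3 → ℝ) : ℝ :=
  ∑ q ∈ Finset.univ.filter (fun q => D.slotVertex q = m), x q

/-- The formal curvature `k^t` of the triangle `t`: its angle sum minus `π`. -/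
def _root_.triangleCurvature {T : Type v} (t : T) (x : T × Fin 3 → ℝ) : ℝ :=
  (∑ i, x (t, i)) - Real.pi

/-- The angle data `d^t(x)`, an unordered triple. -/
def _root_.angleData {T : Type v} (t : T) (x : T × Fin 3 → ℝ) : Multiset ℝ :=
  {x (t, 0), x (t, 1), x (t, 2)}

/-- The affine flat `𝔙`: angles sum to `2π` at interior vertices, to `π` at boundary vertices. -/
def angleFlat [Fintype T] : Set (T × Fin 3 → ℝ) :=
  {x | (∀ m ∈ D.vertices \ D.boundaryVertices, D.vertexSum m x = 2 * Real.pi) ∧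
    ∀ m ∈ D.boundaryVertices, D.vertexSum m x = Real.pi}

/-- The set `𝔑` of angle systems. -/
def angleSystems [Fintype T] : Set (T × Fin 3 → ℝ) :=
  {x | x ∈ D.angleFlat ∧ (∀ t, triangleCurvature t x < 0) ∧ ∀ q, x q ∈ Ioo 0 Real.pi}

/-- The boundary `∂𝔑` of `𝔑`, which is an open subset of the closed flat `𝔙`, relative to `𝔙`. -/
def angleBoundary [Fintype T] : Set (T × Fin 3 → ℝ) :=
  closure D.angleSystems \ D.angleSystems

/-- The triangle `t` is legal with respect to `x`. -/
def _root_.IsLegal {T : Type v} (t : T) (x : T × Fin 3 → ℝ) : Prop :=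
  angleData t x ≠ {0, 0, Real.pi} ∧ (triangleCurvature t x = 0 ∨ ∃ i, x (t, i) = 0)

/-- The bad part `𝔅` of the boundary. -/
def badSet [Fintype T] : Set (T × Fin 3 → ℝ) :=
  {x | x ∈ D.angleBoundary ∧ ∀ t, ¬ IsLegal t x}

/-! ### Conformal deformations -/

/-- The angle slots at the two ends of the side `s`, in the triangle of `s`. -/
def _root_.sideEnds {T : Type v} (s : T × Fin 3) : Set (T × Fin 3) := {q | q.1 = s.1 ∧ q.2 ≠ s.2}

/-- The vector `w_e` of the edge `e` formed by the sides `s` and `glue s`: it is `+1` on the two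
slots adjacent to `e` on the side of `s`, `-1` on the two slots adjacent to `e` on the
other side (the contributions being added if the slots coincide), `0` elsewhere. -/
def edgeVector (s : T × Fin 3) : T × Fin 3 → ℝ :=
  (sideEnds s).indicator 1 - (sideEnds (D.glue s)).indicator 1

/-- The space `C` of conformal deformations, spanned by the vectors of the interior edges. -/
def conformalDeformations : Submodule ℝ (T × Fin 3 → ℝ) :=
  Submodule.span ℝ (D.edgeVector '' {s | D.glue s ≠ s})

/-- Conformal equivalence. -/
def ConformallyEquivalent (x y : T × Fin 3 → ℝ) : Prop := x - y ∈ D.conformalDeformations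

end TriangularDecomposition

/-! ### Hyperbolic geometry -/

/-- The geodesic segment between two points of the hyperbolic plane. -/
def hypSegment (a b : ℍ) : Set ℍ := {z | dist a z + dist z b = dist a b}

/-- The (filled) geodesic triangle with vertices `a`, `b`, `c`. -/
def hypTriangle (a b c : ℍ) : Set ℍ := {z | ∃ w ∈ hypSegment b c, z ∈ hypSegment a w}

/-- The hyperbolic angle at `a` between the geodesics from `a` to `b` and to `c`: the
conformal map `z ↦ (z - a) / (z - conj a)` sends `ℍ` to the Poincaré disk, `a` to the centre, and
the geodesics issuing from `a` to radii. -/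
def hypAngle (a b c : ℍ) : ℝ :=
  InnerProductGeometry.angle
    (((b : ℂ) - a) / ((b : ℂ) - (starRingEnd ℂ) (a : ℂ)))
    (((c : ℂ) - a) / ((c : ℂ) - (starRingEnd ℂ) (a : ℂ)))

/-- A closed half plane of the hyperbolic plane, bounded by a complete geodesic. -/
abbrev HypHalfPlane : Type := {z : ℍ // 0 ≤ z.re}

/-- A hyperbolic structure with geodesic boundary on `M`: an atlas of charts with values in a closed
half plane of the hyperbolic plane, whose coordinate changes are locally restrictions of isometries
of the hyperbolic plane. -/
structure HyperbolicStructure (M : Type u) [TopologicalSpace M] where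
  atlas : Set (OpenPartialHomeomorph M HypHalfPlane)
  cover : ∀ m : M, ∃ e ∈ atlas, m ∈ e.source
  compatible : ∀ e ∈ atlas, ∀ e' ∈ atlas, ∀ m ∈ e.source ∩ e'.source,
    ∃ g : ℍ ≃ᵢ ℍ, ∀ᶠ y in 𝓝 m, (e' y : ℍ) = g (e y : ℍ)

/-- `r` realizes the standard triangle as a geodesic hyperbolic triangle with angle `a i` at the
`i`-th vertex: it is a homeomorphism onto the filled geodesic triangle, carrying sides to sides. -/
structure IsHypRealization (a : Fin 3 → ℝ) (r : StdTriangle → ℍ) : Prop where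
  continuous : Continuous r
  injective : Function.Injective r
  range_eq : range r = hypTriangle (r (StdTriangle.vertex 0)) (r (StdTriangle.vertex 1))
    (r (StdTriangle.vertex 2))
  side : ∀ i j, i ≠ j → r '' StdTriangle.face {i, j} =
    hypSegment (r (StdTriangle.vertex i)) (r (StdTriangle.vertex j))
  angle : ∀ i j k, i ≠ j → i ≠ k → j ≠ k →
    hypAngle (r (StdTriangle.vertex i)) (r (StdTriangle.vertex j)) (r (StdTriangle.vertex k)) = a i

/-- An angle system `x` is uniform if hyperbolic realizations of the triangles of the decomposition,
with the angles prescribed by `x`, fit together to form a hyperbolic structure on `M`: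
for some hyperbolic structure on `M` the characteristic maps are,
in the charts, local isometries from the realized triangles to `M`. -/
def TriangularDecomposition.IsUniform {M : Type u} [TopologicalSpace M] {T : Type v} [Fintype T]
    (D : TriangularDecomposition M T) (x : T × Fin 3 → ℝ) : Prop :=
  x ∈ D.angleSystems ∧
  ∃ r : T → StdTriangle → ℍ, (∀ t, IsHypRealization (fun i => x (t, i)) (r t)) ∧
  ∃ S : HyperbolicStructure M, ∀ (t : T) (z : StdTriangle), ∀ e ∈ S.atlas,
    D.char t z ∈ e.source →
      ∃ g : ℍ ≃ᵢ ℍ, ∀ᶠ y in 𝓝 z, (e (D.char t y) : ℍ) = g (r t y)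

end

/-! The proof is variational. A hyperbolic triangle with angles A carries a potential, a sum of
integrals of log cos and log sin, whose derivative is `HypPot.slope`. Regrouped by sides, this
derivative is a linear combination of the logarithms of sinh² of half the side lengths, and in the
direction w_e all terms cancel except those of the two sides glued along e
(`totalSlope_edgeVector`). Hence an angle system is a critical point of the total potential on its
conformal class exactly when glued sides have equal lengths (`SidesMatch`).

Uniqueness: the potential of a triangle is strictly concave (`hess_nonneg`), so a conformal class
contains at most one critical angle system.

Existence: the potential is continuous up to degenerate triangles, so it attains a maximum on the
compact intersection of the closure of 𝔑 with x + C. Vectors of C preserve the vertex sums, so a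
maximum inside 𝔑 is critical. A maximum on ∂𝔑 would lie outside 𝔅, so some triangle would be legal
there. The slope of that triangle towards x is infinite at the boundary (`tendsto_slope_atTop`),
while concavity bounds the slopes of the other triangles from below; moving towards x would increase
the potential.

It remains to identify matching sides with uniformity. In a hyperbolic structure, a chart at a point
of an edge sees both adjacent triangles up to isometry, so the two copies of the edge have the same
length (`IsUniform.sidesMatch`). Conversely, triangles are modelled in the hyperboloid: three
independent unit vectors span a cone projecting to a filled triangle, and congruent triples are
matched by a Lorentz map. A triangle attached across a side is rigidly determined
(`transfer_adjacent`), so the placements of the triangles agree wherever they are compared. Charts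
come from one triangle at its interior points, from one or two triangles along an edge, and from the
cycle or chain of corners at a vertex. There the angle sum 2π closes the cycle, and the angle sum π
makes the chain fill a half plane (`isUniform_of_sidesMatch`). -/

noncomputable section

/-! ### The hyperboloid model -/

namespace Mink

/-- The Minkowski form on `ℝ³`. -/
def form (v w : Fin 3 → ℝ) : ℝ := v 0 * w 0 - v 1 * w 1 - v 2 * w 2

/-- The triple product. -/
def vol (u v w : Fin 3 → ℝ) : ℝ :=
  u 0 * (v 1 * w 2 - v 2 * w 1) - u 1 * (v 0 * w 2 - v 2 * w 0) + u 2 * (v 0 * w 1 - v 1 * w 0)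

/-- The open forward cone. -/
def Fwd (v : Fin 3 → ℝ) : Prop := 0 < form v v ∧ 0 < v 0

theorem form_comm (v w : Fin 3 → ℝ) : form v w = form w v := by simp only [form]; ring

theorem form_add_left (u v w : Fin 3 → ℝ) : form (u + v) w = form u w + form v w := by
  simp only [form, Pi.add_apply]; ring

theorem form_add_right (u v w : Fin 3 → ℝ) : form u (v + w) = form u v + form u w := by
  simp only [form, Pi.add_apply]; ring

theorem form_smul_left (c : ℝ) (v w : Fin 3 → ℝ) : form (c • v) w = c * form v w := by
  simp only [form, Pi.smul_apply, smul_eq_mul]; ring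

theorem form_smul_right (c : ℝ) (v w : Fin 3 → ℝ) : form v (c • w) = c * form v w := by
  simp only [form, Pi.smul_apply, smul_eq_mul]; ring

theorem continuous_form_self : Continuous fun v : Fin 3 → ℝ => form v v := by
  unfold form; fun_prop

/-- This is the reversed Cauchy–Schwarz inequality: the spatial part of a forward vector is shorter
than its time component, so Euclidean Cauchy–Schwarz bounds the spatial product by the product of
the times. -/
theorem form_lower {v w : Fin 3 → ℝ} (hv : Fwd v) (hw : Fwd w) : 0 < form v w := by
  obtain ⟨hv1, hv0⟩ := hv
  obtain ⟨hw1, hw0⟩ := hw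
  have key : (v 1 * w 1 + v 2 * w 2) ^ 2 < (v 0 * w 0) ^ 2 := by
    simp only [form] at hv1 hw1
    have h1 : (v 1 * w 1 + v 2 * w 2) ^ 2 ≤ (v 1 ^ 2 + v 2 ^ 2) * (w 1 ^ 2 + w 2 ^ 2) := by
      nlinarith [sq_nonneg (v 1 * w 2 - v 2 * w 1)]
    have h2 : (v 1 ^ 2 + v 2 ^ 2) * (w 1 ^ 2 + w 2 ^ 2) ≤ (v 1 ^ 2 + v 2 ^ 2) * w 0 ^ 2 :=
      mul_le_mul_of_nonneg_left (by nlinarith) (by positivity)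
    have h3 : (v 1 ^ 2 + v 2 ^ 2) * w 0 ^ 2 < v 0 ^ 2 * w 0 ^ 2 :=
      mul_lt_mul_of_pos_right (by nlinarith) (by positivity)
    nlinarith
  have := abs_lt_of_sq_lt_sq key (by positivity)
  have := (abs_lt.1 this).2
  simp only [form]; linarith

theorem Fwd.add {v w : Fin 3 → ℝ} (hv : Fwd v) (hw : Fwd w) : Fwd (v + w) := by
  refine ⟨?_, add_pos hv.2 hw.2⟩
  have := form_lower hv hw
  rw [form_add_left, form_add_right, form_add_right, form_comm w v]
  linarith [hv.1, hw.1]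

theorem Fwd.smul {c : ℝ} {v : Fin 3 → ℝ} (hc : 0 < c) (hv : Fwd v) : Fwd (c • v) := by
  refine ⟨?_, mul_pos hc hv.2⟩
  rw [form_smul_left, form_smul_right]
  exact mul_pos hc (mul_pos hc hv.1)

theorem Fwd.denom_pos {v : Fin 3 → ℝ} (hv : Fwd v) : 0 < v 0 - v 1 := by
  obtain ⟨h1, h0⟩ := hv
  simp only [form] at h1
  have : v 1 ^ 2 < v 0 ^ 2 := by nlinarith [sq_nonneg (v 2)]
  have := abs_lt_of_sq_lt_sq this h0.le
  linarith [(abs_lt.1 this).2]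

/-- The sheet of a timelike vector is decided by the sign of its product with one forward vector.
This lets a form-preserving map be checked to preserve the forward cone on a single test vector. -/
theorem fwd_of_form_pos {v w : Fin 3 → ℝ} (hv : Fwd v) (hw : 0 < form w w) (h : 0 < form v w) :
    Fwd w := by
  refine ⟨hw, ?_⟩
  by_contra h0
  rcases (not_lt.1 h0).lt_or_eq with h0 | h0
  · have : Fwd ((-1 : ℝ) • w) := by
      refine ⟨?_, by simpa using h0⟩
      rw [form_smul_left, form_smul_right]; linarith
    have := form_lower hv this
    rw [form_smul_right] at this
    linarith
  · simp only [form, h0] at hw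
    nlinarith [sq_nonneg (w 1), sq_nonneg (w 2)]

/-- The Gram determinant is the square of the volume. -/
theorem vol_sq (u v w : Fin 3 → ℝ) : vol u v w ^ 2 =
    form u u * form v v * form w w + 2 * form u v * form v w * form u w
      - form u u * form v w ^ 2 - form v v * form u w ^ 2 - form w w * form u v ^ 2 := by
  simp only [vol, form]; ring

/-- The point of the hyperboloid representing a point of the half plane. -/
def ofUHP (z : ℍ) : Fin 3 → ℝ :=
  ![(z.re ^ 2 + z.im ^ 2 + 1) / (2 * z.im), (z.re ^ 2 + z.im ^ 2 - 1) / (2 * z.im), z.re / z.im]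

open Classical in
/-- The projection of the forward cone to the half plane. -/
def toUHP (v : Fin 3 → ℝ) : ℍ :=
  if h : Fwd v then ⟨⟨v 2 / (v 0 - v 1), √(form v v) / (v 0 - v 1)⟩,
    div_pos (Real.sqrt_pos.2 h.1) h.denom_pos⟩ else UpperHalfPlane.I

theorem form_ofUHP_self (z : ℍ) : form (ofUHP z) (ofUHP z) = 1 := by
  have := z.im_ne_zero
  simp only [form, ofUHP, Matrix.cons_val]
  field_simp
  ring

theorem fwd_ofUHP (z : ℍ) : Fwd (ofUHP z) := by
  refine ⟨by rw [form_ofUHP_self]; exact one_pos, ?_⟩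
  have := z.im_pos
  simp only [ofUHP, Matrix.cons_val]
  positivity

theorem cosh_dist_eq (z w : ℍ) : Real.cosh (dist z w) = form (ofUHP z) (ofUHP w) := by
  have := z.im_ne_zero
  have := w.im_ne_zero
  rw [UpperHalfPlane.cosh_dist']
  simp only [form, ofUHP, Matrix.cons_val]
  field_simp
  ring

theorem toUHP_re {v : Fin 3 → ℝ} (hv : Fwd v) : (toUHP v).re = v 2 / (v 0 - v 1) := by
  rw [toUHP, dif_pos hv]; rfl

theorem toUHP_im {v : Fin 3 → ℝ} (hv : Fwd v) : (toUHP v).im = √(form v v) / (v 0 - v 1) := by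
  rw [toUHP, dif_pos hv]; rfl

theorem toUHP_ofUHP (z : ℍ) : toUHP (ofUHP z) = z := by
  have hz := z.im_ne_zero
  have h := fwd_ofUHP z
  have hd : ofUHP z 0 - ofUHP z 1 = 1 / z.im := by
    simp only [ofUHP, Matrix.cons_val]; field_simp; ring
  have hz2 : ofUHP z 2 = z.re / z.im := rfl
  apply UpperHalfPlane.ext_re_im
  · rw [toUHP_re h, hd, hz2]; field_simp
  · rw [toUHP_im h, hd, form_ofUHP_self]; simp

/-- The map `toUHP` is projective: it sees a forward vector only up to positive scaling. Points of
triangles can therefore be handled through unnormalized combinations. -/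
theorem ofUHP_toUHP {v : Fin 3 → ℝ} (hv : Fwd v) :
    ofUHP (toUHP v) = (√(form v v))⁻¹ • v := by
  have h1 := hv.denom_pos.ne'
  have h2 := (Real.sqrt_pos.2 hv.1).ne'
  have h3 := Real.sq_sqrt hv.1.le
  have h4 : form v v = (v 0 - v 1) * (v 0 + v 1) - v 2 ^ 2 := by simp only [form]; ring
  rw [h4] at h3
  generalize hs : √(form v v) = s at h2 ⊢
  rw [← h4, hs, h4] at h3
  ext i
  fin_cases i <;>
  simp only [ofUHP, toUHP_re hv, toUHP_im hv, Matrix.cons_val, Pi.smul_apply, smul_eq_mul,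
    Fin.zero_eta, Fin.mk_one, Fin.reduceFinMk, hs] <;>
  field_simp
  · linear_combination h3
  · linear_combination h3

theorem toUHP_smul {c : ℝ} (hc : 0 < c) {v : Fin 3 → ℝ} (hv : Fwd v) :
    toUHP (c • v) = toUHP v := by
  have h1 := hv.denom_pos.ne'
  have hd : (c • v) 0 - (c • v) 1 = c * (v 0 - v 1) := by simp; ring
  have h2 : form (c • v) (c • v) = c ^ 2 * form v v := by
    rw [form_smul_left, form_smul_right]; ring
  apply UpperHalfPlane.ext_re_im
  · rw [toUHP_re hv, toUHP_re (hv.smul hc), hd, Pi.smul_apply, smul_eq_mul]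
    field_simp
  · rw [toUHP_im hv, toUHP_im (hv.smul hc), hd, h2, Real.sqrt_mul (by positivity),
      Real.sqrt_sq hc.le]
    field_simp

theorem toUHP_of_form_eq_one {v : Fin 3 → ℝ} (hv : Fwd v) (h : form v v = 1) :
    ofUHP (toUHP v) = v := by
  rw [ofUHP_toUHP hv, h]; simp

theorem continuous_ofUHP : Continuous ofUHP := by
  have h : ∀ z : ℍ, z.im ≠ 0 := fun z => z.im_ne_zero
  have h' : ∀ z : ℍ, 2 * z.im ≠ 0 := fun z => by simpa using z.im_ne_zero
  refine continuous_pi fun i => ?_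
  fin_cases i <;> simp only [ofUHP, Matrix.cons_val, Fin.zero_eta, Fin.mk_one, Fin.reduceFinMk]
  · exact (((continuous_re.pow 2).add (continuous_im.pow 2)).add continuous_const).div
      (continuous_const.mul continuous_im) h'
  · exact (((continuous_re.pow 2).add (continuous_im.pow 2)).sub continuous_const).div
      (continuous_const.mul continuous_im) h'
  · exact continuous_re.div continuous_im h

theorem continuousOn_toUHP : ContinuousOn toUHP {v | Fwd v} := by
  rw [UpperHalfPlane.isEmbedding_coe.continuousOn_iff]
  have : ContinuousOn (fun v : Fin 3 → ℝ =>
      Complex.equivRealProdCLM.symm (v 2 / (v 0 - v 1), √(form v v) / (v 0 - v 1))) {v | Fwd v} := by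
    apply Complex.equivRealProdCLM.symm.continuous.comp_continuousOn
    have hd : ∀ v ∈ {v | Fwd v}, v 0 - v 1 ≠ 0 := fun v (hv : Fwd v) => hv.denom_pos.ne'
    have c1 : ContinuousOn (fun v : Fin 3 → ℝ => v 0 - v 1) {v | Fwd v} :=
      Continuous.continuousOn (by fun_prop)
    refine (ContinuousOn.div (Continuous.continuousOn (by fun_prop)) c1 hd).prodMk
      (ContinuousOn.div (Continuous.continuousOn ?_) c1 hd)
    exact Real.continuous_sqrt.comp continuous_form_self
  refine this.congr fun v (hv : Fwd v) => ?_
  apply Complex.ext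
  · simpa using toUHP_re hv
  · simpa using toUHP_im hv

theorem one_le_form (z w : ℍ) : 1 ≤ form (ofUHP z) (ofUHP w) := by
  rw [← cosh_dist_eq]; exact Real.one_le_cosh _

theorem one_lt_form {z w : ℍ} (h : z ≠ w) : 1 < form (ofUHP z) (ofUHP w) := by
  rw [← cosh_dist_eq]; exact Real.one_lt_cosh.2 (dist_pos.2 h).ne'

theorem sinh_dist_eq (z w : ℍ) :
    Real.sinh (dist z w) = √(form (ofUHP z) (ofUHP w) ^ 2 - 1) := by
  rw [← cosh_dist_eq, Real.cosh_sq, add_sub_cancel_right, Real.sqrt_sq (Real.sinh_nonneg_iff.2 dist_nonneg)]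

theorem dist_eq_dist_iff {a b c d : ℍ} :
    dist a b = dist c d ↔ form (ofUHP a) (ofUHP b) = form (ofUHP c) (ofUHP d) := by
  rw [← cosh_dist_eq, ← cosh_dist_eq]
  refine ⟨fun h => by rw [h], fun h => ?_⟩
  exact Real.cosh_strictMonoOn.injOn (Set.mem_Ici.2 dist_nonneg) (Set.mem_Ici.2 dist_nonneg) h

end Mink

/-! ### Geodesic segments and the hyperbolic law of cosines -/

namespace Mink

/-- The orthogonal complement of a timelike vector is negative definite. The lemma serves to prove
two vectors equal from the products of their difference. -/
theorem eq_zero_of_orthogonal {a w : Fin 3 → ℝ} (ha : Fwd a) (h : form a w = 0)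
    (hw : 0 ≤ form w w) : w = 0 := by
  obtain ⟨ha1, ha0⟩ := ha
  simp only [form] at ha1 h hw
  have h1 : (a 0 * w 0) ^ 2 ≤ (a 1 ^ 2 + a 2 ^ 2) * (w 1 ^ 2 + w 2 ^ 2) := by
    have : a 0 * w 0 = a 1 * w 1 + a 2 * w 2 := by linarith
    rw [this]
    nlinarith [sq_nonneg (a 1 * w 2 - a 2 * w 1)]
  have h2 : w 1 ^ 2 + w 2 ^ 2 ≤ 0 := by
    by_contra hc
    have hc := not_le.1 hc
    have h3 : (a 1 ^ 2 + a 2 ^ 2) * (w 1 ^ 2 + w 2 ^ 2) < a 0 ^ 2 * (w 1 ^ 2 + w 2 ^ 2) :=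
      mul_lt_mul_of_pos_right (by nlinarith) hc
    have h4 : a 0 ^ 2 * (w 1 ^ 2 + w 2 ^ 2) ≤ a 0 ^ 2 * w 0 ^ 2 :=
      mul_le_mul_of_nonneg_left (by nlinarith) (by positivity)
    nlinarith
  have h3 : w 1 = 0 := by
    apply pow_eq_zero_iff (two_ne_zero) |>.1; nlinarith [sq_nonneg (w 1), sq_nonneg (w 2)]
  have h4 : w 2 = 0 := by
    apply pow_eq_zero_iff (two_ne_zero) |>.1; nlinarith [sq_nonneg (w 1), sq_nonneg (w 2)]
  have h5 : w 0 = 0 := by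
    rw [h3, h4] at h
    have : a 0 * w 0 = 0 := by linarith
    exact (mul_eq_zero.1 this).resolve_left ha0.ne'
  ext i
  fin_cases i <;> simpa

theorem vol_combination (a b : Fin 3 → ℝ) (α β : ℝ) : vol a (α • a + β • b) b = 0 := by
  simp only [vol, Pi.add_apply, Pi.smul_apply, smul_eq_mul]; ring

theorem sinh_dist_sq (z w : ℍ) :
    Real.sinh (dist z w) ^ 2 = form (ofUHP z) (ofUHP w) ^ 2 - 1 := by
  rw [← cosh_dist_eq, Real.cosh_sq]; ring

theorem sinh_dist_nonneg (z w : ℍ) : 0 ≤ Real.sinh (dist z w) :=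
  Real.sinh_nonneg_iff.2 dist_nonneg

/-- The Gram determinant of three points of the hyperboloid. -/
theorem vol_sq_ofUHP (a b c : ℍ) : vol (ofUHP a) (ofUHP b) (ofUHP c) ^ 2 =
    (Real.sinh (dist a b) * Real.sinh (dist b c)) ^ 2 -
      (form (ofUHP a) (ofUHP c) - form (ofUHP a) (ofUHP b) * form (ofUHP b) (ofUHP c)) ^ 2 := by
  rw [vol_sq, form_ofUHP_self, form_ofUHP_self, form_ofUHP_self, mul_pow, sinh_dist_sq,
    sinh_dist_sq]
  ring

/-- By `vol_sq_ofUHP`, coplanarity with the origin means that cosh d(a,b) equals cosh (d(a,z) ±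
d(z,b)). The plus sign, additivity of distances, corresponds to nonnegative coefficients. -/
theorem mem_hypSegment_iff {a b z : ℍ} : z ∈ hypSegment a b ↔
    ∃ α β : ℝ, 0 ≤ α ∧ 0 ≤ β ∧ ofUHP z = α • ofUHP a + β • ofUHP b := by
  have hg := vol_sq_ofUHP a z b
  have s1 := sinh_dist_nonneg a z
  have s2 := sinh_dist_nonneg z b
  constructor
  · intro h
    rcases eq_or_ne a b with rfl | hab
    · have h' : dist a z + dist z a = dist a a := h
      rw [dist_self, dist_comm z a] at h'
      have : a = z := dist_eq_zero.1 (by linarith)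
      exact ⟨1, 0, zero_le_one, le_rfl, by rw [this]; simp⟩
    · have h' : Real.cosh (dist a z + dist z b) = Real.cosh (dist a b) := by
        rw [show dist a z + dist z b = dist a b from h]
      rw [Real.cosh_add, cosh_dist_eq, cosh_dist_eq, cosh_dist_eq] at h'
      have hc := one_lt_form hab
      set c := form (ofUHP a) (ofUHP b) with hcdef
      set c1 := form (ofUHP a) (ofUHP z) with hc1
      set c2 := form (ofUHP z) (ofUHP b) with hc2
      have h1 : 1 ≤ c1 := one_le_form _ _
      have h2 : 1 ≤ c2 := one_le_form _ _
      have hD : 0 < c ^ 2 - 1 := by nlinarith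
      have q1 := sinh_dist_sq a z
      have q2 := sinh_dist_sq z b
      set t1 := Real.sinh (dist a z)
      set t2 := Real.sinh (dist z b)
      have q1' : t1 ^ 2 = c1 ^ 2 - 1 := q1
      have q2' : t2 ^ 2 = c2 ^ 2 - 1 := q2
      -- The coefficients solve the Gram system α + βc = c1, αc + β = c2 obtained by pairing with
      -- the endpoints.
      refine ⟨(c * c2 - c1) / (c ^ 2 - 1), (c * c1 - c2) / (c ^ 2 - 1), ?_, ?_, ?_⟩
      · apply div_nonneg _ hD.le
        have : c * c2 - c1 = c1 * (c2 ^ 2 - 1) + t1 * t2 * c2 := by rw [← h']; ring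
        rw [this]
        have : 0 ≤ c2 ^ 2 - 1 := by nlinarith
        positivity
      · apply div_nonneg _ hD.le
        have : c * c1 - c2 = c2 * (c1 ^ 2 - 1) + t1 * t2 * c1 := by rw [← h']; ring
        rw [this]
        have : 0 ≤ c1 ^ 2 - 1 := by nlinarith
        positivity
      · rw [← sub_eq_zero]
        have e1 : form (ofUHP a) (ofUHP a) = 1 := form_ofUHP_self a
        have e2 : form (ofUHP b) (ofUHP b) = 1 := form_ofUHP_self b
        have e3 : form (ofUHP z) (ofUHP z) = 1 := form_ofUHP_self z
        have hgr : c ^ 2 - 1 - 2 * c * c1 * c2 + c1 ^ 2 + c2 ^ 2 = 0 := by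
          have : (c - c1 * c2) ^ 2 = (t1 * t2) ^ 2 := by rw [← h']; ring
          rw [mul_pow, q1', q2'] at this
          linarith
        -- The difference is orthogonal to the vector of a by the choice of the coefficients, and
        -- its norm is zero because the Gram determinant vanishes.
        apply eq_zero_of_orthogonal (fwd_ofUHP a)
        · rw [sub_eq_add_neg, ← neg_one_smul ℝ, form_add_right, form_smul_right, form_add_right,
            form_smul_right, form_smul_right, e1, ← hcdef, ← hc1]
          field_simp
          ring
        · apply le_of_eq
          simp only [sub_eq_add_neg, ← neg_one_smul ℝ (_ + _), form_add_right, form_smul_right,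
            form_add_left, form_smul_left, e1, e2, e3, form_comm (ofUHP b) (ofUHP a),
            form_comm (ofUHP z) (ofUHP a), form_comm (ofUHP b) (ofUHP z), ← hcdef, ← hc1, ← hc2]
          have hα : (c * c2 - c1) / (c ^ 2 - 1) * (c ^ 2 - 1) = c * c2 - c1 := by field_simp
          have hβ : (c * c1 - c2) / (c ^ 2 - 1) * (c ^ 2 - 1) = c * c1 - c2 := by field_simp
          generalize (c * c2 - c1) / (c ^ 2 - 1) = α at hα ⊢
          generalize (c * c1 - c2) / (c ^ 2 - 1) = β at hβ ⊢
          have k1 : α + β * c = c1 := mul_right_cancel₀ hD.ne' (by linear_combination hα + c * hβ)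
          have k2 : α * c + β = c2 := mul_right_cancel₀ hD.ne' (by linear_combination c * hα + hβ)
          have k3 : α * c1 + β * c2 = 1 :=
            mul_right_cancel₀ hD.ne' (by linear_combination c1 * hα + c2 * hβ - hgr)
          linear_combination k3 - α * k1 - β * k2
  · rintro ⟨α, β, hα, hβ, hz⟩
    have hv : vol (ofUHP a) (ofUHP z) (ofUHP b) = 0 := by rw [hz]; exact vol_combination _ _ _ _
    have e1 : form (ofUHP a) (ofUHP a) = 1 := form_ofUHP_self a
    have e2 : form (ofUHP b) (ofUHP b) = 1 := form_ofUHP_self b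
    have e3 : form (ofUHP z) (ofUHP z) = 1 := form_ofUHP_self z
    have hc := one_le_form a b
    have f1 : form (ofUHP a) (ofUHP z) = α + β * form (ofUHP a) (ofUHP b) := by
      rw [hz, form_add_right, form_smul_right, form_smul_right, e1]; ring
    have f2 : form (ofUHP z) (ofUHP b) = α * form (ofUHP a) (ofUHP b) + β := by
      rw [hz, form_add_left, form_smul_left, form_smul_left, e2]; ring
    have f3 : 1 = α ^ 2 + β ^ 2 + 2 * α * β * form (ofUHP a) (ofUHP b) := by
      rw [← e3, hz]
      simp only [form_add_right, form_smul_right, form_add_left, form_smul_left, e1, e2,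
        form_comm (ofUHP b) (ofUHP a)]
      ring
    rw [hv] at hg
    -- This quantity equals αβ(c² − 1). Its sign selects the sum of the distances rather than their
    -- difference.
    have hn : 0 ≤ form (ofUHP a) (ofUHP b) -
        form (ofUHP a) (ofUHP z) * form (ofUHP z) (ofUHP b) := by
      rw [f1, f2]
      set c := form (ofUHP a) (ofUHP b)
      have : c - (α + β * c) * (α * c + β) = α * β * (c ^ 2 - 1) := by
        linear_combination c * f3
      rw [this]
      have : 0 ≤ c ^ 2 - 1 := by nlinarith
      positivity
    have h4 : form (ofUHP a) (ofUHP b) - form (ofUHP a) (ofUHP z) * form (ofUHP z) (ofUHP b) =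
        Real.sinh (dist a z) * Real.sinh (dist z b) := by
      rw [← sq_eq_sq₀ hn (by positivity)]; linarith
    have h5 : Real.cosh (dist a z + dist z b) = Real.cosh (dist a b) := by
      rw [Real.cosh_add, cosh_dist_eq, cosh_dist_eq, cosh_dist_eq]; linarith
    exact Real.cosh_strictMonoOn.injOn (Set.mem_Ici.2 (by positivity))
      (Set.mem_Ici.2 dist_nonneg) h5

/-- Distance from a is an arc length coordinate on the segment. The three vectors are coplanar, so
cosh d(z,w) is cosh of the sum or of the difference of the distances to a; nonnegativity of the
coefficients of b selects the difference. -/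
theorem dist_of_mem_hypSegment {a b z w : ℍ} (hz : z ∈ hypSegment a b) (hw : w ∈ hypSegment a b) :
    dist z w = |dist a z - dist a w| := by
  obtain ⟨α, β, -, hβ, ez⟩ := mem_hypSegment_iff.1 hz
  obtain ⟨α', β', -, hβ', ew⟩ := mem_hypSegment_iff.1 hw
  have hv : vol (ofUHP z) (ofUHP a) (ofUHP w) = 0 := by
    rw [ez, ew]
    simp only [vol, Pi.add_apply, Pi.smul_apply, smul_eq_mul]; ring
  have hg := vol_sq_ofUHP z a w
  rw [hv, dist_comm z a] at hg
  have s1 := sinh_dist_nonneg a z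
  have s2 := sinh_dist_nonneg a w
  have e1 : form (ofUHP a) (ofUHP a) = 1 := form_ofUHP_self a
  have hn : 0 ≤ form (ofUHP z) (ofUHP a) * form (ofUHP a) (ofUHP w) -
      form (ofUHP z) (ofUHP w) := by
    have e2 : form (ofUHP b) (ofUHP b) = 1 := form_ofUHP_self b
    have hc := one_le_form a b
    simp only [ez, ew, form_add_right, form_smul_right, form_add_left, form_smul_left, e1, e2,
        form_comm (ofUHP b) (ofUHP a)]
    set c := form (ofUHP a) (ofUHP b)
    have : 0 ≤ β * β' * (c ^ 2 - 1) := by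
      have : 0 ≤ c ^ 2 - 1 := by nlinarith
      positivity
    linarith
  have h4 : form (ofUHP z) (ofUHP a) * form (ofUHP a) (ofUHP w) - form (ofUHP z) (ofUHP w) =
      Real.sinh (dist a z) * Real.sinh (dist a w) := by
    rw [← sq_eq_sq₀ hn (by positivity)]; linarith
  have h5 : Real.cosh (dist z w) = Real.cosh |dist a z - dist a w| := by
    rw [Real.cosh_abs, Real.cosh_sub, cosh_dist_eq, cosh_dist_eq, cosh_dist_eq,
      form_comm (ofUHP a) (ofUHP z)]
    linarith
  exact Real.cosh_strictMonoOn.injOn (Set.mem_Ici.2 dist_nonneg) (Set.mem_Ici.2 (abs_nonneg _)) h5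

/-- The hyperbolic law of cosines. -/
theorem cos_hypAngle {a b c : ℍ} (hab : a ≠ b) (hac : a ≠ c) :
    Real.cos (hypAngle a b c) * (Real.sinh (dist a b) * Real.sinh (dist a c)) =
      form (ofUHP a) (ofUHP b) * form (ofUHP a) (ofUHP c) - form (ofUHP b) (ofUHP c) := by
  -- The disk coordinate of b has modulus tanh(d/2), and cosh²(d/2) = |b − ā|² / (4 Im a Im b); the
  -- formula is sinh d = 2 tanh(d/2) cosh²(d/2).
  have hn : ∀ b : ℍ, Real.sinh (dist a b) =
      ‖((b : ℂ) - a) / ((b : ℂ) - (starRingEnd ℂ) (a : ℂ))‖ *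
        (Complex.normSq ((b : ℂ) - (starRingEnd ℂ) (a : ℂ)) / (2 * a.im * b.im)) := by
    intro b
    rw [norm_div, ← dist_eq_norm, ← dist_eq_norm, ← UpperHalfPlane.tanh_half_dist,
      Complex.normSq_eq_norm_sq, ← dist_eq_norm]
    have h1 : dist (b : ℂ) ((starRingEnd ℂ) (a : ℂ)) ^ 2 / (2 * a.im * b.im) =
        2 * Real.cosh (dist b a / 2) ^ 2 := by
      rw [UpperHalfPlane.cosh_half_dist, div_pow, mul_pow, Real.sq_sqrt (by positivity)]
      field_simp
    rw [h1, Real.tanh_eq_sinh_div_cosh, dist_comm a b]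
    nth_rewrite 1 [show dist b a = 2 * (dist b a / 2) by ring]
    rw [Real.sinh_two_mul]
    have := (Real.cosh_pos (dist b a / 2)).ne'
    field_simp
  have hden : ∀ b : ℍ, (b : ℂ) - (starRingEnd ℂ) (a : ℂ) ≠ 0 := by
    intro b h
    have := congrArg Complex.im h
    simp at this
    linarith [a.im_pos, b.im_pos]
  have hne : ∀ b : ℍ, a ≠ b → ‖((b : ℂ) - a) / ((b : ℂ) - (starRingEnd ℂ) (a : ℂ))‖ ≠ 0 := by
    intro b hb
    rw [norm_ne_zero_iff]
    refine div_ne_zero (fun h => hb ?_) (hden b)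
    exact (UpperHalfPlane.ext (sub_eq_zero.1 h)).symm
  have key := InnerProductGeometry.cos_angle
    (((b : ℂ) - a) / ((b : ℂ) - (starRingEnd ℂ) (a : ℂ)))
    (((c : ℂ) - a) / ((c : ℂ) - (starRingEnd ℂ) (a : ℂ)))
  rw [hypAngle, key, hn b, hn c]
  have h1 := hne b hab
  have h2 := hne c hac
  have db := Complex.normSq_pos.2 (hden b)
  have dc := Complex.normSq_pos.2 (hden c)
  -- Multiplying each fraction by the conjugate of its denominator makes both denominators real;
  -- what then remains of the law of cosines is an identity in real and imaginary parts.
  have hinner : inner ℝ (((b : ℂ) - a) / ((b : ℂ) - (starRingEnd ℂ) (a : ℂ)))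
      (((c : ℂ) - a) / ((c : ℂ) - (starRingEnd ℂ) (a : ℂ))) =
      ((((b : ℂ) - a) * ((starRingEnd ℂ) (b : ℂ) - a)) *
        (starRingEnd ℂ) (((c : ℂ) - a) * ((starRingEnd ℂ) (c : ℂ) - a))).re /
      (Complex.normSq ((b : ℂ) - (starRingEnd ℂ) (a : ℂ)) *
        Complex.normSq ((c : ℂ) - (starRingEnd ℂ) (a : ℂ))) := by
    rw [Complex.inner]
    generalize ((b : ℂ) - a) = p
    generalize ((c : ℂ) - a) = q
    have e1 : (starRingEnd ℂ) (b : ℂ) - a = (starRingEnd ℂ) ((b : ℂ) - (starRingEnd ℂ) (a : ℂ)) := by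
      simp
    have e2 : (starRingEnd ℂ) (c : ℂ) - a = (starRingEnd ℂ) ((c : ℂ) - (starRingEnd ℂ) (a : ℂ)) := by
      simp
    rw [e1, e2]
    generalize ((b : ℂ) - (starRingEnd ℂ) (a : ℂ)) = x at db ⊢
    generalize ((c : ℂ) - (starRingEnd ℂ) (a : ℂ)) = y at dc ⊢
    simp only [Complex.normSq_apply] at db dc ⊢
    simp only [map_div₀, Complex.div_re, Complex.div_im, Complex.mul_re, Complex.mul_im,
      Complex.conj_re, Complex.conj_im, Complex.normSq_apply, map_mul, Complex.conj_conj]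
    field_simp
    ring
  rw [hinner]
  have ha := a.im_ne_zero
  have hb := b.im_ne_zero
  have hc := c.im_ne_zero
  field_simp
  simp only [form, ofUHP, Matrix.cons_val, Complex.mul_re, Complex.mul_im, Complex.sub_re,
    Complex.sub_im, Complex.conj_re, Complex.conj_im, map_mul, map_sub, Complex.conj_conj, coe_re,
    coe_im]
  field_simp
  ring

end Mink

namespace Mink

/-! ### Triples of points of the hyperboloid -/

/-- The linear combination of the three vectors of a triple. -/
def comb (P : Fin 3 → Fin 3 → ℝ) (c : Fin 3 → ℝ) : Fin 3 → ℝ :=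
  c 0 • P 0 + c 1 • P 1 + c 2 • P 2

/-- The coordinates of a vector with respect to a triple of independent vectors. -/
def coord (P : Fin 3 → Fin 3 → ℝ) (v : Fin 3 → ℝ) : Fin 3 → ℝ :=
  ![vol v (P 1) (P 2) / vol (P 0) (P 1) (P 2), vol (P 0) v (P 2) / vol (P 0) (P 1) (P 2),
    vol (P 0) (P 1) v / vol (P 0) (P 1) (P 2)]

/-- Three independent points of the hyperboloid. -/
structure IsTriple (P : Fin 3 → Fin 3 → ℝ) : Prop where
  unit : ∀ i, form (P i) (P i) = 1
  pos : ∀ i, 0 < P i 0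
  ind : vol (P 0) (P 1) (P 2) ≠ 0

variable {P Q P' Q' : Fin 3 → Fin 3 → ℝ}

theorem comb_coord (h : vol (P 0) (P 1) (P 2) ≠ 0) (v : Fin 3 → ℝ) :
    comb P (coord P v) = v := by
  have e : ∀ l, vol v (P 1) (P 2) * P 0 l + vol (P 0) v (P 2) * P 1 l + vol (P 0) (P 1) v * P 2 l =
      vol (P 0) (P 1) (P 2) * v l := by
    intro l
    fin_cases l <;> simp only [vol, Fin.zero_eta, Fin.mk_one, Fin.reduceFinMk] <;> ring
  ext l
  simp only [comb, coord, Matrix.cons_val, Pi.add_apply, Pi.smul_apply, smul_eq_mul]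
  rw [div_mul_eq_mul_div, div_mul_eq_mul_div, div_mul_eq_mul_div, ← add_div, ← add_div, e,
    mul_div_cancel_left₀ _ h]

theorem coord_comb (h : vol (P 0) (P 1) (P 2) ≠ 0) (c : Fin 3 → ℝ) :
    coord P (comb P c) = c := by
  ext i
  fin_cases i <;>
  simp only [coord, Matrix.cons_val, Fin.zero_eta, Fin.mk_one, Fin.reduceFinMk] <;>
  rw [div_eq_iff h] <;>
  simp only [vol, comb, Pi.add_apply, Pi.smul_apply, smul_eq_mul] <;> ring

theorem continuous_coord (P : Fin 3 → Fin 3 → ℝ) : Continuous (coord P) := by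
  refine continuous_pi fun i => ?_
  fin_cases i <;>
  simp only [coord, vol, Matrix.cons_val, Fin.zero_eta, Fin.mk_one, Fin.reduceFinMk] <;> fun_prop

theorem continuous_comb (P : Fin 3 → Fin 3 → ℝ) : Continuous (comb P) := by
  unfold comb; fun_prop

theorem coord_smul (P : Fin 3 → Fin 3 → ℝ) (a : ℝ) (v : Fin 3 → ℝ) (i : Fin 3) :
    coord P (a • v) i = a * coord P v i := by
  fin_cases i <;>
  simp only [coord, vol, Matrix.cons_val, Fin.zero_eta, Fin.mk_one, Fin.reduceFinMk, Pi.smul_apply,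
    smul_eq_mul] <;> ring

theorem comb_smul (P : Fin 3 → Fin 3 → ℝ) (a : ℝ) (c : Fin 3 → ℝ) :
    comb P (a • c) = a • comb P c := by
  simp only [comb, Pi.smul_apply, smul_eq_mul, smul_add, smul_smul]

theorem comb_single (P : Fin 3 → Fin 3 → ℝ) (i : Fin 3) : comb P (Pi.single i 1) = P i := by
  fin_cases i <;> simp [comb]

theorem comb_eq (P : Fin 3 → Fin 3 → ℝ) (c : Fin 3 → ℝ) {i j k : Fin 3} (hij : i ≠ j) (hik : i ≠ k)
    (hjk : j ≠ k) : comb P c = c i • P i + c j • P j + c k • P k := by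
  fin_cases i <;> fin_cases j <;> fin_cases k <;> simp_all [comb] <;> abel

theorem form_comb_comb (P : Fin 3 → Fin 3 → ℝ) (c d : Fin 3 → ℝ) :
    form (comb P c) (comb P d) = ∑ i, ∑ j, c i * d j * form (P i) (P j) := by
  simp only [comb, Fin.sum_univ_three, form_add_left, form_add_right, form_smul_left,
    form_smul_right]
  ring

/-- Two triples are congruent if they have the same Gram matrix. -/
def Congruent (P Q : Fin 3 → Fin 3 → ℝ) : Prop := ∀ i j, form (P i) (P j) = form (Q i) (Q j)

theorem Congruent.form_comb (h : Congruent P Q) (c d : Fin 3 → ℝ) :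
    form (comb Q c) (comb Q d) = form (comb P c) (comb P d) := by
  rw [form_comb_comb, form_comb_comb]
  exact Finset.sum_congr rfl fun i _ => Finset.sum_congr rfl fun j _ => by rw [h i j]

theorem IsTriple.fwd (h : IsTriple P) (i : Fin 3) : Fwd (P i) :=
  ⟨by rw [h.unit]; exact one_pos, h.pos i⟩

/-- The forward cone is closed under sums and positive multiples; terms with zero coefficient are
dropped during the induction. -/
theorem IsTriple.fwd_comb (h : IsTriple P) {c : Fin 3 → ℝ} (hc : ∀ i, 0 ≤ c i)
    (hc' : c ≠ 0) : Fwd (comb P c) := by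
  have key : ∀ s : Finset (Fin 3), (∀ i ∈ s, c i = 0) ∨ Fwd (∑ i ∈ s, c i • P i) := by
    intro s
    induction s using Finset.induction_on with
    | empty => left; simp
    | insert a s ha ih =>
      rw [Finset.sum_insert ha]
      rcases (hc a).eq_or_lt with h0 | h0
      · rw [← h0, zero_smul, zero_add]
        exact ih.imp (fun hs i hi => by
          rcases Finset.mem_insert.1 hi with rfl | hi
          exacts [h0.symm, hs i hi]) id
      · right
        rcases ih with ih | ih
        · rw [Finset.sum_eq_zero (fun i hi => by rw [ih i hi, zero_smul]), add_zero]
          exact (h.fwd a).smul h0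
        · exact ((h.fwd a).smul h0).add ih
  rcases key Finset.univ with h0 | h0
  · exact absurd (funext fun i => h0 i (Finset.mem_univ i)) hc'
  · simpa [Fin.sum_univ_three, comb] using h0

/-- The linear map carrying the triple `P` to the triple `Q`. -/
def transfer (P Q : Fin 3 → Fin 3 → ℝ) (v : Fin 3 → ℝ) : Fin 3 → ℝ := comb Q (coord P v)

/-- Equal Gram matrices make the linear map between the two bases a Lorentz map. -/
theorem form_transfer (hP : IsTriple P) (h : Congruent P Q) (v w : Fin 3 → ℝ) :
    form (transfer P Q v) (transfer P Q w) = form v w := by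
  rw [transfer, transfer, h.form_comb, comb_coord hP.ind, comb_coord hP.ind]

theorem transfer_transfer (hP : IsTriple P) (hQ : IsTriple Q) (v : Fin 3 → ℝ) :
    transfer Q P (transfer P Q v) = v := by
  rw [transfer, transfer, coord_comb hQ.ind, comb_coord hP.ind]

theorem transfer_comb (hP : IsTriple P) (c : Fin 3 → ℝ) :
    transfer P Q (comb P c) = comb Q c := by
  rw [transfer, coord_comb hP.ind]

theorem transfer_apply (hP : IsTriple P) (i : Fin 3) : transfer P Q (P i) = Q i := by
  rw [← comb_single P i, transfer_comb hP, comb_single]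

theorem fwd_transfer (hP : IsTriple P) (hQ : IsTriple Q) (h : Congruent P Q) {v : Fin 3 → ℝ}
    (hv : Fwd v) : Fwd (transfer P Q v) := by
  apply fwd_of_form_pos (hQ.fwd 0)
  · rw [form_transfer hP h]; exact hv.1
  · rw [← transfer_apply hP (Q := Q) 0, form_transfer hP h]; exact form_lower (hP.fwd 0) hv

theorem transfer_smul (a : ℝ) (v : Fin 3 → ℝ) : transfer P Q (a • v) = a • transfer P Q v := by
  rw [transfer, transfer, ← comb_smul]
  congr 1
  ext i
  rw [coord_smul, Pi.smul_apply, smul_eq_mul]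

theorem Congruent.symm (h : Congruent P Q) : Congruent Q P := fun i j => (h i j).symm

theorem ofUHP_toUHP_transfer (hP : IsTriple P) (hQ : IsTriple Q) (h : Congruent P Q) (z : ℍ) :
    ofUHP (toUHP (transfer P Q (ofUHP z))) = transfer P Q (ofUHP z) :=
  toUHP_of_form_eq_one (fwd_transfer hP hQ h (fwd_ofUHP z))
    (by rw [form_transfer hP h, form_ofUHP_self])

/-- The isometry of the hyperbolic plane carrying a triple to a congruent triple. -/
def isometryOf (hP : IsTriple P) (hQ : IsTriple Q) (h : Congruent P Q) : ℍ ≃ᵢ ℍ where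
  toFun z := toUHP (transfer P Q (ofUHP z))
  invFun z := toUHP (transfer Q P (ofUHP z))
  left_inv z := by
    beta_reduce
    rw [ofUHP_toUHP_transfer hP hQ h, transfer_transfer hP hQ, toUHP_ofUHP]
  right_inv z := by
    beta_reduce
    rw [ofUHP_toUHP_transfer hQ hP h.symm, transfer_transfer hQ hP, toUHP_ofUHP]
  isometry_toFun := by
    refine Isometry.of_dist_eq fun z w => ?_
    rw [dist_eq_dist_iff, ofUHP_toUHP_transfer hP hQ h, ofUHP_toUHP_transfer hP hQ h,
      form_transfer hP h]

theorem isometryOf_apply (hP : IsTriple P) (hQ : IsTriple Q) (h : Congruent P Q)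
    (z : ℍ) : isometryOf hP hQ h z = toUHP (transfer P Q (ofUHP z)) := rfl

theorem isometryOf_toUHP (hP : IsTriple P) (hQ : IsTriple Q) (h : Congruent P Q) {v : Fin 3 → ℝ}
    (hv : Fwd v) : isometryOf hP hQ h (toUHP v) = toUHP (transfer P Q v) := by
  have := Real.sqrt_pos.2 hv.1
  rw [isometryOf_apply, ofUHP_toUHP hv, transfer_smul,
    toUHP_smul (inv_pos.2 this) (fwd_transfer hP hQ h hv)]

/-- The point of the geodesic triangle spanned by a triple with given projective coordinates. -/
def point (P : Fin 3 → Fin 3 → ℝ) (y : Fin 3 → ℝ) : ℍ := toUHP (comb P y)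

theorem stdTriangle_ne_zero (y : StdTriangle) : y.1 ≠ 0 := by
  intro h
  have := y.2.2
  rw [h] at this
  simp at this

theorem fwd_comb_std (hP : IsTriple P) (y : StdTriangle) : Fwd (comb P y.1) :=
  hP.fwd_comb y.2.1 (stdTriangle_ne_zero y)

theorem isometryOf_point (hP : IsTriple P) (hQ : IsTriple Q) (h : Congruent P Q)
    (y : StdTriangle) : isometryOf hP hQ h (point P y.1) = point Q y.1 := by
  rw [point, isometryOf_toUHP hP hQ h (fwd_comb_std hP y), transfer_comb hP, point]

theorem vol_comb (P : Fin 3 → Fin 3 → ℝ) (c : Fin 3 → ℝ) {i j k : Fin 3} (hij : i ≠ j)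
    (hik : i ≠ k) (hjk : j ≠ k) :
    vol (P j) (P k) (comb P c) = c i * vol (P j) (P k) (P i) := by
  rw [comb_eq P c hij hik hjk]
  simp only [vol, Pi.add_apply, Pi.smul_apply, smul_eq_mul]
  ring

/-- Rigidity: if two pairs of triples share a side (opposite to the `i`-th vertex of the first
triple), lie on opposite sides of it, and are respectively congruent, then the pairs are
congruent. -/
theorem transfer_adjacent (hP : IsTriple P) (hQ : IsTriple Q) (hPQ : Congruent P Q)
    (hP' : IsTriple P') (hQ' : IsTriple Q') (hPQ' : Congruent P' Q')
    (i : Fin 3) (π : Equiv.Perm (Fin 3))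
    (hsP : ∀ j, j ≠ i → P' (π j) = P j) (hsQ : ∀ j, j ≠ i → Q' (π j) = Q j)
    (hoP : coord P (P' (π i)) i < 0) (hoQ : coord Q (Q' (π i)) i < 0) (l : Fin 3) :
    transfer P Q (P' l) = Q' l := by
  obtain ⟨m, rfl⟩ := π.surjective l
  by_cases hm : m = i
  swap
  · rw [hsP m hm, hsQ m hm, transfer_apply hP]
  subst hm
  obtain ⟨j, k, hmj, hmk, hjk⟩ : ∃ j k : Fin 3, m ≠ j ∧ m ≠ k ∧ j ≠ k := by
    clear * -; revert m; decide
  set X := transfer P Q (P' (π m)) with hX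
  set Y := Q' (π m) with hY
  have hcX : coord Q X m < 0 := by
    rw [hX, transfer, coord_comb hQ.ind]; exact hoP
  have fj : ∀ j, m ≠ j → form (Q j) X = form (Q j) Y := by
    intro j hj
    rw [hX, ← transfer_apply hP (Q := Q) j, form_transfer hP hPQ, transfer_apply hP,
      ← hsP j hj.symm, ← hsQ j hj.symm, hPQ']
  have fX : form X X = 1 := by rw [hX, form_transfer hP hPQ, hP'.unit]
  have fY : form Y Y = 1 := hQ'.unit _
  -- X and Y have the same products with the vectors of the common side and the same norm, so by the
  -- Gram determinant they have the same volume over that side up to sign. Lying on the same side of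
  -- it fixes the sign.
  have hv : vol (Q j) (Q k) X ^ 2 = vol (Q j) (Q k) Y ^ 2 := by
    rw [vol_sq, vol_sq, fj j hmj, fj k hmk, fX, fY]
  have eX : vol (Q j) (Q k) X = coord Q X m * vol (Q j) (Q k) (Q m) := by
    conv_lhs => rw [← comb_coord hQ.ind X]
    exact vol_comb Q _ hmj hmk hjk
  have eY : vol (Q j) (Q k) Y = coord Q Y m * vol (Q j) (Q k) (Q m) := by
    conv_lhs => rw [← comb_coord hQ.ind Y]
    exact vol_comb Q _ hmj hmk hjk
  have hv0 : vol (Q j) (Q k) (Q m) ≠ 0 := by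
    have h0 := hQ.ind
    intro h
    apply h0
    clear * - h hmj hmk hjk
    fin_cases m <;> fin_cases j <;> fin_cases k <;> simp_all [vol] <;> linarith
  have hc : coord Q X m = coord Q Y m := by
    rw [eX, eY, mul_pow, mul_pow] at hv
    have h1 := mul_right_cancel₀ (pow_ne_zero 2 hv0) hv
    have h2 : (-coord Q X m) ^ 2 = (-coord Q Y m) ^ 2 := by rw [neg_sq, neg_sq, h1]
    rw [sq_eq_sq₀ (by linarith) (by linarith)] at h2
    linarith
  have hvol : vol (Q j) (Q k) (X - Y) = 0 := by
    have : vol (Q j) (Q k) (X - Y) = vol (Q j) (Q k) X - vol (Q j) (Q k) Y := by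
      simp only [vol, Pi.sub_apply]; ring
    rw [this, eX, eY, hc, sub_self]
  have oj : ∀ j, m ≠ j → form (Q j) (X - Y) = 0 := by
    intro j hj
    have := fj j hj
    have : form (Q j) (X - Y) = form (Q j) X - form (Q j) Y := by
      simp only [form, Pi.sub_apply]; ring
    rw [this, fj j hj, sub_self]
  -- X − Y is orthogonal to both vectors of the side and coplanar with them, so the Gram identity
  -- reduces to the product of its norm with 1 − ⟨Q_j, Q_k⟩², which is nonzero by independence.
  have hg := vol_sq (Q j) (Q k) (X - Y)
  rw [hvol, oj j hmj, oj k hmk, hQ.unit, hQ.unit] at hg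
  have hgr : (1 - form (Q j) (Q k) ^ 2) ≠ 0 := by
    intro h0
    have := vol_sq (Q j) (Q k) (Q m)
    rw [hQ.unit, hQ.unit, hQ.unit] at this
    have h1 : form (Q j) (Q k) ^ 2 = 1 := by linarith
    have h3 : form (Q j) (Q k) = 1 := by
      have := form_lower (hQ.fwd j) (hQ.fwd k)
      nlinarith
    rw [h3] at this
    have h4 : vol (Q j) (Q k) (Q m) ^ 2 ≤ 0 := by
      rw [this]; nlinarith [sq_nonneg (form (Q k) (Q m) - form (Q j) (Q m))]
    exact hv0 (pow_eq_zero_iff two_ne_zero |>.1 (le_antisymm h4 (sq_nonneg _)))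
  have hw : form (X - Y) (X - Y) = 0 := by
    have : form (X - Y) (X - Y) * (1 - form (Q j) (Q k) ^ 2) = 0 := by linarith
    exact (mul_eq_zero.1 this).resolve_right hgr
  exact sub_eq_zero.1 (eq_zero_of_orthogonal (hQ.fwd j) (oj j hmj) hw.ge)

/-- The isometries provided by a pair of adjacent triples do not depend on the pair. -/
theorem isometryOf_adjacent (hP : IsTriple P) (hQ : IsTriple Q) (hPQ : Congruent P Q)
    (hP' : IsTriple P') (hQ' : IsTriple Q') (hPQ' : Congruent P' Q')
    (i : Fin 3) (π : Equiv.Perm (Fin 3))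
    (hsP : ∀ j, j ≠ i → P' (π j) = P j) (hsQ : ∀ j, j ≠ i → Q' (π j) = Q j)
    (hoP : coord P (P' (π i)) i < 0) (hoQ : coord Q (Q' (π i)) i < 0) :
    isometryOf hP hQ hPQ = isometryOf hP' hQ' hPQ' := by
  ext1 z
  rw [isometryOf_apply, isometryOf_apply]
  congr 1
  have key := transfer_adjacent hP hQ hPQ hP' hQ' hPQ' i π hsP hsQ hoP hoQ
  have hlin : ∀ c : Fin 3 → ℝ, transfer P Q (comb P' c) = comb Q' c := by
    intro c
    have hl : ∀ u v w : Fin 3 → ℝ, transfer P Q (u + v + w) =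
        transfer P Q u + transfer P Q v + transfer P Q w := by
      intro u v w
      ext l
      simp only [transfer, comb, coord, vol, Matrix.cons_val, Pi.add_apply, Pi.smul_apply,
        smul_eq_mul]
      ring
    rw [comb, hl, transfer_smul, transfer_smul, transfer_smul, key, key, key, comb]
  conv_lhs => rw [← comb_coord hP'.ind (ofUHP z)]
  rw [hlin, transfer]

end Mink

/-! ### Hyperbolic trigonometry -/

open Real in
/-- The angles of a hyperbolic triangle. -/
structure IsHypAngles (A : Fin 3 → ℝ) : Prop where
  pos : ∀ i, 0 < A i
  sum_lt : ∑ i, A i < π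

open Real in
/-- The hyperbolic cosine of the side opposite to the `i`-th vertex of the hyperbolic triangle
with angles `A`. -/
def sideCosh (A : Fin 3 → ℝ) (i : Fin 3) : ℝ :=
  (cos (A i) + cos (A (i + 1)) * cos (A (i + 2))) / (sin (A (i + 1)) * sin (A (i + 2)))

/-- The hyperbolic sine of the side opposite to the `i`-th vertex. -/
def sideSinh (A : Fin 3 → ℝ) (i : Fin 3) : ℝ := √(sideCosh A i ^ 2 - 1)

namespace IsHypAngles

open Real

variable {A : Fin 3 → ℝ}

theorem sum_eq (A : Fin 3 → ℝ) {i j k : Fin 3} (hij : i ≠ j) (hik : i ≠ k) (hjk : j ≠ k) :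
    ∑ l, A l = A i + A j + A k := by
  rw [Fin.sum_univ_three]
  fin_cases i <;> fin_cases j <;> fin_cases k <;> simp_all <;> ring

theorem exists_distinct (i : Fin 3) : ∃ j k : Fin 3, i ≠ j ∧ i ≠ k ∧ j ≠ k := by
  revert i; decide

theorem exists_third {i j : Fin 3} (h : i ≠ j) : ∃ k : Fin 3, i ≠ k ∧ j ≠ k := by
  revert i j; decide

theorem lt_pi (h : IsHypAngles A) (i : Fin 3) : A i < π := by
  obtain ⟨j, k, hij, hik, hjk⟩ := exists_distinct i
  have := h.sum_lt
  rw [sum_eq A hij hik hjk] at this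
  linarith [h.pos j, h.pos k]

theorem sin_pos (h : IsHypAngles A) (i : Fin 3) : 0 < sin (A i) :=
  sin_pos_of_pos_of_lt_pi (h.pos i) (h.lt_pi i)

theorem sideCosh_eq (A : Fin 3 → ℝ) {i j k : Fin 3} (hij : i ≠ j) (hik : i ≠ k) (hjk : j ≠ k) :
    sideCosh A i = (cos (A i) + cos (A j) * cos (A k)) / (sin (A j) * sin (A k)) := by
  have : (j = i + 1 ∧ k = i + 2) ∨ (j = i + 2 ∧ k = i + 1) := by
    revert i j k; decide
  rcases this with ⟨rfl, rfl⟩ | ⟨rfl, rfl⟩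
  · rfl
  · rw [sideCosh, mul_comm (cos (A (i + 1))), mul_comm (sin (A (i + 1)))]

/-- Sum-to-product gives a factored form in which every factor is positive because the angle sum is
below π. Its logarithm is the source of `HypPot.sideLog`. -/
theorem sideCosh_sub_one (h : IsHypAngles A) {i j k : Fin 3} (hij : i ≠ j) (hik : i ≠ k)
    (hjk : j ≠ k) : sideCosh A i - 1 =
      2 * cos ((A i + A j + A k) / 2) * cos ((A i + A j + A k) / 2 - A i) /
        (sin (A j) * sin (A k)) := by
  have hj := (h.sin_pos j).ne'
  have hk := (h.sin_pos k).ne'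
  rw [sideCosh_eq A hij hik hjk, ← sub_eq_zero]
  have e : 2 * cos ((A i + A j + A k) / 2) * cos ((A i + A j + A k) / 2 - A i) =
      cos (A i) + cos (A j + A k) := by
    rw [Real.two_mul_cos_mul_cos]
    congr 2 <;> ring
  rw [e, cos_add]
  field_simp
  ring

theorem one_lt_sideCosh (h : IsHypAngles A) (i : Fin 3) : 1 < sideCosh A i := by
  obtain ⟨j, k, hij, hik, hjk⟩ := exists_distinct i
  have h1 := h.sum_lt
  rw [sum_eq A hij hik hjk] at h1
  have hi := h.pos i
  have hj := h.pos j
  have hk := h.pos k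
  rw [← sub_pos, h.sideCosh_sub_one hij hik hjk]
  have c1 : 0 < cos ((A i + A j + A k) / 2) := cos_pos_of_mem_Ioo ⟨by linarith, by linarith⟩
  have c2 : 0 < cos ((A i + A j + A k) / 2 - A i) := cos_pos_of_mem_Ioo ⟨by linarith, by linarith⟩
  have := h.sin_pos j
  have := h.sin_pos k
  positivity

theorem sideSinh_pos (h : IsHypAngles A) (i : Fin 3) : 0 < sideSinh A i :=
  sqrt_pos.2 (by nlinarith [h.one_lt_sideCosh i])

theorem sideSinh_sq (h : IsHypAngles A) (i : Fin 3) : sideSinh A i ^ 2 = sideCosh A i ^ 2 - 1 :=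
  sq_sqrt (by nlinarith [h.one_lt_sideCosh i])

/-- The right-hand side is symmetric in the three angles, so this is the law of sines in disguise.
-/
theorem discr_eq (h : IsHypAngles A) {i j k : Fin 3} (hij : i ≠ j) (hik : i ≠ k) (hjk : j ≠ k) :
    sideSinh A i ^ 2 * (sin (A j) * sin (A k)) ^ 2 =
      cos (A i) ^ 2 + cos (A j) ^ 2 + cos (A k) ^ 2 + 2 * cos (A i) * cos (A j) * cos (A k) - 1 := by
  have hj := (h.sin_pos j).ne'
  have hk := (h.sin_pos k).ne'
  rw [h.sideSinh_sq, sideCosh_eq A hij hik hjk]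
  have e : (((cos (A i) + cos (A j) * cos (A k)) / (sin (A j) * sin (A k))) ^ 2 - 1) *
      (sin (A j) * sin (A k)) ^ 2 =
      (cos (A i) + cos (A j) * cos (A k)) ^ 2 - sin (A j) ^ 2 * sin (A k) ^ 2 := by
    field_simp
  rw [e, sin_sq, sin_sq]
  ring

/-- The law of cosines for the sides determined by the angles. -/
theorem law_of_cosines (h : IsHypAngles A) {i j k : Fin 3} (hij : i ≠ j) (hik : i ≠ k)
    (hjk : j ≠ k) : cos (A i) * (sideSinh A j * sideSinh A k) =
      sideCosh A j * sideCosh A k - sideCosh A i := by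
  have si := h.sin_pos i
  have sj := h.sin_pos j
  have sk := h.sin_pos k
  have tj := h.sideSinh_pos j
  have tk := h.sideSinh_pos k
  have dj := h.discr_eq hij.symm hjk hik
  have dk := h.discr_eq hik.symm hjk.symm hij
  set D := cos (A i) ^ 2 + cos (A j) ^ 2 + cos (A k) ^ 2 +
    2 * cos (A i) * cos (A j) * cos (A k) - 1 with hD
  have dj' : sideSinh A j ^ 2 * (sin (A i) * sin (A k)) ^ 2 = D := by rw [dj, hD]; ring
  have dk' : sideSinh A k ^ 2 * (sin (A i) * sin (A j)) ^ 2 = D := by rw [dk, hD]; ring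
  have e1 : sideSinh A j * (sin (A i) * sin (A k)) = sideSinh A k * (sin (A i) * sin (A j)) := by
    rw [← sq_eq_sq₀ (by positivity) (by positivity), mul_pow (sideSinh A j),
      mul_pow (sideSinh A k), dj', dk']
  have e2 : (sideSinh A j * sideSinh A k) * (sin (A i) ^ 2 * sin (A j) * sin (A k)) = D := by
    calc _ = sideSinh A j * (sin (A i) * sin (A k)) * (sideSinh A k * (sin (A i) * sin (A j))) := by
          ring
      _ = sideSinh A j ^ 2 * (sin (A i) * sin (A k)) ^ 2 := by rw [← e1]; ring
      _ = D := dj'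
  have e3 : sideSinh A j * sideSinh A k = D / (sin (A i) ^ 2 * sin (A j) * sin (A k)) := by
    rw [eq_div_iff (by positivity), e2]
  rw [e3, sideCosh_eq A hij hik hjk, sideCosh_eq A hij.symm hjk hik,
    sideCosh_eq A hik.symm hjk.symm hij, hD]
  have q := sin_sq (A i)
  field_simp
  rw [q]
  ring

end IsHypAngles

/-! ### Angles determine the sides -/

open Real in
/-- The dual hyperbolic law of cosines. -/
theorem dual_law_of_cosines {c₁ c₂ c₃ s₁ s₂ s₃ A B C : ℝ} (h₁ : s₁ ^ 2 = c₁ ^ 2 - 1)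
    (h₂ : s₂ ^ 2 = c₂ ^ 2 - 1) (h₃ : s₃ ^ 2 = c₃ ^ 2 - 1) (p₁ : 0 < s₁) (p₂ : 0 < s₂) (p₃ : 0 < s₃)
    (hA : cos A * (s₂ * s₃) = c₂ * c₃ - c₁) (hB : cos B * (s₁ * s₃) = c₁ * c₃ - c₂)
    (hC : cos C * (s₁ * s₂) = c₁ * c₂ - c₃) (hsB : 0 ≤ sin B) (hsC : 0 ≤ sin C) :
    c₁ * (sin B * sin C) = cos A + cos B * cos C := by
  -- G is the Gram determinant of the triangle. Both sin B · s₁s₃ and sin C · s₁s₂ are its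
  -- nonnegative square root, which is the law of sines.
  set G := 1 + 2 * c₁ * c₂ * c₃ - c₁ ^ 2 - c₂ ^ 2 - c₃ ^ 2 with hG
  have eB : (sin B * (s₁ * s₃)) ^ 2 = G := by
    have : (sin B * (s₁ * s₃)) ^ 2 = s₁ ^ 2 * s₃ ^ 2 - (cos B * (s₁ * s₃)) ^ 2 := by
      rw [mul_pow, sin_sq]; ring
    rw [this, hB, h₁, h₃, hG]; ring
  have eC : (sin C * (s₁ * s₂)) ^ 2 = G := by
    have : (sin C * (s₁ * s₂)) ^ 2 = s₁ ^ 2 * s₂ ^ 2 - (cos C * (s₁ * s₂)) ^ 2 := by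
      rw [mul_pow, sin_sq]; ring
    rw [this, hC, h₁, h₂, hG]; ring
  have e : sin B * (s₁ * s₃) = sin C * (s₁ * s₂) := by
    rw [← sq_eq_sq₀ (by positivity) (by positivity), eB, eC]
  have e2 : (sin B * sin C) * (s₁ ^ 2 * s₂ * s₃) = G := by
    calc _ = sin B * (s₁ * s₃) * (sin C * (s₁ * s₂)) := by ring
      _ = G := by rw [← e, ← sq, eB]
  have hp : s₁ ^ 2 * s₂ * s₃ ≠ 0 := by positivity
  apply mul_right_cancel₀ hp
  have e3 : cos A * (s₁ ^ 2 * s₂ * s₃) = (c₂ * c₃ - c₁) * (c₁ ^ 2 - 1) := by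
    rw [← hA, ← h₁]; ring
  have e4 : cos B * cos C * (s₁ ^ 2 * s₂ * s₃) = (c₁ * c₃ - c₂) * (c₁ * c₂ - c₃) := by
    rw [← hB, ← hC]; ring
  rw [mul_assoc, e2, add_mul, e3, e4, hG]
  ring

/-- The sides of a geodesic triangle are determined by its angles. -/
theorem Mink.form_eq_sideCosh {p : Fin 3 → ℍ} (hp : Function.Injective p) {A : Fin 3 → ℝ}
    (hA : IsHypAngles A)
    (h : ∀ i j k, i ≠ j → i ≠ k → j ≠ k → hypAngle (p i) (p j) (p k) = A i)
    {i j k : Fin 3} (hij : i ≠ j) (hik : i ≠ k) (hjk : j ≠ k) :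
    form (ofUHP (p j)) (ofUHP (p k)) = sideCosh A i := by
  have sp : ∀ {i j : Fin 3}, i ≠ j → 0 < Real.sinh (dist (p i) (p j)) := fun hij =>
    Real.sinh_pos_iff.2 (dist_pos.2 fun he => hij (hp he))
  have law : ∀ {i j k : Fin 3}, i ≠ j → i ≠ k → j ≠ k → _ := fun {i j k} hij hik hjk =>
    cos_hypAngle (a := p i) (b := p j) (c := p k) (fun he => hij (hp he)) (fun he => hik (hp he))
  have l1 := law hij hik hjk
  have l2 := law hij.symm hjk hik
  have l3 := law hik.symm hjk.symm hij
  rw [h _ _ _ hij hik hjk] at l1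
  rw [h _ _ _ hij.symm hjk hik, dist_comm (p j) (p i), form_comm (ofUHP (p j)) (ofUHP (p i))] at l2
  rw [h _ _ _ hik.symm hjk.symm hij, dist_comm (p k) (p i), dist_comm (p k) (p j),
    form_comm (ofUHP (p k)) (ofUHP (p i)), form_comm (ofUHP (p k)) (ofUHP (p j))] at l3
  have key := dual_law_of_cosines (sinh_dist_sq (p j) (p k)) (sinh_dist_sq (p i) (p k))
    (sinh_dist_sq (p i) (p j)) (sp hjk) (sp hik) (sp hij) (A := A i) (B := A j) (C := A k)
    (by linarith) (by linarith) (by linarith) (hA.sin_pos j).le (hA.sin_pos k).le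
  rw [IsHypAngles.sideCosh_eq A hij hik hjk, eq_div_iff
    (mul_pos (hA.sin_pos j) (hA.sin_pos k)).ne']
  exact key

/-! ### Geodesic triangles with prescribed angles -/

namespace Mink

/-- The point with polar coordinates given by the hyperbolic cosine and sine of the radius and the
direction. -/
def polar (c s α : ℝ) : Fin 3 → ℝ := ![c, s * Real.cos α, s * Real.sin α]

theorem form_polar (c s α c' s' α' : ℝ) : form (polar c s α) (polar c' s' α') =
    c * c' - s * s' * Real.cos (α' - α) := by
  simp only [form, polar, Matrix.cons_val, Real.cos_sub]; ring

/-- The triple `P` spans a geodesic triangle with angles `A`. -/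
structure HasAngles (A : Fin 3 → ℝ) (P : Fin 3 → Fin 3 → ℝ) : Prop extends IsTriple P where
  side : ∀ i j k, i ≠ j → i ≠ k → j ≠ k → form (P j) (P k) = sideCosh A i

variable {A : Fin 3 → ℝ} {P Q : Fin 3 → Fin 3 → ℝ}

theorem HasAngles.congruent (hP : HasAngles A P) (hQ : HasAngles A Q) : Congruent P Q := by
  intro i j
  rcases eq_or_ne i j with rfl | hij
  · rw [hP.unit, hQ.unit]
  · obtain ⟨k, hik, hjk⟩ := IsHypAngles.exists_third hij
    rw [hP.side k i j hik.symm hjk.symm hij, hQ.side k i j hik.symm hjk.symm hij]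

/-- The triangle with angles `A`, with the `i`-th vertex at the base point, with the side towards
the vertex `j` in the direction `α` and the side towards the third vertex in the direction
`α + ε * A i`, where `ε = ± 1`. -/
def place (A : Fin 3 → ℝ) (i j : Fin 3) (α ε : ℝ) (l : Fin 3) : Fin 3 → ℝ :=
  -- In `Fin 3` the index different from i and j is −(i + j), because 0 + 1 + 2 = 0 there.
  if l = i then polar 1 0 0 else if l = j then polar (sideCosh A (-(i + j))) (sideSinh A (-(i + j))) α
    else polar (sideCosh A j) (sideSinh A j) (α + ε * A i)

theorem place_fst (A : Fin 3 → ℝ) (i j : Fin 3) (α ε : ℝ) : place A i j α ε i = polar 1 0 0 := by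
  simp [place]

theorem place_snd (A : Fin 3 → ℝ) {i j k : Fin 3} (hij : i ≠ j) (hik : i ≠ k) (hjk : j ≠ k)
    (α ε : ℝ) : place A i j α ε j = polar (sideCosh A k) (sideSinh A k) α := by
  have : -(i + j) = k := by revert i j k; decide
  simp [place, hij.symm, this]

theorem place_third (A : Fin 3 → ℝ) {i j k : Fin 3} (hik : i ≠ k) (hjk : j ≠ k)
    (α ε : ℝ) : place A i j α ε k = polar (sideCosh A j) (sideSinh A j) (α + ε * A i) := by
  simp [place, hik.symm, hjk.symm]

/-- Independence is automatic: by the law of cosines the squared volume is the square of sin A₀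
times the two adjacent hyperbolic sines, which is positive. -/
theorem isTriple_of_forms (hA : IsHypAngles A) (unit : ∀ i, form (P i) (P i) = 1)
    (pos : ∀ i, 0 < P i 0)
    (side : ∀ i j k, i ≠ j → i ≠ k → j ≠ k → form (P j) (P k) = sideCosh A i) : HasAngles A P := by
  refine ⟨⟨unit, pos, fun h => ?_⟩, side⟩
  have h1 := vol_sq (P 0) (P 1) (P 2)
  rw [h, unit, unit, unit, side 2 0 1 (by decide) (by decide) (by decide),
    side 0 1 2 (by decide) (by decide) (by decide),
    side 1 0 2 (by decide) (by decide) (by decide)] at h1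
  have h2 := hA.law_of_cosines (i := 0) (j := 1) (k := 2) (by decide) (by decide) (by decide)
  have h3 : (Real.sin (A 0) * (sideSinh A 1 * sideSinh A 2)) ^ 2 = 0 := by
    have e : (Real.sin (A 0) * (sideSinh A 1 * sideSinh A 2)) ^ 2 =
        sideSinh A 1 ^ 2 * sideSinh A 2 ^ 2 -
          (Real.cos (A 0) * (sideSinh A 1 * sideSinh A 2)) ^ 2 := by
      rw [mul_pow, Real.sin_sq]; ring
    rw [e, h2, hA.sideSinh_sq, hA.sideSinh_sq]
    linarith
  have := hA.sin_pos 0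
  have := hA.sideSinh_pos 1
  have := hA.sideSinh_pos 2
  have : 0 < (Real.sin (A 0) * (sideSinh A 1 * sideSinh A 2)) ^ 2 := by positivity
  linarith

theorem hasAngles_place (hA : IsHypAngles A) {i j : Fin 3} (hij : i ≠ j) (α : ℝ) {ε : ℝ}
    (hε : ε = 1 ∨ ε = -1) : HasAngles A (place A i j α ε) := by
  obtain ⟨k, hik, hjk⟩ := IsHypAngles.exists_third hij
  have hcos : Real.cos (ε * A i) = Real.cos (A i) := by
    rcases hε with rfl | rfl <;> simp
  have hl : ∀ l, l = i ∨ l = j ∨ l = k := by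
    clear * - hij hik hjk; revert i j k; decide
  have ei := place_fst A i j α ε
  have ej := place_snd A hij hik hjk α ε
  have ek := place_third A hik hjk α ε
  have h1 := hA.one_lt_sideCosh
  have law := hA.law_of_cosines hij hik hjk
  have fij : form (place A i j α ε i) (place A i j α ε j) = sideCosh A k := by
    rw [ei, ej, form_polar]; ring
  have fik : form (place A i j α ε i) (place A i j α ε k) = sideCosh A j := by
    rw [ei, ek, form_polar]; ring
  have fjk : form (place A i j α ε j) (place A i j α ε k) = sideCosh A i := by
    rw [ej, ek, form_polar, add_sub_cancel_left, hcos]; linarith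
  refine isTriple_of_forms hA ?_ ?_ ?_
  · intro l
    rcases hl l with rfl | rfl | rfl
    · rw [ei, form_polar]; ring
    · rw [ej, form_polar, sub_self, Real.cos_zero]; linarith [hA.sideSinh_sq k]
    · rw [ek, form_polar, sub_self, Real.cos_zero]; linarith [hA.sideSinh_sq j]
  · intro l
    rcases hl l with rfl | rfl | rfl
    · rw [ei]; simp [polar]
    · rw [ej]; simpa [polar] using zero_lt_one.trans (h1 k)
    · rw [ek]; simpa [polar] using zero_lt_one.trans (h1 j)
  · intro l m n hlm hln hmn
    rcases hl l with rfl | rfl | rfl <;> rcases hl m with rfl | rfl | rfl <;>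
      rcases hl n with rfl | rfl | rfl <;>
      first
      | exact absurd rfl hlm
      | exact absurd rfl hln
      | exact absurd rfl hmn
      | assumption
      | (rw [form_comm]; assumption)

theorem point_vertex (hP : IsTriple P) (i : Fin 3) :
    ofUHP (point P (StdTriangle.vertex i).1) = P i := by
  rw [point, StdTriangle.vertex, comb_single]
  exact toUHP_of_form_eq_one (hP.fwd i) (hP.unit i)

/-- Normalization of nonnegative coordinates. -/
theorem exists_std_of_nonneg {c : Fin 3 → ℝ} (hc : ∀ i, 0 ≤ c i) (h0 : c ≠ 0) :
    ∃ (y : StdTriangle) (s : ℝ), 0 < s ∧ c = s • y.1 := by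
  have hs : 0 < ∑ i, c i := by
    refine lt_of_le_of_ne (Finset.sum_nonneg fun i _ => hc i) fun h => h0 ?_
    have := (Finset.sum_eq_zero_iff_of_nonneg fun i _ => hc i).1 h.symm
    exact funext fun i => this i (Finset.mem_univ i)
  refine ⟨⟨(∑ i, c i)⁻¹ • c, fun i => mul_nonneg (inv_nonneg.2 hs.le) (hc i), ?_⟩, _, hs, ?_⟩
  · simp only [Pi.smul_apply, smul_eq_mul, ← Finset.mul_sum]
    exact inv_mul_cancel₀ hs.ne'
  · simp only [smul_smul, mul_inv_cancel₀ hs.ne', one_smul]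

/-- A point depends only on the ray of its coordinates, so nonnegative coordinates may be normalized
to barycentric ones. -/
theorem exists_std_point (hP : IsTriple P) {z : ℍ} {c : Fin 3 → ℝ} (hc : ∀ i, 0 ≤ c i)
    (hz : ofUHP z = comb P c) : ∃ (y : StdTriangle) (s : ℝ), 0 < s ∧ c = s • y.1 ∧
      point P y.1 = z := by
  have h0 : c ≠ 0 := by
    rintro rfl
    have h1 := (fwd_ofUHP z).2
    rw [hz] at h1
    simp [comb] at h1
  obtain ⟨y, s, hs, rfl⟩ := exists_std_of_nonneg hc h0
  refine ⟨y, s, hs, rfl, ?_⟩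
  rw [point, ← toUHP_smul hs (fwd_comb_std hP y), ← comb_smul, ← hz, toUHP_ofUHP]

theorem ofUHP_point (hP : IsTriple P) (y : StdTriangle) :
    ∃ s : ℝ, 0 < s ∧ ofUHP (point P y.1) = comb P (s • y.1) := by
  refine ⟨_, inv_pos.2 (Real.sqrt_pos.2 (fwd_comb_std hP y).1), ?_⟩
  rw [point, ofUHP_toUHP (fwd_comb_std hP y), comb_smul]

theorem continuous_point (hP : IsTriple P) : Continuous fun y : StdTriangle => point P y.1 :=
  continuousOn_toUHP.comp_continuous ((continuous_comb P).comp continuous_subtype_val)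
    fun y => fwd_comb_std hP y

theorem std_eq_of_smul {y y' : StdTriangle} {s s' : ℝ} (hs' : 0 < s')
    (h : s • y.1 = s' • y'.1) : y = y' := by
  have e : ∀ (s : ℝ) (y : StdTriangle), ∑ i, (s • y.1) i = s := by
    intro s y
    simp only [Pi.smul_apply, smul_eq_mul, ← Finset.mul_sum]
    rw [y.2.2, mul_one]
  have : s = s' := by rw [← e s y, ← e s' y', h]
  subst this
  exact Subtype.ext (smul_right_injective _ hs'.ne' h)

theorem point_injective (hP : IsTriple P) : Function.Injective fun y : StdTriangle =>
    point P y.1 := by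
  intro y y' h
  obtain ⟨s, hs, e⟩ := ofUHP_point hP y
  obtain ⟨s', hs', e'⟩ := ofUHP_point hP y'
  have h' : point P y.1 = point P y'.1 := h
  rw [h', e'] at e
  have := congrArg (coord P) e
  rw [coord_comb hP.ind, coord_comb hP.ind] at this
  exact std_eq_of_smul hs' this.symm

/-- A triple with given angles provides a realization of the standard triangle. -/
theorem HasAngles.isHypRealization (hA : IsHypAngles A) (h : HasAngles A P) :
    IsHypRealization A fun y : StdTriangle => point P y.1 where
  continuous := continuous_point h.toIsTriple
  injective := point_injective h.toIsTriple
  range_eq := by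
    have hP := h.toIsTriple
    ext z
    constructor
    · rintro ⟨y, rfl⟩
      obtain ⟨s, hs, e⟩ := ofUHP_point hP y
      -- A point other than the vertex 0 is projected from that vertex to the opposite side. At the
      -- vertex itself the projection is undefined and any point of the opposite side serves.
      by_cases h0 : y.1 1 = 0 ∧ y.1 2 = 0
      · refine ⟨point P (StdTriangle.vertex 1).1, mem_hypSegment_iff.2
          ⟨1, 0, zero_le_one, le_rfl, by simp⟩, mem_hypSegment_iff.2 ⟨s * y.1 0, 0, ?_, le_rfl, ?_⟩⟩
        · exact mul_nonneg hs.le (y.2.1 0)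
        · beta_reduce
          rw [e, point_vertex hP]
          simp [comb, h0.1, h0.2]
      -- Projection from the vertex 0 deletes the coordinate with index 0.
      · set c : Fin 3 → ℝ := ![0, y.1 1, y.1 2] with hc
        have hc0 : c ≠ 0 := fun hc0 => h0 ⟨congrFun hc0 1, congrFun hc0 2⟩
        have hcn : ∀ i, 0 ≤ c i := by
          intro i
          fin_cases i
          exacts [le_rfl, y.2.1 1, y.2.1 2]
        obtain ⟨y', s', hs', hy'⟩ := exists_std_of_nonneg hcn hc0
        obtain ⟨s'', hs'', e'⟩ := ofUHP_point hP y'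
        have hy0 : y'.1 0 = 0 := by
          have := congrFun hy' 0
          simp only [hc, Matrix.cons_val, Pi.smul_apply, smul_eq_mul] at this
          exact (mul_eq_zero.1 this.symm).resolve_left hs'.ne'
        have hy1 : y.1 1 = s' * y'.1 1 := congrFun hy' 1
        have hy2 : y.1 2 = s' * y'.1 2 := congrFun hy' 2
        refine ⟨point P y'.1, mem_hypSegment_iff.2 ⟨s'' * y'.1 1, s'' * y'.1 2,
          mul_nonneg hs''.le (y'.2.1 1), mul_nonneg hs''.le (y'.2.1 2), ?_⟩,
          mem_hypSegment_iff.2 ⟨s * y.1 0, s * s' / s'', mul_nonneg hs.le (y.2.1 0), by positivity,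
            ?_⟩⟩
        · rw [e', point_vertex hP, point_vertex hP]
          simp [comb, hy0]
        · beta_reduce
          rw [e, e', point_vertex hP]
          simp only [comb, Pi.smul_apply, smul_eq_mul, hy0, hy1, hy2, mul_zero, zero_smul, zero_add,
            smul_add, smul_smul, add_assoc]
          congr 2
          · congr 1; field_simp
          · congr 1; field_simp
    · rintro ⟨w, hw, hz⟩
      obtain ⟨γ, δ, hγ, hδ, ew⟩ := mem_hypSegment_iff.1 hw
      obtain ⟨α, β, hα, hβ, ez⟩ := mem_hypSegment_iff.1 hz
      have ez' : ofUHP z = comb P ![α, β * γ, β * δ] := by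
        rw [ez, ew]
        rw [point_vertex hP, point_vertex hP, point_vertex hP]
        simp [comb, smul_smul, add_assoc]
      obtain ⟨y, -, -, -, hy⟩ := exists_std_point hP (c := ![α, β * γ, β * δ]) (by
        intro i
        fin_cases i
        exacts [hα, mul_nonneg hβ hγ, mul_nonneg hβ hδ]) ez'
      exact ⟨y, hy⟩
  side := by
    intro i j hij
    have hP := h.toIsTriple
    obtain ⟨k, hik, hjk⟩ := IsHypAngles.exists_third hij
    have hl : ∀ l, l ≠ i → l ≠ j → l = k := by
      clear * - hij hik hjk; revert i j k; decide
    ext z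
    constructor
    · rintro ⟨y, hy, rfl⟩
      obtain ⟨s, hs, e⟩ := ofUHP_point hP y
      have hk : y.1 k = 0 := hy k (by simp [hik.symm, hjk.symm])
      refine mem_hypSegment_iff.2 ⟨s * y.1 i, s * y.1 j, mul_nonneg hs.le (y.2.1 i),
        mul_nonneg hs.le (y.2.1 j), ?_⟩
      beta_reduce
      rw [e, point_vertex hP, point_vertex hP, comb_eq P _ hij hik hjk]
      simp [hk]
    · intro hz
      obtain ⟨α, β, hα, hβ, ez⟩ := mem_hypSegment_iff.1 hz
      rw [point_vertex hP, point_vertex hP] at ez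
      have ez' : ofUHP z = comb P (Pi.single i α + Pi.single j β) := by
        rw [ez, comb_eq P _ hij hik hjk]
        simp [hij, hij.symm, hik.symm, hjk.symm]
      obtain ⟨y, s, hs, hc, hy⟩ := exists_std_point hP (by
        intro l
        simp only [Pi.add_apply, Pi.single_apply]
        positivity) ez'
      refine ⟨y, fun l hl' => ?_, hy⟩
      simp only [mem_insert_iff, mem_singleton_iff, not_or] at hl'
      have := congrFun hc l
      simp only [Pi.add_apply, Pi.single_apply, hl'.1, hl'.2, if_false, add_zero, Pi.smul_apply,
        smul_eq_mul] at this
      exact (mul_eq_zero.1 this.symm).resolve_left hs.ne'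
  angle := by
    intro i j k hij hik hjk
    have hP := h.toIsTriple
    have inj := point_injective hP
    have hv : ∀ {i j : Fin 3}, i ≠ j → point P (StdTriangle.vertex i).1 ≠
        point P (StdTriangle.vertex j).1 := by
      intro i j hij he
      have h1 := congrArg (coord P ∘ ofUHP) he
      simp only [Function.comp, point_vertex hP] at h1
      rw [← comb_single P i, ← comb_single P j, coord_comb hP.ind, coord_comb hP.ind] at h1
      have := congrFun h1 i
      simp [hij] at this
    have key := cos_hypAngle (hv hij) (hv hik)
    rw [sinh_dist_eq, sinh_dist_eq, point_vertex hP, point_vertex hP, point_vertex hP,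
      h.side k i j hik.symm hjk.symm hij, h.side j i k hij.symm hjk hik,
      h.side i j k hij hik hjk] at key
    have law := hA.law_of_cosines hij hik hjk
    have hcos : Real.cos (hypAngle (point P (StdTriangle.vertex i).1)
        (point P (StdTriangle.vertex j).1) (point P (StdTriangle.vertex k).1)) = Real.cos (A i) := by
      have hpos := mul_pos (hA.sideSinh_pos k) (hA.sideSinh_pos j)
      apply mul_right_cancel₀ hpos.ne'
      have key' : _ * (sideSinh A k * sideSinh A j) = _ := key
      rw [key']
      linarith
    exact Real.injOn_cos ⟨InnerProductGeometry.angle_nonneg _ _,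
      InnerProductGeometry.angle_le_pi _ _⟩ ⟨(hA.pos i).le, (hA.lt_pi i).le⟩ hcos

end Mink

/-! ### The concave functional of a triangle -/

namespace HypPot

open Real

variable {A v : Fin 3 → ℝ}

/-- Half the angle sum. -/
def halfSum (A : Fin 3 → ℝ) : ℝ := (∑ i, A i) / 2

/-- The logarithm of the square of the hyperbolic sine of half the side opposite to the `i`-th
vertex. -/
def sideLog (A : Fin 3 → ℝ) (i : Fin 3) : ℝ :=
  log (cos (halfSum A)) + log (cos (halfSum A - A i)) - (∑ j, log (sin (A j)) - log (sin (A i)))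

/-- The derivative of the functional at `A` in the direction `v`. -/
def slope (A v : Fin 3 → ℝ) : ℝ :=
  halfSum v * log (cos (halfSum A)) + ∑ i, (halfSum v - v i) * log (cos (halfSum A - A i)) -
    ∑ i, v i * log (sin (A i))

theorem slope_eq_sum_sideLog (A v : Fin 3 → ℝ) :
    slope A v = ∑ i, (halfSum v - v i) * sideLog A i := by
  have hv : halfSum v = (v 0 + v 1 + v 2) / 2 := by rw [halfSum, Fin.sum_univ_three]
  simp only [slope, sideLog, Fin.sum_univ_three, hv]
  ring

theorem halfSum_eq (A : Fin 3 → ℝ) {i j k : Fin 3} (hij : i ≠ j) (hik : i ≠ k) (hjk : j ≠ k) :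
    halfSum A = (A i + A j + A k) / 2 := by rw [halfSum, IsHypAngles.sum_eq A hij hik hjk]

theorem halfSum_pos (h : IsHypAngles A) : 0 < halfSum A := by
  have h0 := h.pos 0
  have h1 := h.pos 1
  have h2 := h.pos 2
  rw [halfSum, Fin.sum_univ_three]
  linarith

theorem halfSum_lt (h : IsHypAngles A) : halfSum A < π / 2 := by
  have := h.sum_lt
  rw [halfSum]; linarith

theorem theta_mem (h : IsHypAngles A) (i : Fin 3) : halfSum A - A i ∈ Ioo (-(π / 2)) (π / 2) := by
  obtain ⟨j, k, hij, hik, hjk⟩ := IsHypAngles.exists_distinct i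
  have h1 := h.sum_lt
  have hi := h.pos i
  have hj := h.pos j
  have hk := h.pos k
  rw [IsHypAngles.sum_eq A hij hik hjk] at h1
  rw [halfSum_eq A hij hik hjk]
  constructor <;> linarith

theorem cos_halfSum_pos (h : IsHypAngles A) : 0 < cos (halfSum A) :=
  cos_pos_of_mem_Ioo ⟨by linarith [halfSum_pos h, pi_pos], halfSum_lt h⟩

theorem cos_theta_pos (h : IsHypAngles A) (i : Fin 3) : 0 < cos (halfSum A - A i) :=
  cos_pos_of_mem_Ioo (theta_mem h i)

/-- Since cosh l − 1 = 2 sinh²(l/2), comparing the logarithms is the same as comparing the side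
lengths. -/
theorem exp_sideLog (h : IsHypAngles A) (i : Fin 3) :
    2 * exp (sideLog A i) = sideCosh A i - 1 := by
  obtain ⟨j, k, hij, hik, hjk⟩ := IsHypAngles.exists_distinct i
  rw [h.sideCosh_sub_one hij hik hjk, ← halfSum_eq A hij hik hjk, sideLog,
    show (∑ j, log (sin (A j)) - log (sin (A i))) = log (sin (A j)) + log (sin (A k)) by
      rw [IsHypAngles.sum_eq (fun j => log (sin (A j))) hij hik hjk]; ring,
    exp_sub, exp_add, exp_add, exp_log (cos_halfSum_pos h), exp_log (cos_theta_pos h i),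
    exp_log (h.sin_pos j), exp_log (h.sin_pos k)]
  ring

theorem sideLog_eq_iff {A' : Fin 3 → ℝ} (h : IsHypAngles A) (h' : IsHypAngles A') (i i' : Fin 3) :
    sideLog A i = sideLog A' i' ↔ sideCosh A i = sideCosh A' i' := by
  have e := exp_sideLog h i
  have e' := exp_sideLog h' i'
  constructor
  · intro hs
    rw [hs] at e
    linarith
  · intro hs
    apply exp_injective
    linarith

/-- The form `cot a p² + cot b q² + cot c (p + q)²` for the angles of a euclidean triangle. -/
theorem cot_form {a b c : ℝ} (ha : 0 < sin a) (hb : 0 < sin b) (hc : 0 < sin c)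
    (h : a + b + c = π) (p q : ℝ) :
    0 ≤ cos a / sin a * p ^ 2 + cos b / sin b * q ^ 2 + cos c / sin c * (p + q) ^ 2 ∧
    (cos a / sin a * p ^ 2 + cos b / sin b * q ^ 2 + cos c / sin c * (p + q) ^ 2 = 0 →
      p = 0 ∧ q = 0) := by
  have eb : sin b = sin a * cos c + cos a * sin c := by
    rw [← sin_add, show a + c = π - b by linarith, sin_pi_sub]
  have eb' : cos b = sin a * sin c - cos a * cos c := by
    rw [show b = π - (a + c) by linarith, cos_pi_sub, cos_add]; ring
  set x := cos a / sin a with hx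
  set y := cos b / sin b with hy
  set z := cos c / sin c with hz
  have hxz : x + z = sin b / (sin a * sin c) := by
    rw [hx, hz, eb]; field_simp; ring
  have hpos : 0 < x + z := by rw [hxz]; positivity
  -- The cotangents of angles with sum π satisfy xy + yz + zx = 1, so the form in p and q has
  -- determinant 1. As x + z is positive, completing the square gives definiteness.
  have hdet : x * y + y * z + z * x = 1 := by
    have : y * (x + z) = 1 - x * z := by
      rw [hxz, hy, hx, hz, eb']
      field_simp
    linarith
  have key : (x + z) * (x * p ^ 2 + y * q ^ 2 + z * (p + q) ^ 2) =
      ((x + z) * p + z * q) ^ 2 + q ^ 2 := by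
    linear_combination q ^ 2 * hdet
  constructor
  · by_contra hn
    have := mul_neg_of_pos_of_neg hpos (not_le.1 hn)
    nlinarith [sq_nonneg ((x + z) * p + z * q), sq_nonneg q]
  · intro h0
    rw [h0, mul_zero] at key
    have hq : q = 0 := by
      apply pow_eq_zero_iff two_ne_zero |>.1
      nlinarith [sq_nonneg ((x + z) * p + z * q), sq_nonneg q]
    subst hq
    have : (x + z) * p = 0 := by
      apply pow_eq_zero_iff two_ne_zero |>.1
      nlinarith
    exact ⟨(mul_eq_zero.1 this).resolve_left hpos.ne', rfl⟩

/-- Minus the second derivative of the functional at `A` in the direction `v`. -/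
def hess (A v : Fin 3 → ℝ) : ℝ :=
  tan (halfSum A) * halfSum v ^ 2 + ∑ i, tan (halfSum A - A i) * (halfSum v - v i) ^ 2 +
    ∑ i, cos (A i) / sin (A i) * v i ^ 2

/-- The form is assembled from euclidean cotangent forms: 3·hess is twice the sum of the three forms
in `T1` plus the sum of the three forms in `T2`. Definiteness comes from `T1`, whose vanishing for
each i kills each v i. -/
theorem hess_nonneg (h : IsHypAngles A) (v : Fin 3 → ℝ) :
    0 ≤ hess A v ∧ (hess A v = 0 → v = 0) := by
  -- The angles π/2 − θ_j, π/2 − θ_k and A_i add up to π, where θ_j = σ − A_j and σ is half the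
  -- angle sum.
  have T1 : ∀ i j k : Fin 3, i ≠ j → i ≠ k → j ≠ k →
      0 ≤ tan (halfSum A - A j) * (halfSum v - v j) ^ 2 +
        tan (halfSum A - A k) * (halfSum v - v k) ^ 2 + cos (A i) / sin (A i) * v i ^ 2 ∧
      (tan (halfSum A - A j) * (halfSum v - v j) ^ 2 +
        tan (halfSum A - A k) * (halfSum v - v k) ^ 2 + cos (A i) / sin (A i) * v i ^ 2 = 0 →
        v i = 0) := by
    intro i j k hij hik hjk
    have := cot_form (a := π / 2 - (halfSum A - A j)) (b := π / 2 - (halfSum A - A k)) (c := A i)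
      (by rw [sin_pi_div_two_sub]; exact cos_theta_pos h j)
      (by rw [sin_pi_div_two_sub]; exact cos_theta_pos h k) (h.sin_pos i)
      (by rw [halfSum_eq A hij hik hjk]; ring) (halfSum v - v j) (halfSum v - v k)
    have e : halfSum v - v j + (halfSum v - v k) = v i := by
      rw [halfSum_eq v hij hik hjk]; ring
    rw [e] at this
    simp only [sin_pi_div_two_sub, cos_pi_div_two_sub, ← tan_eq_sin_div_cos] at this
    refine ⟨this.1, fun h0 => ?_⟩
    have := this.2 h0
    linarith
  -- The angles π/2 − σ, A_i and π/2 + θ_i add up to π. The cotangent of the last is −tan θ_i, hence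
  -- the minus sign.
  have T2 : ∀ i j k : Fin 3, i ≠ j → i ≠ k → j ≠ k →
      0 ≤ tan (halfSum A) * halfSum v ^ 2 + cos (A i) / sin (A i) * v i ^ 2 -
        tan (halfSum A - A i) * (halfSum v - v i) ^ 2 := by
    intro i j k hij hik hjk
    have := cot_form (a := π / 2 - halfSum A) (b := A i) (c := (halfSum A - A i) + π / 2)
      (by rw [sin_pi_div_two_sub]; exact cos_halfSum_pos h)
      (h.sin_pos i) (by rw [sin_add_pi_div_two]; exact cos_theta_pos h i)
      (by ring) (halfSum v) (- v i)
    simp only [sin_pi_div_two_sub, cos_pi_div_two_sub, ← tan_eq_sin_div_cos, sin_add_pi_div_two,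
      cos_add_pi_div_two, neg_div] at this
    have h1 := this.1
    linarith
  have a0 := T1 0 1 2 (by decide) (by decide) (by decide)
  have a1 := T1 1 0 2 (by decide) (by decide) (by decide)
  have a2 := T1 2 0 1 (by decide) (by decide) (by decide)
  have b0 := T2 0 1 2 (by decide) (by decide) (by decide)
  have b1 := T2 1 0 2 (by decide) (by decide) (by decide)
  have b2 := T2 2 0 1 (by decide) (by decide) (by decide)
  simp only [hess, Fin.sum_univ_three]
  constructor
  · linarith [a0.1, a1.1, a2.1]
  · intro h0
    have c0 := a0.2 (by linarith [a0.1, a1.1, a2.1])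
    have c1 := a1.2 (by linarith [a0.1, a1.1, a2.1])
    have c2 := a2.2 (by linarith [a0.1, a1.1, a2.1])
    ext i
    fin_cases i <;> assumption

/-! ### Derivative of the slope and concavity along lines -/

theorem halfSum_line (A v : Fin 3 → ℝ) (s : ℝ) :
    halfSum (A + s • v) = halfSum A + s * halfSum v := by
  simp only [halfSum, Fin.sum_univ_three, Pi.add_apply, Pi.smul_apply, smul_eq_mul]; ring

theorem hasDerivAt_line (a b s : ℝ) : HasDerivAt (fun s : ℝ => a + s * b) b s := by
  simpa using ((hasDerivAt_id s).mul_const b).const_add a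

theorem hasDerivAt_halfSum (A v : Fin 3 → ℝ) (s : ℝ) :
    HasDerivAt (fun s : ℝ => halfSum (A + s • v)) (halfSum v) s := by
  simp only [halfSum_line]
  exact hasDerivAt_line _ _ _

theorem hasDerivAt_apply (A v : Fin 3 → ℝ) (i : Fin 3) (s : ℝ) :
    HasDerivAt (fun s : ℝ => (A + s • v) i) (v i) s := by
  simpa using hasDerivAt_line (A i) (v i) s

theorem hasDerivAt_slope {s : ℝ} (h : IsHypAngles (A + s • v)) :
    HasDerivAt (fun s : ℝ => slope (A + s • v) v) (-hess (A + s • v) v) s := by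
  have hσ := hasDerivAt_halfSum A v s
  have ha := fun i => hasDerivAt_apply A v i s
  have d1 := ((hσ.cos).log (cos_halfSum_pos h).ne').const_mul (halfSum v)
  have d2 := HasDerivAt.fun_sum fun (i : Fin 3) (_ : i ∈ Finset.univ) =>
    (((hσ.sub (ha i)).cos).log (cos_theta_pos h i).ne').const_mul (halfSum v - v i)
  have d3 := HasDerivAt.fun_sum fun (i : Fin 3) (_ : i ∈ Finset.univ) =>
    (((ha i).sin).log (h.sin_pos i).ne').const_mul (v i)
  refine ((d1.add d2).sub d3).congr_deriv ?_
  simp only [hess, tan_eq_sin_div_cos, neg_add, ← Finset.sum_neg_distrib, sub_eq_add_neg]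
  congr 1
  · congr 1
    · ring
    · exact Finset.sum_congr rfl fun i _ => by simp only [Pi.add_apply, Pi.neg_apply]; ring
  · exact Finset.sum_congr rfl fun i _ => by ring

theorem convex_isHypAngles : Convex ℝ {A : Fin 3 → ℝ | IsHypAngles A} := by
  intro A hA B hB a b ha hb hab
  rcases ha.eq_or_lt with rfl | ha
  · rw [zero_add] at hab; subst hab; simpa using hB
  refine ⟨fun i => ?_, ?_⟩
  · have := hA.pos i
    have := hB.pos i
    simp only [Pi.add_apply, Pi.smul_apply, smul_eq_mul]
    positivity
  · have h1 := hA.sum_lt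
    have h2 := hB.sum_lt
    simp only [Fin.sum_univ_three, Pi.add_apply, Pi.smul_apply, smul_eq_mul] at h1 h2 ⊢
    have e1 := mul_lt_mul_of_pos_left h1 ha
    have e2 := mul_le_mul_of_nonneg_left h2.le hb
    have e3 : a * π + b * π = π := by rw [← add_mul, hab, one_mul]
    linarith

/-- The derivative of the slope is −hess, so the slope decreases along segments in the convex set of
hyperbolic angles. The strict version gives uniqueness; the weak one controls triangles near the
boundary. -/
theorem slope_le {s t : ℝ} (hst : s ≤ t) (hs : IsHypAngles (A + s • v))
    (ht : IsHypAngles (A + t • v)) :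
    slope (A + t • v) v ≤ slope (A + s • v) v ∧
      (s < t → v ≠ 0 → slope (A + t • v) v < slope (A + s • v) v) := by
  have hmem : ∀ r ∈ Icc s t, IsHypAngles (A + r • v) := by
    intro r hr
    have hc : Convex ℝ {r : ℝ | IsHypAngles (A + r • v)} := by
      intro r hr r' hr' a b ha hb hab
      have := convex_isHypAngles hr hr' ha hb hab
      have e : a • (A + r • v) + b • (A + r' • v) = A + (a • r + b • r') • v := by
        rw [show A + (a • r + b • r') • v = (a + b) • A + (a • r + b • r') • v by
          rw [hab, one_smul]]
        module
      rw [e] at this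
      exact this
    exact hc.ordConnected.out hs ht hr
  have hcont : ContinuousOn (fun s : ℝ => slope (A + s • v) v) (Icc s t) := fun r hr =>
    (hasDerivAt_slope (hmem r hr)).continuousAt.continuousWithinAt
  have hint : ∀ r ∈ interior (Icc s t), IsHypAngles (A + r • v) := fun r hr =>
    hmem r (interior_subset hr)
  constructor
  · refine antitoneOn_of_deriv_nonpos (convex_Icc s t) hcont (fun r hr =>
      (hasDerivAt_slope (hint r hr)).differentiableAt.differentiableWithinAt) (fun r hr => ?_)
      (left_mem_Icc.2 hst) (right_mem_Icc.2 hst) hst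
    rw [(hasDerivAt_slope (hint r hr)).deriv]
    linarith [(hess_nonneg (hint r hr) v).1]
  · intro hlt hv
    refine strictAntiOn_of_deriv_neg (convex_Icc s t) hcont (fun r hr => ?_)
      (left_mem_Icc.2 hst) (right_mem_Icc.2 hst) hlt
    rw [(hasDerivAt_slope (hint r hr)).deriv]
    have := hess_nonneg (hint r hr) v
    have h2 : hess (A + r • v) v ≠ 0 := fun h => hv (this.2 h)
    exact neg_neg_of_pos (lt_of_le_of_ne this.1 h2.symm)

/-! #### The functional -/

/-- The concave functional of a triangle with angles `A`. -/
def potential (A : Fin 3 → ℝ) : ℝ :=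
  (∫ x in (0 : ℝ)..(halfSum A), log (cos x)) +
    ∑ i, (∫ x in (0 : ℝ)..(halfSum A - A i), log (cos x)) -
    ∑ i, ∫ x in (0 : ℝ)..(A i), log (sin x)

/-- `Real.log` takes absolute values, and log|cos| and log|sin| are integrable on every bounded
interval, so their primitives are continuous on the whole line. The potential therefore extends to
degenerate triangles, and a maximum exists on the compact closure. -/
theorem continuous_potential : Continuous potential := by
  have c1 : Continuous fun b : ℝ => ∫ x in (0 : ℝ)..b, log (cos x) :=
    intervalIntegral.continuous_primitive (fun a b => intervalIntegrable_log_cos) 0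
  have c2 : Continuous fun b : ℝ => ∫ x in (0 : ℝ)..b, log (sin x) :=
    intervalIntegral.continuous_primitive (fun a b => intervalIntegrable_log_sin) 0
  have h1 : Continuous halfSum := by unfold halfSum; fun_prop
  unfold potential
  refine ((c1.comp h1).add (continuous_finsetSum _ fun i _ => c1.comp
    (h1.sub (continuous_apply i)))).sub (continuous_finsetSum _ fun i _ => c2.comp
      (continuous_apply i))

theorem hasDerivAt_potential {s : ℝ} (h : IsHypAngles (A + s • v)) :
    HasDerivAt (fun s : ℝ => potential (A + s • v)) (slope (A + s • v) v) s := by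
  have dcos : ∀ b : ℝ, 0 < cos b →
      HasDerivAt (fun b : ℝ => ∫ x in (0 : ℝ)..b, log (cos x)) (log (cos b)) b := by
    intro b hb
    refine intervalIntegral.integral_hasDerivAt_right intervalIntegrable_log_cos ?_
      (continuous_cos.continuousAt.log hb.ne')
    exact (measurable_log.comp measurable_cos).stronglyMeasurable.stronglyMeasurableAtFilter
  have dsin : ∀ b : ℝ, 0 < sin b →
      HasDerivAt (fun b : ℝ => ∫ x in (0 : ℝ)..b, log (sin x)) (log (sin b)) b := by
    intro b hb
    refine intervalIntegral.integral_hasDerivAt_right intervalIntegrable_log_sin ?_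
      (continuous_sin.continuousAt.log hb.ne')
    exact (measurable_log.comp measurable_sin).stronglyMeasurable.stronglyMeasurableAtFilter
  have hσ := hasDerivAt_halfSum A v s
  have ha := fun i => hasDerivAt_apply A v i s
  have d1 := (dcos _ (cos_halfSum_pos h)).comp s hσ
  have d2 := HasDerivAt.fun_sum fun (i : Fin 3) (_ : i ∈ Finset.univ) =>
    (dcos _ (cos_theta_pos h i)).comp s (hσ.sub (ha i))
  have d3 := HasDerivAt.fun_sum fun (i : Fin 3) (_ : i ∈ Finset.univ) =>
    (dsin _ (h.sin_pos i)).comp s (ha i)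
  refine ((d1.add d2).sub d3).congr_deriv ?_
  simp only [slope]
  congr 1
  · congr 1
    · ring
    · exact Finset.sum_congr rfl fun i _ => mul_comm _ _
  · exact Finset.sum_congr rfl fun i _ => mul_comm _ _

/-! #### The slope at the boundary -/

/-- Eventually bounded below to the right of `0`. -/
def BddBelowAtZero (f : ℝ → ℝ) : Prop := ∃ b, ∀ᶠ s in 𝓝[>] (0 : ℝ), b ≤ f s

theorem BddBelowAtZero.add {f g : ℝ → ℝ} (hf : BddBelowAtZero f) (hg : BddBelowAtZero g) :
    BddBelowAtZero fun s => f s + g s := by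
  obtain ⟨b, hb⟩ := hf
  obtain ⟨c, hc⟩ := hg
  exact ⟨b + c, by filter_upwards [hb, hc] with s h1 h2 using add_le_add h1 h2⟩

theorem BddBelowAtZero.sum {ι : Type*} {f : ι → ℝ → ℝ} (s : Finset ι)
    (h : ∀ i ∈ s, BddBelowAtZero (f i)) : BddBelowAtZero fun x => ∑ i ∈ s, f i x := by
  classical
  induction s using Finset.induction_on with
  | empty => exact ⟨0, by simp⟩
  | insert a s ha ih =>
    simp only [Finset.sum_insert ha]
    exact (h a (Finset.mem_insert_self a s)).add
      (ih fun i hi => h i (Finset.mem_insert_of_mem hi))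

theorem tendsto_add_of_bddBelow {f g : ℝ → ℝ} (hf : Tendsto f (𝓝[>] 0) atTop)
    (hg : BddBelowAtZero g) : Tendsto (fun s => f s + g s) (𝓝[>] 0) atTop := by
  obtain ⟨b, hb⟩ := hg
  exact tendsto_atTop_add_right_of_le' _ b hf hb

theorem tendsto_sum_of_bddBelow {ι : Type*} {f : ι → ℝ → ℝ} {s : Finset ι}
    (h : ∀ i ∈ s, BddBelowAtZero (f i)) {i : ι} (hi : i ∈ s)
    (ht : Tendsto (f i) (𝓝[>] 0) atTop) :
    Tendsto (fun x => ∑ i ∈ s, f i x) (𝓝[>] 0) atTop := by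
  classical
  simp only [← Finset.add_sum_erase s (fun i => f i _) hi]
  exact tendsto_add_of_bddBelow ht (BddBelowAtZero.sum _ fun j hj => h j (Finset.mem_of_mem_erase hj))

theorem tendsto_const_mul_log {c : ℝ} {g : ℝ → ℝ} (hg : Continuous g)
    (hpos : ∀ᶠ s in 𝓝[>] (0 : ℝ), 0 < g s) (h0 : g 0 = 0) (hc : c < 0) :
    Tendsto (fun s => c * log (g s)) (𝓝[>] 0) atTop := by
  have h1 : Tendsto g (𝓝[>] 0) (𝓝[>] 0) := by
    refine tendsto_nhdsWithin_iff.2 ⟨?_, hpos⟩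
    have := (hg.tendsto 0).mono_left (nhdsWithin_le_nhds (s := Ioi 0))
    rwa [h0] at this
  exact (tendsto_log_nhdsGT_zero.comp h1).const_mul_atBot_of_neg hc

theorem bddBelow_const_mul_log {c : ℝ} {g : ℝ → ℝ} (hg : Continuous g)
    (hpos : ∀ᶠ s in 𝓝[>] (0 : ℝ), 0 < g s) (h : g 0 = 0 → c < 0) :
    BddBelowAtZero fun s => c * log (g s) := by
  by_cases h0 : g 0 = 0
  · exact ⟨0, (tendsto_const_mul_log hg hpos h0 (h h0)).eventually_ge_atTop 0⟩
  · refine ⟨c * log (g 0) - 1, ?_⟩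
    have h1 : ContinuousAt (fun s => c * log (g s)) 0 :=
      continuousAt_const.mul (hg.continuousAt.log h0)
    exact nhdsWithin_le_nhds ((h1.eventually_const_lt (sub_one_lt _)).mono fun _ h => h.le)

/-- At a legal boundary point the slope towards the interior is infinite. -/
theorem tendsto_slope_atTop (hpos : ∀ i, 0 ≤ A i) (hsum : ∑ i, A i ≤ π) (hpi : ∀ i, A i ≠ π)
    (hbd : ∑ i, A i = π ∨ ∃ i, A i = 0) (h : ∀ s ∈ Ioc (0 : ℝ) 1, IsHypAngles (A + s • v)) :
    Tendsto (fun s : ℝ => slope (A + s • v) v) (𝓝[>] 0) atTop := by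
  have hev : ∀ᶠ s in 𝓝[>] (0 : ℝ), IsHypAngles (A + s • v) :=
    mem_of_superset (Ioc_mem_nhdsGT one_pos) h
  have h1 := h 1 ⟨one_pos, le_rfl⟩
  rw [one_smul] at h1
  have hv : ∀ i, A i = 0 → 0 < v i := by
    intro i hi
    have := h1.pos i
    rwa [Pi.add_apply, hi, zero_add] at this
  have hσv : ∑ i, A i = π → halfSum v < 0 := by
    intro hs
    have := h1.sum_lt
    simp only [Pi.add_apply, Finset.sum_add_distrib, hs] at this
    rw [halfSum]; linarith
  have cσ : Continuous fun s : ℝ => halfSum (A + s • v) := by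
    simp only [halfSum_line]; fun_prop
  have ca : ∀ i, Continuous fun s : ℝ => (A + s • v) i := fun i => by
    simp only [Pi.add_apply, Pi.smul_apply]; fun_prop
  have e0 : A + (0 : ℝ) • v = A := by simp
  have hS0 : 0 ≤ halfSum A := by
    rw [halfSum]; exact div_nonneg (Finset.sum_nonneg fun i _ => hpos i) two_pos.le
  have hσ0 : cos (halfSum A) = 0 → ∑ i, A i = π := by
    intro hc
    by_contra hne
    have hlt := lt_of_le_of_ne hsum hne
    have : 0 < cos (halfSum A) := cos_pos_of_mem_Ioo ⟨by linarith [pi_pos], by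
      rw [halfSum]; linarith⟩
    linarith
  -- The value θ_i = π/2 forces angle sum π and A_i = 0, while θ_i = −π/2 would force the excluded
  -- angle π.
  have hθ0 : ∀ i, cos (halfSum A - A i) = 0 → ∑ i, A i = π ∧ A i = 0 := by
    intro i hc
    obtain ⟨j, k, hij, hik, hjk⟩ := IsHypAngles.exists_distinct i
    have hi := hpos i
    have hj := hpos j
    have hk := hpos k
    have hs := hsum
    rw [IsHypAngles.sum_eq A hij hik hjk] at hs
    have hA : A i < π := lt_of_le_of_ne (by linarith) (hpi i)
    by_contra hne
    have hlt : halfSum A - A i < π / 2 := by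
      by_contra hge
      apply hne
      rw [IsHypAngles.sum_eq A hij hik hjk]
      rw [halfSum_eq A hij hik hjk] at hge
      constructor <;> linarith
    have hgt : -(π / 2) < halfSum A - A i := by
      rw [halfSum_eq A hij hik hjk]; linarith
    linarith [cos_pos_of_mem_Ioo ⟨hgt, hlt⟩]
  have hs0 : ∀ i, sin (A i) = 0 → A i = 0 := by
    intro i hs
    by_contra hne
    have hlt : A i < π := by
      obtain ⟨j, k, hij, hik, hjk⟩ := IsHypAngles.exists_distinct i
      have hj := hpos j
      have hk := hpos k
      have hs := hsum
      rw [IsHypAngles.sum_eq A hij hik hjk] at hs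
      exact lt_of_le_of_ne (by linarith) (hpi i)
    linarith [sin_pos_of_pos_of_lt_pi (lt_of_le_of_ne (hpos i) (Ne.symm hne)) hlt]
  -- The coefficient `halfSum v - v i` of log cos θ_i is split into two, each negative wherever that
  -- logarithm diverges. Every summand is then bounded below. The term X tends to +∞ when the
  -- curvature is zero, and W i does when the angle i is zero.
  set X : ℝ → ℝ := fun s => halfSum v * log (cos (halfSum (A + s • v))) with hX
  set Y : Fin 3 → ℝ → ℝ := fun i s =>
    halfSum v * log (cos (halfSum (A + s • v) - (A + s • v) i)) with hY
  set Z : Fin 3 → ℝ → ℝ := fun i s =>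
    -v i * log (cos (halfSum (A + s • v) - (A + s • v) i)) with hZ
  set W : Fin 3 → ℝ → ℝ := fun i s => -v i * log (sin ((A + s • v) i)) with hW
  have pX := hev.mono fun s hs => cos_halfSum_pos hs
  have pY := fun i => hev.mono fun s hs => cos_theta_pos hs i
  have pW := fun i => hev.mono fun s hs => hs.sin_pos i
  have cX : Continuous fun s : ℝ => cos (halfSum (A + s • v)) := continuous_cos.comp cσ
  have cY : ∀ i, Continuous fun s : ℝ => cos (halfSum (A + s • v) - (A + s • v) i) :=
    fun i => continuous_cos.comp (cσ.sub (ca i))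
  have cW : ∀ i, Continuous fun s : ℝ => sin ((A + s • v) i) := fun i => continuous_sin.comp (ca i)
  have bX : BddBelowAtZero X := bddBelow_const_mul_log cX pX fun h0 => by
    rw [e0] at h0; exact hσv (hσ0 h0)
  have bY : ∀ i, BddBelowAtZero (Y i) := fun i => bddBelow_const_mul_log (cY i) (pY i) fun h0 => by
    rw [e0] at h0; exact hσv (hθ0 i h0).1
  have bZ : ∀ i, BddBelowAtZero (Z i) := fun i => bddBelow_const_mul_log (cY i) (pY i) fun h0 => by
    rw [e0] at h0; exact neg_neg_of_pos (hv i (hθ0 i h0).2)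
  have bW : ∀ i, BddBelowAtZero (W i) := fun i => bddBelow_const_mul_log (cW i) (pW i) fun h0 => by
    rw [e0] at h0; exact neg_neg_of_pos (hv i (hs0 i h0))
  have bYZ : BddBelowAtZero fun s => ∑ i, Y i s + ∑ i, Z i s :=
    (BddBelowAtZero.sum _ fun i _ => bY i).add (BddBelowAtZero.sum _ fun i _ => bZ i)
  have eq : ∀ s : ℝ, slope (A + s • v) v = X s + ∑ i, W i s + (∑ i, Y i s + ∑ i, Z i s) := by
    intro s
    simp only [hX, hY, hZ, hW, slope, sub_mul, neg_mul, Finset.sum_sub_distrib,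
      Finset.sum_neg_distrib]
    ring
  refine Tendsto.congr (fun s => (eq s).symm) ?_
  refine tendsto_add_of_bddBelow ?_ bYZ
  rcases hbd with hk | ⟨i, hi⟩
  · refine tendsto_add_of_bddBelow ?_ (BddBelowAtZero.sum _ fun i _ => bW i)
    refine tendsto_const_mul_log cX pX ?_ (hσv hk)
    rw [e0, halfSum, hk, cos_pi_div_two]
  · have hWi : Tendsto (W i) (𝓝[>] 0) atTop :=
      tendsto_const_mul_log (cW i) (pW i) (by rw [e0, hi, sin_zero]) (neg_neg_of_pos (hv i hi))
    have := tendsto_add_of_bddBelow (tendsto_sum_of_bddBelow (fun j _ => bW j)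
      (Finset.mem_univ i) hWi) bX
    simpa only [add_comm] using this

end HypPot

/-! ### The variational problem -/

namespace TriangularDecomposition

variable {M : Type u} [TopologicalSpace M] {T : Type v} (D : TriangularDecomposition M T)

theorem slotVertex_perm (s : T × Fin 3) {j : Fin 3} (hj : j ≠ s.2) :
    D.slotVertex ((D.glue s).1, D.perm s j) = D.slotVertex (s.1, j) := by
  refine ((D.char_eq_iff _ _ _ _).2 (.rel _ _ ⟨s.2, ?_, rfl, fun l => ?_⟩)).symm
  · simp [StdTriangle.vertex, hj.symm]
  · simp [StdTriangle.vertex, Pi.single_apply]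

/-- In the side coordinates of `slope_eq_sum_sideLog`, the indicator of the two ends of a side
becomes the basis vector of that side. -/
theorem halfSum_sub_sideEnds [DecidableEq T] (s q : T × Fin 3) :
    HypPot.halfSum (fun i => (sideEnds s).indicator (1 : T × Fin 3 → ℝ) (q.1, i)) -
      (sideEnds s).indicator 1 q = (Pi.single s 1 : T × Fin 3 → ℝ) q := by
  obtain ⟨t, i⟩ := s
  obtain ⟨t', i'⟩ := q
  simp only [HypPot.halfSum, Fin.sum_univ_three, sideEnds, indicator_apply, mem_ofPred_eq,
    Pi.one_apply, Pi.single_apply, Prod.mk.injEq]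
  by_cases h : t' = t
  · fin_cases i <;> fin_cases i' <;> simp [h]
  · simp [h]

theorem continuous_triangleCurvature (t : T) :
    Continuous (triangleCurvature t : (T × Fin 3 → ℝ) → ℝ) := by
  unfold triangleCurvature; fun_prop

variable [Fintype T]

theorem isHypAngles {x : T × Fin 3 → ℝ} (hx : x ∈ D.angleSystems) (t : T) :
    IsHypAngles fun i => x (t, i) :=
  ⟨fun i => (hx.2.2 (t, i)).1, by have := hx.2.1 t; rw [triangleCurvature] at this; linarith⟩

/-- The derivative at `x` of the sum of the functionals of the triangles, in the direction `w`. -/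
def totalSlope (x w : T × Fin 3 → ℝ) : ℝ :=
  ∑ t, HypPot.slope (fun i => x (t, i)) (fun i => w (t, i))

/-- The sum of the functionals of the triangles. -/
def totalPotential (x : T × Fin 3 → ℝ) : ℝ := ∑ t, HypPot.potential fun i => x (t, i)

/-- The sides that are glued have equal lengths. -/
def SidesMatch (x : T × Fin 3 → ℝ) : Prop :=
  ∀ s, sideCosh (fun i => x (s.1, i)) s.2 =
    sideCosh (fun i => x ((D.glue s).1, i)) (D.glue s).2

theorem totalSlope_eq (x w : T × Fin 3 → ℝ) : totalSlope x w =
    ∑ q : T × Fin 3, (HypPot.halfSum (fun i => w (q.1, i)) - w q) *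
      HypPot.sideLog (fun i => x (q.1, i)) q.2 := by
  simp only [totalSlope, HypPot.slope_eq_sum_sideLog, Fintype.sum_prod_type]

/-- This turns criticality into geometry: the derivative along w_e compares the lengths of the two
copies of e. -/
theorem totalSlope_edgeVector (x : T × Fin 3 → ℝ) (s : T × Fin 3) :
    totalSlope x (D.edgeVector s) = HypPot.sideLog (fun i => x (s.1, i)) s.2 -
      HypPot.sideLog (fun i => x ((D.glue s).1, i)) (D.glue s).2 := by
  classical
  have e : ∀ q : T × Fin 3, HypPot.halfSum (fun i => D.edgeVector s (q.1, i)) - D.edgeVector s q =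
      (Pi.single s 1 : T × Fin 3 → ℝ) q - (Pi.single (D.glue s) 1 : T × Fin 3 → ℝ) q := by
    intro q
    rw [← halfSum_sub_sideEnds, ← halfSum_sub_sideEnds]
    simp only [edgeVector, HypPot.halfSum, Fin.sum_univ_three, Pi.sub_apply]
    ring
  rw [totalSlope_eq]
  simp only [e, sub_mul, Finset.sum_sub_distrib, Pi.single_apply, ite_mul, one_mul, zero_mul,
    Finset.sum_ite_eq', Finset.mem_univ, if_true]

theorem totalSlope_add (x w w' : T × Fin 3 → ℝ) :
    totalSlope x (w + w') = totalSlope x w + totalSlope x w' := by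
  simp only [totalSlope_eq, HypPot.halfSum, ← Finset.sum_add_distrib, Fin.sum_univ_three,
    Pi.add_apply]
  exact Finset.sum_congr rfl fun _ _ => by ring

theorem totalSlope_smul (x w : T × Fin 3 → ℝ) (c : ℝ) :
    totalSlope x (c • w) = c * totalSlope x w := by
  simp only [totalSlope_eq, HypPot.halfSum, Finset.mul_sum, Fin.sum_univ_three, Pi.smul_apply,
    smul_eq_mul]
  exact Finset.sum_congr rfl fun _ _ => by ring

theorem SidesMatch.totalSlope_eq_zero {x : T × Fin 3 → ℝ} (hx : x ∈ D.angleSystems)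
    (h : D.SidesMatch x) {w : T × Fin 3 → ℝ} (hw : w ∈ D.conformalDeformations) :
    totalSlope x w = 0 := by
  induction hw using Submodule.span_induction with
  | mem w hw =>
    obtain ⟨s, -, rfl⟩ := hw
    rw [totalSlope_edgeVector, sub_eq_zero]
    exact (HypPot.sideLog_eq_iff (D.isHypAngles hx _) (D.isHypAngles hx _) _ _).2 (h s)
  | zero => simpa using totalSlope_smul x 0 0
  | add w w' _ _ h1 h2 => rw [totalSlope_add, h1, h2, add_zero]
  | smul c w _ h => rw [totalSlope_smul, h, mul_zero]

/-- Angle systems with matching sides are unique in their conformal class. -/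
theorem eq_of_sidesMatch {x x' : T × Fin 3 → ℝ} (hx : x ∈ D.angleSystems)
    (hx' : x' ∈ D.angleSystems) (h : D.SidesMatch x) (h' : D.SidesMatch x')
    (hw : x' - x ∈ D.conformalDeformations) : x = x' := by
  by_contra hne
  have z := h.totalSlope_eq_zero D hx hw
  have z' := h'.totalSlope_eq_zero D hx' hw
  obtain ⟨⟨t, i⟩, hq⟩ := Function.ne_iff.1 hne
  have key : ∀ t, HypPot.slope (fun i => x' (t, i)) (fun i => (x' - x) (t, i)) ≤
        HypPot.slope (fun i => x (t, i)) (fun i => (x' - x) (t, i)) ∧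
      ((fun i => (x' - x) (t, i)) ≠ 0 →
        HypPot.slope (fun i => x' (t, i)) (fun i => (x' - x) (t, i)) <
          HypPot.slope (fun i => x (t, i)) (fun i => (x' - x) (t, i))) := by
    intro t
    have e0 : (fun i => x (t, i)) + (0 : ℝ) • (fun i => (x' - x) (t, i)) = fun i => x (t, i) := by
      simp
    have e1 : (fun i => x (t, i)) + (1 : ℝ) • (fun i => (x' - x) (t, i)) = fun i => x' (t, i) := by
      ext i; simp
    have := HypPot.slope_le (A := fun i => x (t, i)) (v := fun i => (x' - x) (t, i))
      (zero_le_one' ℝ) (by rw [e0]; exact D.isHypAngles hx t)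
      (by rw [e1]; exact D.isHypAngles hx' t)
    rw [e0, e1] at this
    exact ⟨this.1, this.2 one_pos⟩
  have : totalSlope x' (x' - x) < totalSlope x (x' - x) := by
    refine Finset.sum_lt_sum (fun t _ => (key t).1) ⟨t, Finset.mem_univ t, (key t).2 fun h0 => ?_⟩
    have := congrFun h0 i
    simp only [Pi.sub_apply, Pi.zero_apply, sub_eq_zero] at this
    exact hq this.symm
  linarith

/-! ### Conformal deformations and the maximum of the potential -/

theorem vertexSum_add (m : M) (x y : T × Fin 3 → ℝ) :
    D.vertexSum m (x + y) = D.vertexSum m x + D.vertexSum m y := by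
  simp only [vertexSum, Pi.add_apply, Finset.sum_add_distrib]

theorem vertexSum_smul (m : M) (c : ℝ) (x : T × Fin 3 → ℝ) :
    D.vertexSum m (c • x) = c * D.vertexSum m x := by
  simp only [vertexSum, Pi.smul_apply, smul_eq_mul, Finset.mul_sum]

theorem vertexSum_sideEnds [DecidableEq M] (m : M) (s : T × Fin 3) :
    D.vertexSum m ((sideEnds s).indicator 1) =
      ∑ j, if j ≠ s.2 ∧ D.slotVertex (s.1, j) = m then 1 else 0 := by
  classical
  rw [vertexSum, Finset.sum_filter, Fintype.sum_prod_type, Finset.sum_eq_single s.1]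
  · refine Finset.sum_congr rfl fun j _ => ?_
    simp only [indicator_apply, sideEnds, mem_ofPred_eq, true_and, Pi.one_apply]
    by_cases h1 : j = s.2 <;> by_cases h2 : D.slotVertex (s.1, j) = m <;> simp [h1, h2]
  · intro t _ ht
    refine Finset.sum_eq_zero fun j _ => ?_
    simp [sideEnds, ht]
  · simp

/-- The gluing matches the ends of the two sides and identifies them in M, so each +1 at a vertex is
cancelled by a −1 at the same vertex. -/
theorem vertexSum_edgeVector (m : M) (s : T × Fin 3) : D.vertexSum m (D.edgeVector s) = 0 := by
  classical
  have e : D.edgeVector s = (sideEnds s).indicator 1 +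
      (-1 : ℝ) • (sideEnds (D.glue s)).indicator 1 := by
    rw [edgeVector, neg_one_smul, sub_eq_add_neg]
  rw [e, vertexSum_add, vertexSum_smul, vertexSum_sideEnds, vertexSum_sideEnds,
    ← Equiv.sum_comp (D.perm s) fun j =>
      if j ≠ (D.glue s).2 ∧ D.slotVertex ((D.glue s).1, j) = m then (1 : ℝ) else 0,
    neg_one_mul, ← sub_eq_add_neg, sub_eq_zero]
  refine Finset.sum_congr rfl fun j _ => ?_
  by_cases h : j = s.2
  · simp [h, D.perm_side s]
  · have h' : D.perm s j ≠ (D.glue s).2 := by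
      rw [← D.perm_side s]
      exact (D.perm s).injective.ne h
    simp only [D.slotVertex_perm s h, h, h', ne_eq, not_false_eq_true, true_and]

theorem vertexSum_conformal (m : M) {w : T × Fin 3 → ℝ} (hw : w ∈ D.conformalDeformations) :
    D.vertexSum m w = 0 := by
  induction hw using Submodule.span_induction with
  | mem w hw =>
    obtain ⟨s, -, rfl⟩ := hw
    exact D.vertexSum_edgeVector m s
  | zero => simpa using D.vertexSum_smul m 0 0
  | add w w' _ _ h1 h2 => rw [vertexSum_add, h1, h2, add_zero]
  | smul c w _ h => rw [vertexSum_smul, h, mul_zero]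

theorem add_conformal_mem_angleFlat {x w : T × Fin 3 → ℝ} (hx : x ∈ D.angleFlat)
    (hw : w ∈ D.conformalDeformations) : x + w ∈ D.angleFlat :=
  ⟨fun m hm => by rw [vertexSum_add, D.vertexSum_conformal m hw, add_zero, hx.1 m hm],
    fun m hm => by rw [vertexSum_add, D.vertexSum_conformal m hw, add_zero, hx.2 m hm]⟩

theorem continuous_vertexSum (m : M) : Continuous (D.vertexSum m) := by
  unfold vertexSum; fun_prop

theorem closure_angleSystems_subset : closure D.angleSystems ⊆
    {x | x ∈ D.angleFlat ∧ (∀ t, triangleCurvature t x ≤ 0) ∧ ∀ q, x q ∈ Icc 0 Real.pi} := by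
  refine closure_minimal (fun x hx => ⟨hx.1, fun t => (hx.2.1 t).le,
    fun q => Ioo_subset_Icc_self (hx.2.2 q)⟩) ?_
  have h1 : IsClosed D.angleFlat := by
    simp only [angleFlat, ofPred_and, ofPred_forall]
    exact (isClosed_biInter fun m _ => isClosed_eq (D.continuous_vertexSum m) continuous_const).inter
      (isClosed_biInter fun m _ => isClosed_eq (D.continuous_vertexSum m) continuous_const)
  have h2 : IsClosed {x : T × Fin 3 → ℝ | ∀ t, triangleCurvature t x ≤ 0} := by
    simp only [ofPred_forall]
    exact isClosed_iInter fun t => isClosed_le (continuous_triangleCurvature t) continuous_const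
  have h3 : IsClosed {x : T × Fin 3 → ℝ | ∀ q, x q ∈ Icc 0 Real.pi} := by
    simp only [ofPred_forall]
    exact isClosed_iInter fun q => isClosed_Icc.preimage (continuous_apply q)
  exact h1.inter (h2.inter h3)

theorem isCompact_closure_angleSystems : IsCompact (closure D.angleSystems) := by
  refine (isCompact_univ_pi fun _ : T × Fin 3 => isCompact_Icc (a := (0 : ℝ)) (b := Real.pi)).of_isClosed_subset
    isClosed_closure fun x hx q _ => (D.closure_angleSystems_subset hx).2.2 q

theorem continuous_totalPotential : Continuous (totalPotential : (T × Fin 3 → ℝ) → ℝ) := by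
  unfold totalPotential
  exact continuous_finsetSum _ fun t _ => HypPot.continuous_potential.comp (by fun_prop)

theorem hasDerivAt_totalPotential {x w : T × Fin 3 → ℝ} {s : ℝ}
    (h : x + s • w ∈ D.angleSystems) :
    HasDerivAt (fun s : ℝ => totalPotential (x + s • w)) (totalSlope (x + s • w) w) s := by
  refine HasDerivAt.fun_sum fun t _ => ?_
  exact HypPot.hasDerivAt_potential (A := fun i => x (t, i)) (v := fun i => w (t, i))
    (D.isHypAngles h t)

/-- The segment from a point of the closure to an angle system. -/
theorem segment_mem_angleSystems {x y : T × Fin 3 → ℝ} (hx : x ∈ D.angleSystems)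
    (hy : y ∈ closure D.angleSystems) {s : ℝ} (hs : s ∈ Ioc (0 : ℝ) 1) :
    y + s • (x - y) ∈ D.angleSystems := by
  obtain ⟨hf, hk, hq⟩ := D.closure_angleSystems_subset hy
  have e : y + s • (x - y) = (1 - s) • y + s • x := by module
  have h1 : 0 ≤ 1 - s := by linarith [hs.2]
  have hs0 := hs.1
  rw [e]
  refine ⟨⟨fun m hm => ?_, fun m hm => ?_⟩, fun t => ?_, fun q => ⟨?_, ?_⟩⟩
  · rw [vertexSum_add, vertexSum_smul, vertexSum_smul, hf.1 m hm, hx.1.1 m hm]; ring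
  · rw [vertexSum_add, vertexSum_smul, vertexSum_smul, hf.2 m hm, hx.1.2 m hm]; ring
  · have : triangleCurvature t ((1 - s) • y + s • x) =
        (1 - s) * triangleCurvature t y + s * triangleCurvature t x := by
      simp only [triangleCurvature, Fin.sum_univ_three, Pi.add_apply, Pi.smul_apply, smul_eq_mul]
      ring
    rw [this]
    have := mul_nonpos_of_nonneg_of_nonpos h1 (hk t)
    have := mul_neg_of_pos_of_neg hs0 (hx.2.1 t)
    linarith
  · have := mul_nonneg h1 (hq q).1
    have := mul_pos hs0 (hx.2.2 q).1
    simp only [Pi.add_apply, Pi.smul_apply, smul_eq_mul]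
    linarith
  · have := mul_le_mul_of_nonneg_left (hq q).2 h1
    have := mul_lt_mul_of_pos_left (hx.2.2 q).2 hs0
    simp only [Pi.add_apply, Pi.smul_apply, smul_eq_mul]
    linarith

/-- Conformal directions stay in the flat, and the remaining finitely many conditions are open. -/
theorem eventually_mem_angleSystems {x w : T × Fin 3 → ℝ} (hx : x ∈ D.angleSystems)
    (hw : w ∈ D.conformalDeformations) : ∀ᶠ s : ℝ in 𝓝 0, x + s • w ∈ D.angleSystems := by
  have hc : Continuous fun s : ℝ => x + s • w := by fun_prop
  have e0 : x + (0 : ℝ) • w = x := by simp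
  have h1 : ∀ᶠ s : ℝ in 𝓝 0, ∀ t, triangleCurvature t (x + s • w) < 0 := by
    refine eventually_all.2 fun t => ?_
    have := ((continuous_triangleCurvature t).comp hc).tendsto 0
    refine this.eventually_lt_const ?_
    simp only [Function.comp, e0]
    exact hx.2.1 t
  have h2 : ∀ᶠ s : ℝ in 𝓝 0, ∀ q, (x + s • w) q ∈ Ioo 0 Real.pi := by
    refine eventually_all.2 fun q => ?_
    have := ((continuous_apply q).comp hc).tendsto 0
    refine this.eventually (isOpen_Ioo.mem_nhds ?_)
    simp only [Function.comp, e0]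
    exact hx.2.2 q
  filter_upwards [h1, h2] with s a1 a2
  exact ⟨D.add_conformal_mem_angleFlat hx.1 (Submodule.smul_mem _ s hw), a1, a2⟩

/-- At a legal triangle the slope towards the interior is infinite. -/
theorem tendsto_slope_of_isLegal {x y : T × Fin 3 → ℝ} (hx : x ∈ D.angleSystems)
    (hy : y ∈ closure D.angleSystems) {t : T} (ht : IsLegal t y) :
    Tendsto (fun s : ℝ => HypPot.slope (fun i => (y + s • (x - y)) (t, i))
      (fun i => (x - y) (t, i))) (𝓝[>] 0) atTop := by
  obtain ⟨hf, hk, hq⟩ := D.closure_angleSystems_subset hy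
  have hsum : ∑ i, y (t, i) ≤ Real.pi := by
    have := hk t; rw [triangleCurvature] at this; linarith
  refine HypPot.tendsto_slope_atTop (A := fun i => y (t, i)) (v := fun i => (x - y) (t, i))
    (fun i => (hq _).1) hsum (fun i hi => ht.1 ?_) ?_
    (fun s hs => D.isHypAngles (D.segment_mem_angleSystems hx hy hs) t)
  -- An angle π leaves nothing for the other two, so the triangle would have the excluded data {0,
  -- 0, π}.
  · have h0 := (hq (t, 0)).1
    have h1 := (hq (t, 1)).1
    have h2 := (hq (t, 2)).1
    rw [Fin.sum_univ_three] at hsum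
    simp only [angleData]
    fin_cases i
    · simp only [Fin.zero_eta] at hi
      rw [show y (t, 1) = 0 by linarith, show y (t, 2) = 0 by linarith, hi]
      exact Multiset.coe_eq_coe.2 (List.perm_append_comm (l₁ := [Real.pi]) (l₂ := [0, 0]))
    · simp only [Fin.mk_one] at hi
      rw [show y (t, 0) = 0 by linarith, show y (t, 2) = 0 by linarith, hi]
      exact Multiset.coe_eq_coe.2 (List.Perm.cons 0 (List.Perm.swap _ _ _))
    · simp only [Fin.reduceFinMk] at hi
      rw [show y (t, 0) = 0 by linarith, show y (t, 1) = 0 by linarith, hi]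
  · exact ht.2.imp (fun h => by rw [triangleCurvature] at h; linarith) id

/-- Existence of an angle system with matching sides. -/
theorem exists_sidesMatch {x : T × Fin 3 → ℝ} (hx : x ∈ D.angleSystems)
    (hbad : {y | D.ConformallyEquivalent y x} ∩ D.badSet = ∅) :
    ∃ u ∈ D.angleSystems, D.SidesMatch u ∧ D.ConformallyEquivalent u x := by
  have hcl : IsClosed {y : T × Fin 3 → ℝ | D.ConformallyEquivalent y x} :=
    (Submodule.closed_of_finiteDimensional D.conformalDeformations).preimage
      (continuous_id.sub continuous_const)
  -- The potential is maximized over the closure of 𝔑 within the conformal class.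
  have hK := D.isCompact_closure_angleSystems.inter_right hcl
  have hxx : D.ConformallyEquivalent x x := by
    rw [ConformallyEquivalent, sub_self]; exact Submodule.zero_mem _
  obtain ⟨y, ⟨hy, hyx⟩, hmax⟩ := hK.exists_isMaxOn ⟨x, subset_closure hx, hxx⟩
    (continuous_totalPotential (T := T)).continuousOn
  have hyx' : y - x ∈ D.conformalDeformations := hyx
  by_cases hyN : y ∈ D.angleSystems
  · refine ⟨y, hyN, fun s => ?_, hyx⟩
    by_cases hs : D.glue s = s
    · rw [hs]
    have hw : D.edgeVector s ∈ D.conformalDeformations := Submodule.subset_span ⟨s, hs, rfl⟩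
    have hev := D.eventually_mem_angleSystems hyN hw
    have e0 : y + (0 : ℝ) • D.edgeVector s = y := by simp
    have hd := D.hasDerivAt_totalPotential (x := y) (w := D.edgeVector s) (s := 0)
      (by rw [e0]; exact hyN)
    rw [e0, totalSlope_edgeVector] at hd
    -- Small moves along w_e stay admissible, so the derivative in this direction vanishes at an
    -- interior maximum.
    have hloc : IsLocalMax (fun s' : ℝ => totalPotential (y + s' • D.edgeVector s)) 0 := by
      filter_upwards [hev] with r hr
      rw [e0]
      refine hmax ⟨subset_closure hr, ?_⟩
      have : y + r • D.edgeVector s - x = (y - x) + r • D.edgeVector s := by module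
      change y + r • D.edgeVector s - x ∈ D.conformalDeformations
      rw [this]
      exact Submodule.add_mem _ hyx' (Submodule.smul_mem _ r hw)
    have := hloc.hasDerivAt_eq_zero hd
    exact (HypPot.sideLog_eq_iff (D.isHypAngles hyN _) (D.isHypAngles hyN _) _ _).1
      (sub_eq_zero.1 this)
  -- A maximum on the boundary is outside the bad set, so it has a legal triangle; the potential
  -- then strictly increases towards x.
  · exfalso
    have hnb : y ∉ D.badSet := fun hb => by
      have : y ∈ {y | D.ConformallyEquivalent y x} ∩ D.badSet := ⟨hyx, hb⟩
      rw [hbad] at this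
      exact this
    have : ∃ t, IsLegal t y := by
      by_contra hno
      exact hnb ⟨⟨hy, hyN⟩, fun t ht => hno ⟨t, ht⟩⟩
    obtain ⟨t, ht⟩ := this
    have hseg := fun (s : ℝ) hs => D.segment_mem_angleSystems hx hy (s := s) hs
    have hlim : Tendsto (fun s : ℝ => totalSlope (y + s • (x - y)) (x - y)) (𝓝[>] 0) atTop := by
      refine HypPot.tendsto_sum_of_bddBelow (fun t' _ => ?_) (Finset.mem_univ t)
        (D.tendsto_slope_of_isLegal hx hy ht)
      -- By concavity the slope at s ≤ 1 is at least the slope at s = 1. This lower bound holds for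
      -- every triangle, legal or not.
      refine ⟨HypPot.slope (fun i => (y + (1 : ℝ) • (x - y)) (t', i)) (fun i => (x - y) (t', i)), ?_⟩
      filter_upwards [Ioc_mem_nhdsGT (one_pos (α := ℝ))] with s hs
      exact (HypPot.slope_le (A := fun i => y (t', i)) (v := fun i => (x - y) (t', i)) hs.2
        (D.isHypAngles (hseg s hs) t') (D.isHypAngles (hseg 1 ⟨one_pos, le_rfl⟩) t')).1
    have hpos := hlim.eventually_gt_atTop 0
    obtain ⟨δ, hδ, hδ'⟩ := mem_nhdsGT_iff_exists_Ioc_subset.1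
      (inter_mem hpos (Ioc_mem_nhdsGT (one_pos (α := ℝ))))
    have hδ0 : (0 : ℝ) < δ := hδ
    have hcont : Continuous fun s : ℝ => totalPotential (y + s • (x - y)) :=
      continuous_totalPotential.comp (by fun_prop)
    -- No derivative is needed at y itself: continuity up to y and a positive derivative on the open
    -- interval suffice.
    have hmono : StrictMonoOn (fun s : ℝ => totalPotential (y + s • (x - y))) (Icc 0 δ) := by
      refine strictMonoOn_of_deriv_pos (convex_Icc 0 δ) hcont.continuousOn fun r hr => ?_
      rw [interior_Icc] at hr
      have hr' := hδ' ⟨hr.1, hr.2.le⟩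
      rw [(D.hasDerivAt_totalPotential (hseg r hr'.2)).deriv]
      exact hr'.1
    have hlt := hmono (left_mem_Icc.2 hδ0.le) (right_mem_Icc.2 hδ0.le) hδ0
    have hδ1 := (hδ' ⟨hδ0, le_rfl⟩).2
    have hle := hmax (a := y + δ • (x - y)) ⟨subset_closure (hseg δ hδ1), by
      change y + δ • (x - y) - x ∈ D.conformalDeformations
      rw [show y + δ • (x - y) - x = (1 - δ) • (y - x) by module]
      exact Submodule.smul_mem _ _ hyx'⟩
    have hle' : totalPotential (y + δ • (x - y)) ≤ totalPotential y := hle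
    simp only [zero_smul, add_zero] at hlt
    linarith

end TriangularDecomposition

/-! ### Uniform angle systems have matching sides -/

/-- Two parametrized geodesic segments that are locally isometric have the same length. -/
theorem Mink.dist_eq_of_locally_isometric {γ γ' : unitInterval → ℍ} (hc : Continuous γ)
    (hc' : Continuous γ') (hi : Function.Injective γ) (hi' : Function.Injective γ')
    (hs : ∀ a, γ a ∈ hypSegment (γ 0) (γ 1)) (hs' : ∀ a, γ' a ∈ hypSegment (γ' 0) (γ' 1))
    (hloc : ∀ a, ∀ᶠ b in 𝓝 a, dist (γ a) (γ b) = dist (γ' a) (γ' b)) :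
    dist (γ 0) (γ 1) = dist (γ' 0) (γ' 1) := by
  -- Distance from the starting point is continuous, injective along the segment and minimal at
  -- parameter 0, hence strictly increasing.
  have mono : ∀ {γ : unitInterval → ℍ}, Continuous γ → Function.Injective γ →
      (∀ a, γ a ∈ hypSegment (γ 0) (γ 1)) → StrictMono fun a => dist (γ 0) (γ a) := by
    intro γ hc hi hs
    refine Continuous.strictMono_of_inj_boundedOrder (continuous_const.dist hc) ?_ fun a b hab => ?_
    · change dist (γ 0) (γ 0) ≤ _
      rw [dist_self]
      exact dist_nonneg
    · apply hi
      have hab' : dist (γ 0) (γ a) = dist (γ 0) (γ b) := hab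
      rw [← dist_eq_zero, dist_of_mem_hypSegment (hs a) (hs b), hab', sub_self, abs_zero]
  have m := (mono hc hi hs).monotone
  have m' := (mono hc' hi' hs').monotone
  -- The two arc lengths have the same local increments, so their difference is constant on the
  -- interval; it vanishes at 0.
  have hl : IsLocallyConstant fun a => dist (γ 0) (γ a) - dist (γ' 0) (γ' a) := by
    rw [IsLocallyConstant.iff_eventually_eq]
    intro a
    filter_upwards [hloc a] with b hb
    rw [dist_of_mem_hypSegment (hs a) (hs b), dist_of_mem_hypSegment (hs' a) (hs' b)] at hb
    rcases le_total a b with h | h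
    · have h1 : dist (γ 0) (γ a) ≤ dist (γ 0) (γ b) := m h
      have h2 : dist (γ' 0) (γ' a) ≤ dist (γ' 0) (γ' b) := m' h
      rw [abs_of_nonpos (by linarith), abs_of_nonpos (by linarith)] at hb
      linarith
    · have h1 : dist (γ 0) (γ b) ≤ dist (γ 0) (γ a) := m h
      have h2 : dist (γ' 0) (γ' b) ≤ dist (γ' 0) (γ' a) := m' h
      rw [abs_of_nonneg (by linarith), abs_of_nonneg (by linarith)] at hb
      linarith
  have := hl.apply_eq_of_preconnectedSpace 0 1
  simp only [dist_self] at this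
  linarith

namespace StdTriangle

/-- The parametrization of the side joining two vertices. -/
def sidePath (j k : Fin 3) (a : unitInterval) : StdTriangle :=
  ⟨(1 - a.1) • Pi.single j 1 + a.1 • Pi.single k 1,
    convex_stdSimplex ℝ (Fin 3) (single_mem_stdSimplex ℝ j) (single_mem_stdSimplex ℝ k)
      (by linarith [a.2.2]) a.2.1 (by ring)⟩

theorem continuous_sidePath (j k : Fin 3) : Continuous (sidePath j k) := by
  unfold sidePath
  fun_prop

theorem sidePath_zero (j k : Fin 3) : sidePath j k 0 = vertex j := by
  apply Subtype.ext; simp [sidePath, vertex]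

theorem sidePath_one (j k : Fin 3) : sidePath j k 1 = vertex k := by
  apply Subtype.ext; simp [sidePath, vertex]

theorem sidePath_injective {j k : Fin 3} (h : j ≠ k) : Function.Injective (sidePath j k) := by
  intro a b hab
  have := congrFun (congrArg Subtype.val hab) k
  simpa [sidePath, h.symm, Subtype.ext_iff] using this

theorem sidePath_mem_face (j k : Fin 3) (a : unitInterval) : sidePath j k a ∈ face {j, k} := by
  intro i hi
  simp only [mem_insert_iff, mem_singleton_iff, not_or] at hi
  simp [sidePath, hi.1, hi.2]

end StdTriangle

namespace TriangularDecomposition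

variable {M : Type u} [TopologicalSpace M] {T : Type v} (D : TriangularDecomposition M T)

theorem char_sidePath (s : T × Fin 3) {j k : Fin 3} (hj : j ≠ s.2) (hk : k ≠ s.2)
    (a : unitInterval) : D.char s.1 (StdTriangle.sidePath j k a) =
      D.char (D.glue s).1 (StdTriangle.sidePath (D.perm s j) (D.perm s k) a) := by
  refine (D.char_eq_iff _ _ _ _).2 (.rel _ _ ⟨s.2, ?_, rfl, fun l => ?_⟩)
  · simp [StdTriangle.sidePath, hj.symm, hk.symm]
  · simp [StdTriangle.sidePath, Pi.single_apply]

/-- A chart at a point of a glued side restricts to an isometry of either realized triangle. The two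
parametrizations of the side are therefore locally isometric, and the side lengths, which the angles
determine, agree. -/
theorem IsUniform.sidesMatch [Fintype T] {x : T × Fin 3 → ℝ} (h : D.IsUniform x) :
    D.SidesMatch x := by
  obtain ⟨hx, r, hr, S, hS⟩ := h
  intro s
  obtain ⟨j, k, hij, hik, hjk⟩ := IsHypAngles.exists_distinct s.2
  have inj := (D.perm s).injective
  have hsp := D.perm_side s
  have hv : ∀ t, Function.Injective fun i => r t (StdTriangle.vertex i) := by
    intro t i i' hii
    have := congrFun (congrArg Subtype.val ((hr t).injective hii)) i
    simp only [StdTriangle.vertex, Pi.single_apply] at this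
    by_contra hne
    simp [hne] at this
  have e1 := Mink.form_eq_sideCosh (hv s.1) (D.isHypAngles hx s.1) (hr s.1).angle hij hik hjk
  have e2 := Mink.form_eq_sideCosh (hv (D.glue s).1) (D.isHypAngles hx (D.glue s).1)
    (hr (D.glue s).1).angle (inj.ne hij) (inj.ne hik) (inj.ne hjk)
  rw [hsp] at e2
  rw [← e1, ← e2, ← Mink.dist_eq_dist_iff]
  have key := Mink.dist_eq_of_locally_isometric
    (γ := fun a => r s.1 (StdTriangle.sidePath j k a))
    (γ' := fun a => r (D.glue s).1 (StdTriangle.sidePath (D.perm s j) (D.perm s k) a))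
    ((hr _).continuous.comp (StdTriangle.continuous_sidePath j k))
    ((hr _).continuous.comp (StdTriangle.continuous_sidePath _ _))
    ((hr _).injective.comp (StdTriangle.sidePath_injective hjk))
    ((hr _).injective.comp (StdTriangle.sidePath_injective (inj.ne hjk)))
    (fun a => by
      rw [StdTriangle.sidePath_zero, StdTriangle.sidePath_one, ← (hr _).side j k hjk]
      exact mem_image_of_mem _ (StdTriangle.sidePath_mem_face j k a))
    (fun a => by
      rw [StdTriangle.sidePath_zero, StdTriangle.sidePath_one, ← (hr _).side _ _ (inj.ne hjk)]
      exact mem_image_of_mem _ (StdTriangle.sidePath_mem_face _ _ a))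
    (fun a => by
      -- The same chart is used for both triangles, since the two parametrizations have the same
      -- image point in M.
      obtain ⟨e, he, hm⟩ := S.cover (D.char s.1 (StdTriangle.sidePath j k a))
      obtain ⟨g, hg⟩ := hS _ _ e he hm
      rw [D.char_sidePath s hij.symm hik.symm] at hm
      obtain ⟨g', hg'⟩ := hS _ _ e he hm
      have c1 := (StdTriangle.continuous_sidePath j k).tendsto a
      have c2 := (StdTriangle.continuous_sidePath (D.perm s j) (D.perm s k)).tendsto a
      have key : ∀ b, (e (D.char s.1 (StdTriangle.sidePath j k b)) : ℍ) =
          g (r s.1 (StdTriangle.sidePath j k b)) →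
          (e (D.char (D.glue s).1 (StdTriangle.sidePath (D.perm s j) (D.perm s k) b)) : ℍ) =
          g' (r (D.glue s).1 (StdTriangle.sidePath (D.perm s j) (D.perm s k) b)) →
          g (r s.1 (StdTriangle.sidePath j k b)) =
          g' (r (D.glue s).1 (StdTriangle.sidePath (D.perm s j) (D.perm s k) b)) := by
        intro b h1 h2
        rw [← h1, ← h2, D.char_sidePath s hij.symm hik.symm]
      have ka := key a hg.self_of_nhds hg'.self_of_nhds
      filter_upwards [c1.eventually hg, c2.eventually hg'] with b h1 h2
      exact ((g.dist_eq _ _).symm.trans (by rw [ka, key b h1 h2])).trans (g'.dist_eq _ _))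
  simpa only [StdTriangle.sidePath_zero, StdTriangle.sidePath_one] using key

end TriangularDecomposition

/-! ### Charts from locally injective maps -/

/-- A continuous injective map of a locally compact space which is open at a point restricts to a
chart near this point. -/
theorem exists_openPartialHomeomorph {X : Type*} {Y : Type*} [TopologicalSpace X] [T2Space X]
    [LocallyCompactSpace X] [TopologicalSpace Y] [T2Space Y] {f : X → Y} {S : Set X} {m : X}
    (hS : IsOpen S) (hm : m ∈ S) (hf : ContinuousOn f S) (hi : InjOn f S)
    (ho : ∀ U ∈ 𝓝 m, f '' U ∈ 𝓝 (f m)) :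
    ∃ e : OpenPartialHomeomorph X Y, m ∈ e.source ∧ e.source ⊆ S ∧ ∀ x ∈ e.source, e x = f x := by
  -- The compact neighbourhood K replaces invariance of domain: an injective continuous map on it is
  -- closed.
  obtain ⟨K, hKm, hKS, hK⟩ := local_compact_nhds (hS.mem_nhds hm)
  obtain ⟨W, hW, hWo, hmW⟩ := mem_nhds_iff.1 (ho _ (interior_mem_nhds.2 hKm))
  have hKi : interior K ⊆ S := interior_subset.trans hKS
  have hcont : ContinuousOn f (interior K) := hf.mono hKi
  set s := interior K ∩ f ⁻¹' W with hs
  have hso : IsOpen s := hcont.isOpen_inter_preimage isOpen_interior hWo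
  have hsS : s ⊆ S := inter_subset_left.trans hKi
  have hbij : BijOn f s W := by
    refine ⟨fun x hx => hx.2, hi.mono hsS, fun w hw => ?_⟩
    obtain ⟨x, hx, rfl⟩ := hW hw
    exact ⟨x, ⟨hx, hw⟩, rfl⟩
  have : Nonempty X := ⟨m⟩
  have hopen : IsOpenMap (s.domRestrict f) := by
    intro V hV
    obtain ⟨V', hV', rfl⟩ := isOpen_induced_iff.1 hV
    -- By injectivity on K, the image of an open part is W minus the image of its compact complement
    -- in K, which is closed.
    have e : s.domRestrict f '' (Subtype.val ⁻¹' V') = W ∩ (f '' (K \ (s ∩ V')))ᶜ := by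
      ext w
      constructor
      · rintro ⟨x, hx, rfl⟩
        refine ⟨x.2.2, ?_⟩
        rintro ⟨x', hx', he⟩
        have : x' = x := hi (hKS hx'.1) (hsS x.2) he
        exact hx'.2 ⟨this ▸ x.2, this ▸ hx⟩
      · rintro ⟨hw, hw'⟩
        obtain ⟨x, hx, rfl⟩ := hW hw
        have hxs : x ∈ s := ⟨hx, hw⟩
        by_cases hxV : x ∈ V'
        · exact ⟨⟨x, hxs⟩, hxV, rfl⟩
        · exact absurd ⟨x, ⟨interior_subset hx, fun h => hxV h.2⟩, rfl⟩ hw'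
    rw [e]
    refine hWo.inter (IsCompact.isClosed ?_).isOpen_compl
    exact (hK.diff (hso.inter hV')).image_of_continuousOn (hf.mono (sdiff_subset.trans hKS))
  refine ⟨OpenPartialHomeomorph.ofContinuousOpenRestrict hbij.toPartialEquiv
    (hf.mono hsS) hopen hso, ⟨mem_interior_iff_mem_nhds.2 hKm, hmW⟩, hsS, fun x _ => rfl⟩

/-! ### Hyperbolic structures from developing maps -/

namespace TriangularDecomposition

variable {M : Type u} [TopologicalSpace M] {T : Type v} (D : TriangularDecomposition M T)

theorem sideGluing_symm {p q : T × StdTriangle} (h : SideGluing D.glue D.perm p q) :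
    SideGluing D.glue D.perm q p := by
  obtain ⟨i, h0, h1, h2⟩ := h
  have e : (q.1, D.perm (p.1, i) i) = D.glue (p.1, i) :=
    Prod.ext h1 (D.perm_side (p.1, i))
  refine ⟨D.perm (p.1, i) i, by rw [h2, h0], ?_, fun j => ?_⟩
  · rw [e, D.glue_glue]
  · rw [e, D.perm_glue, ← h2]
    simp

theorem char_eq_of_sideGluing {p q : T × StdTriangle} (h : SideGluing D.glue D.perm p q) :
    D.char p.1 p.2 = D.char q.1 q.2 :=
  (D.char_eq_iff _ _ _ _).2 (.rel _ _ h)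

/-- A property which is invariant under side gluings holds for all the points representing the
same point of `M`. -/
theorem of_char_eq {Ω : T × StdTriangle → Prop}
    (h : ∀ p q, SideGluing D.glue D.perm p q → Ω p → Ω q) {p q : T × StdTriangle}
    (he : D.char p.1 p.2 = D.char q.1 q.2) (hp : Ω p) : Ω q := by
  have key : ∀ p q, Relation.EqvGen (SideGluing D.glue D.perm) p q → (Ω p ↔ Ω q) := by
    intro p q hpq
    induction hpq with
    | rel p q h' => exact ⟨h p q h', h q p (D.sideGluing_symm h')⟩
    | refl p => rfl
    | symm p q _ ih => exact ih.symm
    | trans p q r _ _ ih1 ih2 => exact ih1.trans ih2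
  exact (key p q ((D.char_eq_iff _ _ _ _).1 he)).1 hp

/-- M carries the quotient topology of its finitely many compact triangles: the complement of S is a
finite union of compact images, closed because M is Hausdorff. -/
theorem isOpen_of_char [T2Space M] [Finite T] {S : Set M}
    (h : ∀ t, IsOpen (D.char t ⁻¹' S)) : IsOpen S := by
  rw [← isClosed_compl_iff]
  have e : Sᶜ = ⋃ t, D.char t '' (D.char t ⁻¹' S)ᶜ := by
    ext m
    obtain ⟨t, y, rfl⟩ := D.char_surjective m
    constructor
    · intro hm
      exact mem_iUnion.2 ⟨t, y, hm, rfl⟩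
    · intro hm
      obtain ⟨t', y', hy', he⟩ := mem_iUnion.1 hm
      rw [← he]
      exact hy'
  rw [e]
  exact isClosed_iUnion_of_finite fun t =>
    ((h t).isClosed_compl.isCompact.image (D.char t).continuous).isClosed

/-- A local property at m may be checked at each representative of m: the image of the points where
it fails to hold locally is closed and misses m. -/
theorem eventually_of_char [T2Space M] [Finite T] {p : M → Prop} {m : M}
    (h : ∀ t z, D.char t z = m → ∀ᶠ y in 𝓝 z, p (D.char t y)) : ∀ᶠ m' in 𝓝 m, p m' := by
  set O : T → Set StdTriangle := fun t => interior {y | p (D.char t y)} with hO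
  have hcl : IsClosed (⋃ t, D.char t '' (O t)ᶜ) := isClosed_iUnion_of_finite fun t =>
    (isOpen_interior.isClosed_compl.isCompact.image (D.char t).continuous).isClosed
  have hm : m ∈ (⋃ t, D.char t '' (O t)ᶜ)ᶜ := by
    intro hm
    obtain ⟨t, z, hz, he⟩ := mem_iUnion.1 hm
    exact hz (mem_interior_iff_mem_nhds.2 (h t z he))
  filter_upwards [hcl.isOpen_compl.mem_nhds hm] with m' hm'
  obtain ⟨t, y, rfl⟩ := D.char_surjective m'
  by_contra hp
  exact hm' (mem_iUnion.2 ⟨t, y, fun hy => hp (interior_subset (s := {y | p (D.char t y)}) hy), rfl⟩)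

variable (r : T → StdTriangle → ℍ) (G : T × Fin 3 → ℍ ≃ᵢ ℍ)

/-- The isometries `G s` identify the glued sides of the realized triangles. -/
structure RealizesGluing : Prop where
  continuous : ∀ t, Continuous (r t)
  glue : ∀ s, D.glue s ≠ s → ∀ y y' : StdTriangle, y.1 s.2 = 0 →
    (∀ j, y'.1 (D.perm s j) = y.1 j) → G s (r (D.glue s).1 y') = r s.1 y

/-- Consistency of the placements `g` of the triangles at the points of `Ω`. -/
structure IsConsistent (Ω : Set (T × StdTriangle)) (g : T × StdTriangle → ℍ ≃ᵢ ℍ) : Prop where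
  isOpen : ∀ t, IsOpen {y | (t, y) ∈ Ω}
  glue_mem : ∀ p q, SideGluing D.glue D.perm p q → p ∈ Ω → q ∈ Ω
  locally_const : ∀ t z, (t, z) ∈ Ω → ∀ᶠ y in 𝓝 z, g (t, y) = g (t, z)
  adj : ∀ p ∈ Ω, ∀ i, p.2.1 i = 0 → D.glue (p.1, i) ≠ (p.1, i) → ∀ q : T × StdTriangle,
    q.1 = (D.glue (p.1, i)).1 → (∀ j, q.2.1 (D.perm (p.1, i) j) = p.2.1 j) →
    g q = (G (p.1, i)).trans (g p)

/-- The developing map of a placement. -/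
def develop (g : T × StdTriangle → ℍ ≃ᵢ ℍ) (p : T × StdTriangle) : ℍ := g p (r p.1 p.2)

variable {D r G}

theorem eq_of_sideGluing_of_glue_eq {p q : T × StdTriangle} {i : Fin 3}
    (hi : D.glue (p.1, i) = (p.1, i)) (h1 : q.1 = (D.glue (p.1, i)).1)
    (h2 : ∀ j, q.2.1 (D.perm (p.1, i) j) = p.2.1 j) : q = p := by
  rw [hi] at h1
  rw [D.perm_boundary _ hi] at h2
  exact Prod.ext h1 (Subtype.ext (funext h2))

namespace IsConsistent

variable {Ω : Set (T × StdTriangle)} {g : T × StdTriangle → ℍ ≃ᵢ ℍ}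

theorem develop_eq_of_sideGluing (hG : D.RealizesGluing r G) (h : D.IsConsistent G Ω g)
    {p q : T × StdTriangle} (hpq : SideGluing D.glue D.perm p q) (hp : p ∈ Ω) :
    develop r g p = develop r g q := by
  obtain ⟨i, h0, h1, h2⟩ := hpq
  by_cases hi : D.glue (p.1, i) = (p.1, i)
  · rw [eq_of_sideGluing_of_glue_eq hi h1 h2]
  · rw [develop, develop, h.adj p hp i h0 hi q h1 h2, IsometryEquiv.trans_apply, h1,
      hG.glue _ hi p.2 q.2 h0 h2]

theorem develop_eq (hG : D.RealizesGluing r G) (h : D.IsConsistent G Ω g)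
    {p q : T × StdTriangle} (he : D.char p.1 p.2 = D.char q.1 q.2) (hp : p ∈ Ω) :
    develop r g p = develop r g q :=
  (D.of_char_eq (Ω := fun q => q ∈ Ω ∧ develop r g p = develop r g q)
    (fun _ q' hq hp' => ⟨h.glue_mem _ q' hq hp'.1,
      hp'.2.trans (h.develop_eq_of_sideGluing hG hq hp'.1)⟩) he ⟨hp, rfl⟩).2

theorem mem_of_char_eq (h : D.IsConsistent G Ω g) {p q : T × StdTriangle}
    (he : D.char p.1 p.2 = D.char q.1 q.2) (hp : p ∈ Ω) : q ∈ Ω :=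
  D.of_char_eq (Ω := (· ∈ Ω)) h.glue_mem he hp

end IsConsistent

variable (D r G)

/-- A chart in which the realized triangles are placed by the isometries `g`. -/
structure IsGeodesicChart (e : OpenPartialHomeomorph M HypHalfPlane)
    (g : T × StdTriangle → ℍ ≃ᵢ ℍ) : Prop where
  consistent : D.IsConsistent G {p | D.char p.1 p.2 ∈ e.source} g
  apply_char : ∀ t y, D.char t y ∈ e.source → (e (D.char t y) : ℍ) = develop r g (t, y)

variable {D r G}

/-- A consistent placement with values in a half plane, injective on `M` and open at a point,
provides a chart near this point. -/
theorem IsConsistent.exists_chart [T2Space M] [CompactSpace M] [Finite T]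
    (hG : D.RealizesGluing r G) {Ω : Set (T × StdTriangle)} {g : T × StdTriangle → ℍ ≃ᵢ ℍ}
    (h : D.IsConsistent G Ω g)
    (hre : ∀ p ∈ Ω, 0 ≤ (develop r g p).re)
    (hinj : ∀ p ∈ Ω, ∀ q ∈ Ω, develop r g p = develop r g q → D.char p.1 p.2 = D.char q.1 q.2)
    {p₀ : T × StdTriangle} (hp₀ : p₀ ∈ Ω)
    (hopen : ∀ U ∈ 𝓝 (D.char p₀.1 p₀.2), ∀ᶠ w in 𝓝 (develop r g p₀), 0 ≤ w.re →
      ∃ p ∈ Ω, D.char p.1 p.2 ∈ U ∧ develop r g p = w) :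
    ∃ e, D.IsGeodesicChart r G e g ∧ D.char p₀.1 p₀.2 ∈ e.source := by
  classical
  set S : Set M := {m | ∃ p ∈ Ω, D.char p.1 p.2 = m} with hSdef
  have hS : ∀ t y, D.char t y ∈ S ↔ (t, y) ∈ Ω := fun t y =>
    ⟨fun ⟨p, hp, he⟩ => h.mem_of_char_eq (q := (t, y)) he hp, fun hp => ⟨_, hp, rfl⟩⟩
  choose rt ry hrep using D.char_surjective
  -- The value at m is computed from a chosen representative. The default `UpperHalfPlane.I` is
  -- never taken on S, where all representatives give the same value with nonnegative real part.
  let f : M → HypHalfPlane := fun m =>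
    if hm : 0 ≤ (develop r g (rt m, ry m)).re then ⟨develop r g (rt m, ry m), hm⟩
    else ⟨UpperHalfPlane.I, le_of_eq (by simp)⟩
  have hf : ∀ t y, (t, y) ∈ Ω → (f (D.char t y) : ℍ) = develop r g (t, y) := by
    intro t y hp
    have he : D.char t y = D.char (rt (D.char t y)) (ry (D.char t y)) := (hrep _).symm
    have hd := h.develop_eq hG (p := (t, y)) (q := (rt (D.char t y), ry (D.char t y))) he hp
    have hre' := hre _ hp
    rw [hd] at hre' ⊢
    simp only [f, dif_pos hre']
  have hSo : IsOpen S := D.isOpen_of_char fun t => by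
    have : D.char t ⁻¹' S = {y | (t, y) ∈ Ω} := by ext y; exact hS t y
    rw [this]
    exact h.isOpen t
  have hcont : ContinuousOn f S := by
    intro m hm
    refine ContinuousAt.continuousWithinAt ?_
    intro V hV
    refine D.eventually_of_char fun t z hz => ?_
    have hz' : (t, z) ∈ Ω := by rw [← hS, hz]; exact hm
    subst hz
    rw [nhds_subtype_eq_comap, hf t z hz'] at hV
    obtain ⟨V', hV', hVV⟩ := hV
    have c : ContinuousAt (fun y => g (t, z) (r t y)) z :=
      ((g (t, z)).continuous.comp (hG.continuous t)).continuousAt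
    filter_upwards [h.locally_const t z hz', (h.isOpen t).mem_nhds hz', c hV'] with y h1 h2 h3
    apply hVV
    change (f (D.char t y) : ℍ) ∈ V'
    rw [hf t y h2, develop, h1]
    exact h3
  have hinjf : InjOn f S := by
    rintro _ ⟨p, hp, rfl⟩ _ ⟨q, hq, rfl⟩ he
    apply hinj p hp q hq
    have := congrArg Subtype.val he
    rwa [hf p.1 p.2 hp, hf q.1 q.2 hq] at this
  obtain ⟨e, hme, heS, hef⟩ := exists_openPartialHomeomorph hSo ⟨p₀, hp₀, rfl⟩ hcont hinjf (by
    intro U hU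
    rw [nhds_subtype_eq_comap, hf p₀.1 p₀.2 hp₀]
    refine mem_of_superset (preimage_mem_comap (hopen U hU)) ?_
    intro w hw
    obtain ⟨p, hp, hpU, hpw⟩ := hw w.2
    exact ⟨_, hpU, Subtype.ext ((hf p.1 p.2 hp).trans hpw)⟩)
  have hsub : ∀ p : T × StdTriangle, D.char p.1 p.2 ∈ e.source → p ∈ Ω := fun p hp =>
    (hS p.1 p.2).1 (heS hp)
  refine ⟨e, ⟨⟨fun t => e.open_source.preimage (D.char t).continuous, fun p q hpq hp => ?_,
    fun t z hz => h.locally_const t z (hsub (t, z) hz), fun p hp => h.adj p (hsub p hp)⟩,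
    fun t y hy => ?_⟩, hme⟩
  · change D.char q.1 q.2 ∈ e.source
    rw [← D.char_eq_of_sideGluing hpq]
    exact hp
  · rw [hef _ hy, hf t y (hsub (t, y) hy)]

/-- A consistent placement, injective on `M` and open at a point, provides a chart near this
point. -/
theorem IsConsistent.exists_chart_interior [T2Space M] [CompactSpace M] [Finite T]
    (hG : D.RealizesGluing r G) {Ω : Set (T × StdTriangle)} {g : T × StdTriangle → ℍ ≃ᵢ ℍ}
    (h : D.IsConsistent G Ω g)
    (hinj : ∀ p ∈ Ω, ∀ q ∈ Ω, develop r g p = develop r g q → D.char p.1 p.2 = D.char q.1 q.2)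
    {p₀ : T × StdTriangle} (hp₀ : p₀ ∈ Ω)
    (hopen : ∀ U ∈ 𝓝 (D.char p₀.1 p₀.2), ∀ᶠ w in 𝓝 (develop r g p₀),
      ∃ p ∈ Ω, D.char p.1 p.2 ∈ U ∧ develop r g p = w) :
    ∃ e g', D.IsGeodesicChart r G e g' ∧ D.char p₀.1 p₀.2 ∈ e.source := by
  -- A real translation moves the image of the base point to real part 1. Restricting to positive
  -- real part then keeps the chart away from the edge of the model half plane.
  set a : ℝ := 1 - (develop r g p₀).re with ha
  have : IsIsometricVAdd ℝ ℍ := ⟨UpperHalfPlane.isometry_real_vadd⟩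
  set τ : ℍ ≃ᵢ ℍ := IsometryEquiv.constVAdd a with hτ
  have hτre : ∀ z, (τ z).re = a + z.re := fun z => UpperHalfPlane.vadd_re a z
  set g' : T × StdTriangle → ℍ ≃ᵢ ℍ := fun p => (g p).trans τ with hg'
  have hdev : ∀ p, develop r g' p = τ (develop r g p) := fun p => rfl
  set Ω' : Set (T × StdTriangle) := {p | p ∈ Ω ∧ 0 < (develop r g' p).re} with hΩ'
  have hcons : D.IsConsistent G Ω' g' := by
    refine ⟨fun t => ?_, fun p q hpq hp => ⟨h.glue_mem p q hpq hp.1, ?_⟩, fun t z hz => ?_,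
      fun p hp i h0 hi q h1 h2 => ?_⟩
    · rw [isOpen_iff_mem_nhds]
      intro z hz
      have c : Continuous (fun y => (τ (g (t, z) (r t y))).re) :=
        UpperHalfPlane.continuous_re.comp
          (τ.continuous.comp ((g (t, z)).continuous.comp (hG.continuous t)))
      filter_upwards [h.locally_const t z hz.1, (h.isOpen t).mem_nhds hz.1,
        c.continuousAt.eventually_const_lt hz.2] with y h1 h2 h3
      refine ⟨h2, ?_⟩
      rw [hdev, develop, h1]
      exact h3
    · rw [hdev, ← h.develop_eq_of_sideGluing hG hpq hp.1]
      exact hp.2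
    · filter_upwards [h.locally_const t z hz.1] with y hy
      rw [hg']
      simp only [hy]
    · simp only [hg', h.adj p hp.1 i h0 hi q h1 h2]
      rfl
  have hp₀' : p₀ ∈ Ω' := by
    refine ⟨hp₀, ?_⟩
    rw [hdev, hτre, ha]
    linarith
  obtain ⟨e, he, hm⟩ := hcons.exists_chart hG (fun p hp => hp.2.le)
    (fun p hp q hq hpq => hinj p hp.1 q hq.1 (τ.injective hpq)) hp₀' (by
      intro U hU
      have h1 : ∀ᶠ w in 𝓝 (develop r g' p₀), 0 < w.re :=
        UpperHalfPlane.continuous_re.continuousAt.eventually_const_lt hp₀'.2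
      have h2 : Tendsto τ.symm (𝓝 (develop r g' p₀)) (𝓝 (develop r g p₀)) := by
        have := τ.symm.continuous.tendsto (develop r g' p₀)
        rwa [hdev, τ.symm_apply_apply] at this
      filter_upwards [h1, h2.eventually (hopen U hU)] with w hw hw' _
      obtain ⟨p, hp, hpU, hpw⟩ := hw'
      have e : develop r g' p = w := by rw [hdev, hpw, τ.apply_symm_apply]
      exact ⟨p, ⟨hp, by rw [e]; exact hw⟩, hpU, e⟩)
  exact ⟨e, g', he, hm⟩

/-- Geodesic charts around all points provide a hyperbolic structure. -/
theorem isUniform_of_charts [T2Space M] [Fintype T] {x : T × Fin 3 → ℝ}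
    (hx : x ∈ D.angleSystems) (hr : ∀ t, IsHypRealization (fun i => x (t, i)) (r t))
    (hch : ∀ p : T × StdTriangle, ∃ e g, D.IsGeodesicChart r G e g ∧ D.char p.1 p.2 ∈ e.source) :
    D.IsUniform x := by
  have loc : ∀ {e g}, D.IsGeodesicChart r G e g → ∀ t z, D.char t z ∈ e.source →
      ∀ᶠ y in 𝓝 z, (e (D.char t y) : ℍ) = g (t, z) (r t y) := by
    intro e g he t z hz
    filter_upwards [he.consistent.locally_const t z hz,
      (he.consistent.isOpen t).mem_nhds hz] with y h1 h2
    rw [he.apply_char t y h2, develop, h1]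
  refine ⟨hx, r, hr, ⟨{e | ∃ g, D.IsGeodesicChart r G e g}, fun m => ?_, ?_⟩, ?_⟩
  · obtain ⟨t, y, rfl⟩ := D.char_surjective m
    obtain ⟨e, g, he, hm⟩ := hch (t, y)
    exact ⟨e, ⟨g, he⟩, hm⟩
  · rintro e ⟨g, he⟩ e' ⟨g', he'⟩ m ⟨hm, hm'⟩
    obtain ⟨t, z, rfl⟩ := D.char_surjective m
    refine ⟨(g (t, z)).symm.trans (g' (t, z)), D.eventually_of_char fun t' z' hz' => ?_⟩
    -- Crossing a side precomposes both placements with the same isometry G s, so the coordinate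
    -- change is the same for every representative of m.
    have key : D.char t' z' ∈ e.source ∧ D.char t' z' ∈ e'.source ∧
        (g (t', z')).symm.trans (g' (t', z')) = (g (t, z)).symm.trans (g' (t, z)) := by
      refine D.of_char_eq (Ω := fun p => D.char p.1 p.2 ∈ e.source ∧ D.char p.1 p.2 ∈ e'.source ∧
        (g p).symm.trans (g' p) = (g (t, z)).symm.trans (g' (t, z))) (fun p q hpq hp => ?_)
        (p := (t, z)) (q := (t', z')) hz'.symm ⟨hm, hm', rfl⟩
      have hc := D.char_eq_of_sideGluing hpq
      refine ⟨hc ▸ hp.1, hc ▸ hp.2.1, ?_⟩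
      obtain ⟨i, h0, h1, h2⟩ := hpq
      by_cases hi : D.glue (p.1, i) = (p.1, i)
      · rw [eq_of_sideGluing_of_glue_eq hi h1 h2]
        exact hp.2.2
      · rw [he.consistent.adj p hp.1 i h0 hi q h1 h2, he'.consistent.adj p hp.2.1 i h0 hi q h1 h2,
          ← hp.2.2]
        ext1 w
        simp [IsometryEquiv.trans_apply]
    filter_upwards [loc he t' z' key.1, loc he' t' z' key.2.1] with y h1 h2
    rw [h1, h2, ← key.2.2]
    simp [IsometryEquiv.trans_apply]
  · rintro t z e ⟨g, he⟩ hz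
    exact ⟨g (t, z), loc he t z hz⟩

end TriangularDecomposition

/-! ### Adjacent geodesic triangles -/

namespace Mink

variable {A A' : Fin 3 → ℝ} {P Q P' Q' R : Fin 3 → Fin 3 → ℝ} {i : Fin 3} {π : Equiv.Perm (Fin 3)}

open Classical in
/-- The isometry carrying a triple to a congruent one. -/
def moveTo (P Q : Fin 3 → Fin 3 → ℝ) : ℍ ≃ᵢ ℍ :=
  if h : IsTriple P ∧ IsTriple Q ∧ Congruent P Q then isometryOf h.1 h.2.1 h.2.2
  else IsometryEquiv.refl ℍ

theorem moveTo_eq (hP : IsTriple P) (hQ : IsTriple Q) (h : Congruent P Q) :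
    moveTo P Q = isometryOf hP hQ h := by
  rw [moveTo, dif_pos ⟨hP, hQ, h⟩]

theorem moveTo_point (hP : HasAngles A P) (hQ : HasAngles A Q) (y : StdTriangle) :
    moveTo P Q (point P y.1) = point Q y.1 := by
  rw [moveTo_eq hP.toIsTriple hQ.toIsTriple (hP.congruent hQ), isometryOf_point]

theorem moveTo_trans (hP : HasAngles A P) (hQ : HasAngles A Q) (hR : HasAngles A R) :
    (moveTo P Q).trans (moveTo Q R) = moveTo P R := by
  ext1 z
  rw [moveTo_eq hP.toIsTriple hQ.toIsTriple (hP.congruent hQ),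
    moveTo_eq hQ.toIsTriple hR.toIsTriple (hQ.congruent hR),
    moveTo_eq hP.toIsTriple hR.toIsTriple (hP.congruent hR), IsometryEquiv.trans_apply,
    isometryOf_apply, isometryOf_apply, isometryOf_apply,
    ofUHP_toUHP_transfer hP.toIsTriple hQ.toIsTriple (hP.congruent hQ)]
  congr 1
  rw [transfer, transfer, transfer, coord_comb hQ.ind]

/-- The triples `P` and `P'` share the side opposite to the `i`-th vertex of `P` and lie on opposite
sides of it. -/
structure Adjacent (i : Fin 3) (π : Equiv.Perm (Fin 3)) (P P' : Fin 3 → Fin 3 → ℝ) : Prop where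
  shared : ∀ j, j ≠ i → P' (π j) = P j
  opposite : coord P (P' (π i)) i < 0

/-- Solving the expansion of the opposite vertex for P i gives the coordinate 1 / c i, which has the
same sign as c i. -/
theorem Adjacent.symm (h : Adjacent i π P P') (hP : IsTriple P) (hP' : IsTriple P') :
    Adjacent (π i) π⁻¹ P' P := by
  refine ⟨fun j hj => ?_, ?_⟩
  · obtain ⟨j, rfl⟩ := π.surjective j
    have : j ≠ i := fun h => hj (by rw [h])
    rw [h.shared j this]
    simp
  · obtain ⟨j, k, hij, hik, hjk⟩ := IsHypAngles.exists_distinct i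
    have hc := h.opposite
    set c := coord P (P' (π i)) with hcdef
    have e : P' (π i) = c i • P i + c j • P j + c k • P k := by
      rw [← comb_eq P c hij hik hjk, hcdef, comb_coord hP.ind]
    set d : Fin 3 → ℝ := Pi.single (π i) (c i)⁻¹ + Pi.single (π j) (-(c i)⁻¹ * c j) +
      Pi.single (π k) (-(c i)⁻¹ * c k) with hd
    have inj := π.injective
    have hdi : d (π i) = (c i)⁻¹ := by
      simp [hd, (inj.ne hij), (inj.ne hik)]
    have hdj : d (π j) = -(c i)⁻¹ * c j := by
      simp [hd, (inj.ne hij.symm), (inj.ne hjk)]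
    have hdk : d (π k) = -(c i)⁻¹ * c k := by
      simp [hd, (inj.ne hik.symm), (inj.ne hjk.symm)]
    have e2 : P i = comb P' d := by
      rw [comb_eq P' d (inj.ne hij) (inj.ne hik) (inj.ne hjk), hdi, hdj, hdk, h.shared j hij.symm,
        h.shared k hik.symm, e, smul_add, smul_add, smul_smul, inv_mul_cancel₀ hc.ne, one_smul,
        smul_smul, smul_smul]
      module
    rw [Equiv.Perm.inv_def, Equiv.symm_apply_apply, e2, coord_comb hP'.ind, hdi]
    exact inv_lt_zero.2 hc

/-- This is rigidity in the form used for gluing: the isometry moving one triangle of an adjacent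
pair also moves the other. -/
theorem Adjacent.moveTo_eq (h : Adjacent i π P P') (h' : Adjacent i π Q Q') (hP : HasAngles A P)
    (hP' : HasAngles A' P') (hQ : HasAngles A Q) (hQ' : HasAngles A' Q') :
    moveTo P Q = moveTo P' Q' := by
  rw [Mink.moveTo_eq hP.toIsTriple hQ.toIsTriple (hP.congruent hQ),
    Mink.moveTo_eq hP'.toIsTriple hQ'.toIsTriple (hP'.congruent hQ')]
  exact isometryOf_adjacent _ _ _ _ _ _ i π h.shared h'.shared h.opposite h'.opposite

theorem Adjacent.point_eq (h : Adjacent i π P P') {y y' : Fin 3 → ℝ} (hy : y i = 0)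
    (hyy : ∀ j, y' (π j) = y j) : point P' y' = point P y := by
  obtain ⟨j, k, hij, hik, hjk⟩ := IsHypAngles.exists_distinct i
  have inj := π.injective
  rw [point, point, comb_eq P y hij hik hjk,
    comb_eq P' y' (inj.ne hij) (inj.ne hik) (inj.ne hjk), hyy, hyy, hyy, hy,
    h.shared j hij.symm, h.shared k hik.symm, zero_smul, zero_smul]

/-- A linear functional vanishing on the line through the base point in the direction `β`. -/
def sideForm (β : ℝ) (v : Fin 3 → ℝ) : ℝ := Real.cos β * v 2 - Real.sin β * v 1

theorem sideForm_comb (β : ℝ) (P : Fin 3 → Fin 3 → ℝ) (c : Fin 3 → ℝ) {i j k : Fin 3} (hij : i ≠ j)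
    (hik : i ≠ k) (hjk : j ≠ k) : sideForm β (comb P c) =
      c i * sideForm β (P i) + c j * sideForm β (P j) + c k * sideForm β (P k) := by
  rw [comb_eq P c hij hik hjk]
  simp only [sideForm, Pi.add_apply, Pi.smul_apply, smul_eq_mul]
  ring

theorem sideForm_polar (β c s α : ℝ) : sideForm β (polar c s α) = s * Real.sin (α - β) := by
  simp only [sideForm, polar, Matrix.cons_val, Real.sin_sub]; ring

theorem sideForm_zero (v : Fin 3 → ℝ) : sideForm 0 v = v 2 := by simp [sideForm]

/-- A functional that vanishes on two vectors of a basis is a multiple of the third coordinate, so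
its sign detects the side of the line. -/
theorem sideForm_eq_coord {β : ℝ} (hP : IsTriple P) (h0 : ∀ j, j ≠ i → sideForm β (P j) = 0)
    (v : Fin 3 → ℝ) : sideForm β v = coord P v i * sideForm β (P i) := by
  obtain ⟨j, k, hij, hik, hjk⟩ := IsHypAngles.exists_distinct i
  conv_lhs => rw [← comb_coord hP.ind v]
  rw [sideForm_comb β P _ hij hik hjk, h0 j hij.symm, h0 k hik.symm]
  ring

theorem adjacent_of_sideForm {β : ℝ} (hP : IsTriple P) (hs : ∀ j, j ≠ i → P' (π j) = P j)
    (h0 : ∀ j, j ≠ i → sideForm β (P j) = 0)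
    (h1 : sideForm β (P' (π i)) * sideForm β (P i) < 0) : Adjacent i π P P' := by
  refine ⟨hs, ?_⟩
  rw [sideForm_eq_coord hP h0] at h1
  by_contra hc
  have := mul_nonneg (not_lt.1 hc) (mul_self_nonneg (sideForm β (P i)))
  linarith

/-- Triangles with a side of the same length can be placed on both sides of a line. -/
theorem exists_adjacent (hA : IsHypAngles A) (hA' : IsHypAngles A') (i : Fin 3)
    (π : Equiv.Perm (Fin 3)) (h : sideCosh A i = sideCosh A' (π i)) :
    ∃ P P', HasAngles A P ∧ HasAngles A' P' ∧ Adjacent i π P P' ∧ (∀ j, j ≠ i → P j 2 = 0) ∧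
      0 < P i 2 ∧ P' (π i) 2 < 0 := by
  obtain ⟨j, k, hij, hik, hjk⟩ := IsHypAngles.exists_distinct i
  have inj := π.injective
  have hl : ∀ l, l ≠ i → l = j ∨ l = k := by
    clear * - hij hik hjk; revert i j k; decide
  -- The common side starts at the base point in direction 0; opposite orientations ε put the two
  -- apexes on opposite sides of it.
  have hP := hasAngles_place hA hjk 0 (ε := 1) (Or.inl rfl)
  have hP' := hasAngles_place hA' (inj.ne hjk) 0 (ε := -1) (Or.inr rfl)
  have e1 := place_fst A j k 0 1
  have e2 := place_snd A hjk hij.symm hik.symm 0 1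
  have e3 := place_third A hij.symm hik.symm 0 1
  have f1 := place_fst A' (π j) (π k) 0 (-1)
  have f2 := place_snd A' (inj.ne hjk) (inj.ne hij.symm) (inj.ne hik.symm) 0 (-1)
  have f3 := place_third A' (inj.ne hij.symm) (inj.ne hik.symm) 0 (-1)
  set P := place A j k 0 1
  set P' := place A' (π j) (π k) 0 (-1)
  have hsinh : sideSinh A i = sideSinh A' (π i) := by rw [sideSinh, sideSinh, h]
  have hs : ∀ l, l ≠ i → P' (π l) = P l := by
    intro l hli
    rcases hl l hli with rfl | rfl
    · rw [e1, f1]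
    · rw [e2, f2, h, hsinh]
  have h0 : ∀ l, l ≠ i → sideForm 0 (P l) = 0 := by
    intro l hli
    rcases hl l hli with rfl | rfl
    · rw [e1, sideForm_polar]; simp
    · rw [e2, sideForm_polar]; simp
  have p1 : 0 < sideForm 0 (P i) := by
    rw [e3, sideForm_polar]
    have := hA.sideSinh_pos k
    have := hA.sin_pos j
    simp only [zero_add, one_mul, sub_zero]
    positivity
  have p2 : sideForm 0 (P' (π i)) < 0 := by
    rw [f3, sideForm_polar]
    have h1 := mul_pos (hA'.sideSinh_pos (π k)) (hA'.sin_pos (π j))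
    simp only [zero_add, neg_mul, one_mul, sub_zero, Real.sin_neg, mul_neg]
    linarith
  refine ⟨P, P', hP, hP', adjacent_of_sideForm hP.toIsTriple hs h0
    (mul_neg_of_neg_of_pos p2 p1), fun l hli => ?_, ?_, ?_⟩
  · exact (sideForm_zero _).symm.trans (h0 l hli)
  · exact p1.trans_eq (sideForm_zero _)
  · exact (sideForm_zero _).symm.trans_lt p2

/-- The geodesic triangle covers, near each of its points, the cone determined by the sides
through this point. -/
theorem eventually_exists_point (hP : IsTriple P) {z : StdTriangle} {N : Set StdTriangle}
    (hN : N ∈ 𝓝 z) : ∀ᶠ w in 𝓝 (point P z.1),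
      (∀ j, z.1 j = 0 → 0 ≤ coord P (ofUHP w) j) → ∃ y ∈ N, point P y.1 = w := by
  obtain ⟨s, hs, hz⟩ := ofUHP_point hP z
  have c : Continuous fun w => coord P (ofUHP w) := (continuous_coord P).comp continuous_ofUHP
  have hc0 : coord P (ofUHP (point P z.1)) = s • z.1 := by rw [hz, coord_comb hP.ind]
  have hsum : ∀ (s : ℝ) (z : StdTriangle), ∑ j, (s • z.1) j = s := fun s z => by
    simp only [Pi.smul_apply, smul_eq_mul, ← Finset.mul_sum, z.2.2, mul_one]
  -- Coordinates that are positive at z stay positive nearby, so only those vanishing at z constrain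
  -- w.
  have hpos : ∀ᶠ w in 𝓝 (point P z.1), ∀ j, z.1 j ≠ 0 → 0 ≤ coord P (ofUHP w) j := by
    refine eventually_all.2 fun j => ?_
    by_cases hj : z.1 j = 0
    · exact Eventually.of_forall fun w h => absurd hj h
    · have h1 : 0 < coord P (ofUHP (point P z.1)) j := by
        rw [hc0]
        exact mul_pos hs (lt_of_le_of_ne (z.2.1 j) (Ne.symm hj))
      exact (((continuous_apply j).comp c).continuousAt.eventually_const_lt h1).mono
        fun w hw _ => le_of_lt hw
  obtain ⟨N', hN', hNN⟩ := mem_nhds_subtype _ _ _ |>.1 hN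
  have hnear : ∀ᶠ w in 𝓝 (point P z.1),
      (∑ j, coord P (ofUHP w) j)⁻¹ • coord P (ofUHP w) ∈ N' := by
    have c1 : ContinuousAt (fun w => (∑ j, coord P (ofUHP w) j)⁻¹ • coord P (ofUHP w))
        (point P z.1) := by
      have c2 : Continuous fun w => ∑ j, coord P (ofUHP w) j :=
        continuous_finsetSum _ fun j _ => (continuous_apply j).comp c
      exact ContinuousAt.smul (c2.continuousAt.inv₀ (by rw [hc0, hsum]; exact hs.ne'))
        c.continuousAt
    have h2 : (∑ j, coord P (ofUHP (point P z.1)) j)⁻¹ • coord P (ofUHP (point P z.1)) = z.1 := by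
      rw [hc0, hsum, smul_smul, inv_mul_cancel₀ hs.ne', one_smul]
    apply c1
    beta_reduce
    rw [h2]
    exact hN'
  filter_upwards [hpos, hnear] with w h1 h2 h3
  obtain ⟨y, s', hs', hy, hyw⟩ := exists_std_point hP (z := w) (c := coord P (ofUHP w))
    (fun j => by
      by_cases hj : z.1 j = 0
      exacts [h3 j hj, h1 j hj]) (comb_coord hP.ind _).symm
  refine ⟨y, hNN ?_, hyw⟩
  rw [hy, hsum, smul_smul, inv_mul_cancel₀ hs'.ne', one_smul] at h2
  exact h2

end Mink

/-! ### The isometries gluing the triangles -/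

namespace TriangularDecomposition

open Mink

variable {M : Type u} [TopologicalSpace M] {T : Type v} (D : TriangularDecomposition M T)

/-- The reference placement of the triangle `t` with the angles prescribed by `x`. -/
def baseTriple (x : T × Fin 3 → ℝ) (t : T) : Fin 3 → Fin 3 → ℝ := place (fun i => x (t, i)) 0 1 0 1

/-- The realization of the triangle `t` with the angles prescribed by `x`. -/
def baseRealization (x : T × Fin 3 → ℝ) (t : T) (y : StdTriangle) : ℍ := point (baseTriple x t) y.1

variable {x : T × Fin 3 → ℝ}

/-- The isometries `G s` describe the relative position of adjacent triangles. -/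
def IsSideIsometry (x : T × Fin 3 → ℝ) (G : T × Fin 3 → ℍ ≃ᵢ ℍ) : Prop :=
  ∀ s P P', HasAngles (fun i => x (s.1, i)) P → HasAngles (fun i => x ((D.glue s).1, i)) P' →
    Adjacent s.2 (D.perm s) P P' →
    moveTo (baseTriple x (D.glue s).1) P' = (G s).trans (moveTo (baseTriple x s.1) P)

variable {D} in
/-- Consistency of placements given by adjacent triples. -/
theorem IsSideIsometry.adj {G : T × Fin 3 → ℍ ≃ᵢ ℍ} (hG : D.IsSideIsometry x G) {s : T × Fin 3}
    {t' : T} (ht' : t' = (D.glue s).1) {P P' : Fin 3 → Fin 3 → ℝ}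
    (hP : HasAngles (fun i => x (s.1, i)) P)
    (hP' : HasAngles (fun i => x (t', i)) P') (h : Adjacent s.2 (D.perm s) P P') :
    moveTo (baseTriple x t') P' = (G s).trans (moveTo (baseTriple x s.1) P) := by
  subst ht'
  exact hG s P P' hP hP' h

variable [Fintype T]

theorem hasAngles_baseTriple (hx : x ∈ D.angleSystems) (t : T) :
    HasAngles (fun i => x (t, i)) (baseTriple x t) :=
  hasAngles_place (D.isHypAngles hx t) (by decide) 0 (Or.inl rfl)

/-- One adjacent pair is used to define the isometry; rigidity shows that every other adjacent pair
gives the same one. -/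
theorem exists_isSideIsometry (hx : x ∈ D.angleSystems) (h : D.SidesMatch x) :
    ∃ G, D.IsSideIsometry x G := by
  have key : ∀ s : T × Fin 3, ∃ g : ℍ ≃ᵢ ℍ, ∀ P P', HasAngles (fun i => x (s.1, i)) P →
      HasAngles (fun i => x ((D.glue s).1, i)) P' → Adjacent s.2 (D.perm s) P P' →
      moveTo (baseTriple x (D.glue s).1) P' = g.trans (moveTo (baseTriple x s.1) P) := by
    intro s
    obtain ⟨Q, Q', hQ, hQ', hadj, -⟩ := exists_adjacent (D.isHypAngles hx s.1)
      (D.isHypAngles hx (D.glue s).1) s.2 (D.perm s) (by rw [D.perm_side]; exact h s)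
    refine ⟨(moveTo (baseTriple x (D.glue s).1) Q').trans (moveTo (baseTriple x s.1) Q).symm,
      fun P P' hP hP' hadj' => ?_⟩
    rw [← moveTo_trans (D.hasAngles_baseTriple hx _) hQ' hP',
      ← moveTo_trans (D.hasAngles_baseTriple hx _) hQ hP,
      hadj.moveTo_eq hadj' hQ hQ' hP hP']
    ext1 z
    simp [IsometryEquiv.trans_apply]
  exact Classical.skolem.1 key

variable {D} in
theorem IsSideIsometry.realizesGluing {G : T × Fin 3 → ℍ ≃ᵢ ℍ} (hG : D.IsSideIsometry x G)
    (hx : x ∈ D.angleSystems) (h : D.SidesMatch x) :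
    D.RealizesGluing (baseRealization x) G where
  continuous t := continuous_point (D.hasAngles_baseTriple hx t).toIsTriple
  glue s _ y y' hy hyy := by
    obtain ⟨Q, Q', hQ, hQ', hadj, -⟩ := exists_adjacent (D.isHypAngles hx s.1)
      (D.isHypAngles hx (D.glue s).1) s.2 (D.perm s) (by rw [D.perm_side]; exact h s)
    apply (moveTo (baseTriple x s.1) Q).injective
    rw [← IsometryEquiv.trans_apply, ← hG s Q Q' hQ hQ' hadj, baseRealization, baseRealization,
      moveTo_point (D.hasAngles_baseTriple hx _) hQ', moveTo_point (D.hasAngles_baseTriple hx _) hQ,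
      hadj.point_eq hy hyy]

end TriangularDecomposition

/-! ### Charts at interior points and at edges -/

theorem Mink.ofUHP_two (w : ℍ) : ofUHP w 2 = w.re / w.im := rfl

/-- The third hyperboloid coordinate is re / im and has the sign of the real part. A triangle with
one side on the geodesic re = 0 therefore lies on the side of its apex. -/
theorem Mink.point_two {P : Fin 3 → Fin 3 → ℝ} (hP : IsTriple P) {i : Fin 3}
    (h0 : ∀ j, j ≠ i → P j 2 = 0) (y : StdTriangle) :
    ∃ s : ℝ, 0 < s ∧ ofUHP (point P y.1) 2 = s * y.1 i * P i 2 := by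
  obtain ⟨s, hs, e⟩ := ofUHP_point hP y
  refine ⟨s, hs, ?_⟩
  rw [e, ← sideForm_zero (comb P _), sideForm_eq_coord hP (i := i)
    (fun j hj => by rw [sideForm_zero]; exact h0 j hj), coord_comb hP.ind, sideForm_zero]
  rfl

namespace TriangularDecomposition

open Mink

variable {M : Type u} [TopologicalSpace M] {T : Type v} {D : TriangularDecomposition M T}

theorem isOpen_setOf_fst {t t' : T} {O : Set StdTriangle} (hO : IsOpen O) :
    IsOpen {y | t' = t ∧ y ∈ O} := by
  by_cases h : t' = t
  · simpa [h] using hO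
  · simp [h]

variable [T2Space M] [CompactSpace M] [Fintype T] {x : T × Fin 3 → ℝ} {G : T × Fin 3 → ℍ ≃ᵢ ℍ}

theorem exists_chart_of_pos (hx : x ∈ D.angleSystems) (h : D.SidesMatch x)
    (hG : D.IsSideIsometry x G) {t : T} {z : StdTriangle} (hz : ∀ i, 0 < z.1 i) :
    ∃ e g, D.IsGeodesicChart (baseRealization x) G e g ∧ D.char t z ∈ e.source := by
  set O : Set StdTriangle := {y | ∀ i, 0 < y.1 i} with hOdef
  have hO : IsOpen O := by
    simp only [hOdef, ofPred_forall]
    exact isOpen_iInter_of_finite fun i => isOpen_lt continuous_const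
      ((continuous_apply i).comp continuous_subtype_val)
  have hcons : D.IsConsistent G {p | p.1 = t ∧ p.2 ∈ O} fun _ => IsometryEquiv.refl ℍ := by
    refine ⟨fun t' => isOpen_setOf_fst hO, fun p q hpq hp => ?_, fun _ _ _ =>
      Eventually.of_forall fun _ => rfl, fun p hp i h0 => ?_⟩
    · obtain ⟨i, h0, -⟩ := hpq
      exact absurd h0 (hp.2 i).ne'
    · exact absurd h0 (hp.2 i).ne'
  refine hcons.exists_chart_interior (hG.realizesGluing hx h) (p₀ := (t, z)) ?_ ⟨rfl, hz⟩ ?_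
  · rintro ⟨t₁, y₁⟩ ⟨rfl, -⟩ ⟨t₂, y₂⟩ ⟨h₂, -⟩ he
    simp only at h₂
    subst h₂
    rw [point_injective (D.hasAngles_baseTriple hx t₂).toIsTriple he]
  · intro U hU
    have hN : (D.char t) ⁻¹' U ∩ O ∈ 𝓝 z :=
      inter_mem ((D.char t).continuous.continuousAt hU) (hO.mem_nhds hz)
    filter_upwards [eventually_exists_point (D.hasAngles_baseTriple hx t).toIsTriple hN] with w hw
    obtain ⟨y, hy, hyw⟩ := hw fun j hj => absurd hj (hz j).ne'
    exact ⟨(t, y), ⟨rfl, hy.2⟩, hy.1, hyw⟩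

/-- The region of a triangle near one of its sides. -/
def sideRegion (i : Fin 3) : Set StdTriangle := {y | ∀ j, j ≠ i → y.1 i < y.1 j}

theorem isOpen_sideRegion (i : Fin 3) : IsOpen (sideRegion i) := by
  simp only [sideRegion, ofPred_forall]
  exact isOpen_iInter_of_finite fun j => isOpen_iInter_of_finite fun _ =>
    isOpen_lt ((continuous_apply i).comp continuous_subtype_val)
      ((continuous_apply j).comp continuous_subtype_val)

theorem eq_of_mem_sideRegion {i j : Fin 3} {y : StdTriangle} (hy : y ∈ sideRegion i)
    (hj : y.1 j = 0) : j = i := by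
  by_contra hne
  have := hy j hne
  rw [hj] at this
  exact absurd this (not_lt.2 (y.2.1 i))

theorem sideRegion_of_perm {π : Equiv.Perm (Fin 3)} {i : Fin 3} {y y' : StdTriangle}
    (hy : y ∈ sideRegion i) (h : ∀ j, y'.1 (π j) = y.1 j) : y' ∈ sideRegion (π i) := by
  intro j hj
  obtain ⟨j, rfl⟩ := π.surjective j
  rw [h, h]
  exact hy j fun he => hj (by rw [he])

/-- The triangle is placed with its boundary side on re = 0 and its apex in re > 0, so that side
lands on the edge of the model half plane. -/
theorem exists_chart_of_boundary_side (hx : x ∈ D.angleSystems) (h : D.SidesMatch x)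
    (hG : D.IsSideIsometry x G) {s : T × Fin 3} (hs : D.glue s = s) {z : StdTriangle}
    (hz : z ∈ sideRegion s.2) :
    ∃ e g, D.IsGeodesicChart (baseRealization x) G e g ∧ D.char s.1 z ∈ e.source := by
  obtain ⟨P, -, hP, -, -, hP0, hPi, -⟩ := exists_adjacent (D.isHypAngles hx s.1)
    (D.isHypAngles hx s.1) s.2 1 rfl
  have hB := D.hasAngles_baseTriple hx s.1
  have hdev : ∀ y, develop (baseRealization x) (fun _ => moveTo (baseTriple x s.1) P) (s.1, y) =
      point P y.1 := fun y => moveTo_point hB hP y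
  have hside : ∀ p : T × StdTriangle, p.1 = s.1 → p.2 ∈ sideRegion s.2 → ∀ i, p.2.1 i = 0 →
      D.glue (p.1, i) = (p.1, i) := by
    intro p h1 h2 i hi
    rw [h1, eq_of_mem_sideRegion h2 hi]
    exact hs
  have hcons : D.IsConsistent G {p | p.1 = s.1 ∧ p.2 ∈ sideRegion s.2}
      fun _ => moveTo (baseTriple x s.1) P := by
    refine ⟨fun t' => isOpen_setOf_fst (isOpen_sideRegion _), fun p q hpq hp => ?_, fun _ _ _ =>
      Eventually.of_forall fun _ => rfl, fun p hp i h0 hne => absurd (hside p hp.1 hp.2 i h0) hne⟩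
    obtain ⟨i, h0, h1, h2⟩ := hpq
    rw [eq_of_sideGluing_of_glue_eq (hside p hp.1 hp.2 i h0) h1 h2]
    exact hp
  refine Exists.imp (fun e he => ⟨_, he⟩) (hcons.exists_chart (hG.realizesGluing hx h)
    (p₀ := (s.1, z)) ?_ ?_ ⟨rfl, hz⟩ ?_)
  · rintro ⟨t, y⟩ ⟨ht, -⟩
    simp only at ht
    subst ht
    rw [hdev]
    obtain ⟨c, hc, e⟩ := point_two hP.toIsTriple hP0 y
    rw [ofUHP_two, div_eq_iff (point P y.1).im_ne_zero] at e
    rw [e]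
    have := y.2.1 s.2
    have := (point P y.1).im_pos
    positivity
  · rintro ⟨t₁, y₁⟩ ⟨h₁, -⟩ ⟨t₂, y₂⟩ ⟨h₂, -⟩ he
    simp only at h₁ h₂
    subst h₁
    rw [hdev] at he
    subst h₂
    rw [hdev] at he
    rw [point_injective hP.toIsTriple he]
  · intro U hU
    have hN : (D.char s.1) ⁻¹' U ∩ sideRegion s.2 ∈ 𝓝 z :=
      inter_mem ((D.char s.1).continuous.continuousAt hU) ((isOpen_sideRegion _).mem_nhds hz)
    rw [hdev]
    filter_upwards [eventually_exists_point hP.toIsTriple hN] with w hw hre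
    obtain ⟨y, hy, hyw⟩ := hw fun j hj => by
      rw [eq_of_mem_sideRegion hz hj]
      have e := sideForm_eq_coord (β := 0) hP.toIsTriple (i := s.2)
        (fun j hj => by rw [sideForm_zero]; exact hP0 j hj) (ofUHP w)
      rw [sideForm_zero, sideForm_zero, ofUHP_two] at e
      have h1 : 0 ≤ coord P (ofUHP w) s.2 * P s.2 2 := by
        rw [← e]; exact div_nonneg hre w.im_pos.le
      exact nonneg_of_mul_nonneg_left h1 hPi
    exact ⟨(s.1, y), ⟨rfl, hy.2⟩, hy.1, by rw [hdev, hyw]⟩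

/-- The two triangles are laid on opposite sides of the geodesic re = 0. Their images can meet only
on the common side, where the gluing identifies them, and together they cover a neighbourhood. -/
theorem exists_chart_of_interior_side (hx : x ∈ D.angleSystems) (h : D.SidesMatch x)
    (hG : D.IsSideIsometry x G) {s : T × Fin 3} (hs : D.glue s ≠ s) {z : StdTriangle}
    (hz0 : z.1 s.2 = 0) (hz : z ∈ sideRegion s.2) :
    ∃ e g, D.IsGeodesicChart (baseRealization x) G e g ∧ D.char s.1 z ∈ e.source := by
  classical
  obtain ⟨P, P', hP, hP', hadj, hP0, hPi, hPi'⟩ := exists_adjacent (D.isHypAngles hx s.1)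
    (D.isHypAngles hx (D.glue s).1) s.2 (D.perm s) (by rw [D.perm_side]; exact h s)
  have hadj' := hadj.symm hP.toIsTriple hP'.toIsTriple
  rw [D.perm_side] at hPi' hadj'
  have hP0' : ∀ j, j ≠ (D.glue s).2 → P' j 2 = 0 := by
    intro j hj
    obtain ⟨j, rfl⟩ := (D.perm s).surjective j
    have hji : j ≠ s.2 := fun he => hj (by rw [he, D.perm_side])
    rw [hadj.shared j hji, hP0 j hji]
  set R : Set (T × StdTriangle) := {p | p.1 = s.1 ∧ p.2 ∈ sideRegion s.2} with hR
  set R' : Set (T × StdTriangle) :=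
    {p | p.1 = (D.glue s).1 ∧ p.2 ∈ sideRegion (D.glue s).2} with hR'
  -- A triangle may be glued to itself along two different sides; the regions remain disjoint
  -- because the smallest coordinate is strictly smallest.
  have hdisj : ∀ p ∈ R', p ∉ R := by
    intro p hp' hp
    have hne : s.2 ≠ (D.glue s).2 := fun he => hs (Prod.ext (hp'.1.symm.trans hp.1) he.symm)
    exact lt_asymm (hp.2 _ hne.symm) (hp'.2 _ hne)
  set g : T × StdTriangle → ℍ ≃ᵢ ℍ := fun p =>
    if p ∈ R then moveTo (baseTriple x p.1) P else moveTo (baseTriple x p.1) P' with hg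
  have hgR : ∀ p ∈ R, g p = moveTo (baseTriple x s.1) P := by
    intro p hp
    rw [hg]
    simp only [hp, if_true, hp.1]
  have hgR' : ∀ p ∈ R', g p = moveTo (baseTriple x (D.glue s).1) P' := by
    intro p hp
    rw [hg]
    simp only [hdisj p hp, if_false, hp.1]
  have hdR : ∀ p ∈ R, develop (baseRealization x) g p = point P p.2.1 := by
    intro p hp
    rw [develop, hgR p hp, hp.1]
    exact moveTo_point (D.hasAngles_baseTriple hx s.1) hP p.2
  have hdR' : ∀ p ∈ R', develop (baseRealization x) g p = point P' p.2.1 := by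
    intro p hp
    rw [develop, hgR' p hp, hp.1]
    exact moveTo_point (D.hasAngles_baseTriple hx (D.glue s).1) hP' p.2
  have hcross : ∀ p ∈ R, ∀ q : T × StdTriangle, q.1 = (D.glue s).1 →
      (∀ j, q.2.1 (D.perm s j) = p.2.1 j) → q ∈ R' := by
    intro p hp q h1 h2
    refine ⟨h1, ?_⟩
    rw [← D.perm_side]
    exact sideRegion_of_perm hp.2 h2
  have hcross' : ∀ p ∈ R', ∀ q : T × StdTriangle, q.1 = s.1 →
      (∀ j, q.2.1 (D.perm (D.glue s) j) = p.2.1 j) → q ∈ R := by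
    intro p hp q h1 h2
    refine ⟨h1, ?_⟩
    have e : s.2 = D.perm (D.glue s) (D.glue s).2 := by rw [D.perm_side, D.glue_glue]
    rw [e]
    exact sideRegion_of_perm hp.2 h2
  have hOR : ∀ t, IsOpen {y | (t, y) ∈ R} := fun t => isOpen_setOf_fst (isOpen_sideRegion _)
  have hOR' : ∀ t, IsOpen {y | (t, y) ∈ R'} := fun t => isOpen_setOf_fst (isOpen_sideRegion _)
  have sR : ∀ p ∈ R, ∀ i, p.2.1 i = 0 → (p.1, i) = s := fun p hp i hi =>
    Prod.ext hp.1 (eq_of_mem_sideRegion hp.2 hi)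
  have sR' : ∀ p ∈ R', ∀ i, p.2.1 i = 0 → (p.1, i) = D.glue s := fun p hp i hi =>
    Prod.ext hp.1 (eq_of_mem_sideRegion hp.2 hi)
  have hcons : D.IsConsistent G (R ∪ R') g := by
    refine ⟨fun t => (hOR t).union (hOR' t), ?_, ?_, ?_⟩
    · rintro p q ⟨i, h0, h1, h2⟩ (hp | hp)
      · rw [sR p hp i h0] at h1 h2
        exact Or.inr (hcross p hp q h1 h2)
      · rw [sR' p hp i h0] at h1 h2
        rw [D.glue_glue] at h1
        exact Or.inl (hcross' p hp q h1 h2)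
    · rintro t z' (hz' | hz')
      · filter_upwards [(hOR t).mem_nhds hz'] with y hy
        rw [hgR _ hy, hgR _ hz']
      · filter_upwards [(hOR' t).mem_nhds hz'] with y hy
        rw [hgR' _ hy, hgR' _ hz']
    · rintro p (hp | hp) i h0 - q h1 h2
      · rw [sR p hp i h0] at h1 h2 ⊢
        rw [hgR p hp, hgR' q (hcross p hp q h1 h2)]
        exact hG.adj rfl hP hP' hadj
      · rw [sR' p hp i h0] at h1 h2 ⊢
        rw [D.glue_glue] at h1
        rw [hgR' p hp, hgR q (hcross' p hp q h1 h2)]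
        exact hG.adj (s := D.glue s) (by rw [D.glue_glue]) hP' hP (by rw [D.perm_glue]; exact hadj')
  have hRG := hG.realizesGluing hx h
  -- A common image point has real part both nonnegative and nonpositive, hence comes from the side.
  have mixed : ∀ p ∈ R, ∀ q ∈ R', develop (baseRealization x) g p =
      develop (baseRealization x) g q → D.char p.1 p.2 = D.char q.1 q.2 := by
    intro p hp q hq he
    obtain ⟨c, hc, e1⟩ := point_two hP.toIsTriple hP0 p.2
    obtain ⟨c', hc', e2⟩ := point_two hP'.toIsTriple hP0' q.2
    have he' := he
    rw [hdR p hp, hdR' q hq] at he'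
    rw [he', e2] at e1
    have y1 := p.2.2.1 s.2
    have y2 := q.2.2.1 (D.glue s).2
    have hp0 : p.2.1 s.2 = 0 := by
      by_contra hne
      have : 0 < p.2.1 s.2 := lt_of_le_of_ne y1 (Ne.symm hne)
      have h1 : 0 < c * p.2.1 s.2 * P s.2 2 := by positivity
      have h2 : c' * q.2.1 (D.glue s).2 * P' (D.glue s).2 2 ≤ 0 :=
        mul_nonpos_of_nonneg_of_nonpos (by positivity) hPi'.le
      linarith
    -- This is the point glued to p; it has the same image as q in the second triangle and therefore
    -- coincides with q.
    let q' : T × StdTriangle := ((D.glue s).1, ⟨fun j => p.2.1 ((D.perm s)⁻¹ j), fun j => p.2.2.1 _, by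
      rw [Equiv.sum_comp (D.perm s)⁻¹ p.2.1]; exact p.2.2.2⟩)
    have hps : (p.1, s.2) = s := Prod.ext hp.1 rfl
    have hgl : SideGluing D.glue D.perm p q' :=
      ⟨s.2, hp0, by rw [hps], fun j => by rw [hps]; simp [q']⟩
    have hq' : q' ∈ R' := hcross p hp q' rfl fun j => by simp [q']
    have hd := hcons.develop_eq_of_sideGluing hRG hgl (Or.inl hp)
    rw [he, hdR' q hq, hdR' q' hq'] at hd
    have hqq : q.2 = q'.2 := point_injective hP'.toIsTriple hd
    rw [D.char_eq_of_sideGluing hgl, hqq, hq.1]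
  have hz' : (s.1, z) ∈ R := ⟨rfl, hz⟩
  refine hcons.exists_chart_interior hRG (p₀ := (s.1, z)) ?_ (Or.inl hz') ?_
  · rintro p (hp | hp) q (hq | hq) he
    · rw [hdR p hp, hdR q hq] at he
      rw [hp.1, hq.1, point_injective hP.toIsTriple he]
    · exact mixed p hp q hq he
    · exact (mixed q hq p hp he.symm).symm
    · rw [hdR' p hp, hdR' q hq] at he
      rw [hp.1, hq.1, point_injective hP'.toIsTriple he]
  · intro U hU
    let z' : StdTriangle := ⟨fun j => z.1 ((D.perm s)⁻¹ j), fun j => z.2.1 _, by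
      rw [Equiv.sum_comp (D.perm s)⁻¹ z.1]; exact z.2.2⟩
    have hgl : SideGluing D.glue D.perm (s.1, z) ((D.glue s).1, z') :=
      ⟨s.2, hz0, rfl, fun j => by simp [z']⟩
    have hzR' : ((D.glue s).1, z') ∈ R' := hcross _ hz' _ rfl fun j => by simp [z']
    have hU' := hU
    rw [D.char_eq_of_sideGluing hgl] at hU'
    have hN : (D.char s.1) ⁻¹' U ∩ {y | (s.1, y) ∈ R} ∈ 𝓝 z :=
      inter_mem ((D.char s.1).continuous.continuousAt hU) ((hOR _).mem_nhds hz')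
    have hN' : (D.char (D.glue s).1) ⁻¹' U ∩ {y | ((D.glue s).1, y) ∈ R'} ∈ 𝓝 z' :=
      inter_mem ((D.char _).continuous.continuousAt hU') ((hOR' _).mem_nhds hzR')
    have ev := eventually_exists_point hP.toIsTriple hN
    have ev' := eventually_exists_point hP'.toIsTriple hN'
    rw [← hdR' _ hzR', ← hcons.develop_eq_of_sideGluing hRG hgl (Or.inl hz')] at ev'
    rw [← hdR _ hz'] at ev
    filter_upwards [ev, ev'] with w hw hw'
    have e := sideForm_eq_coord (β := 0) hP.toIsTriple (i := s.2)
      (fun j hj => by rw [sideForm_zero]; exact hP0 j hj) (ofUHP w)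
    have e' := sideForm_eq_coord (β := 0) hP'.toIsTriple (i := (D.glue s).2)
      (fun j hj => by rw [sideForm_zero]; exact hP0' j hj) (ofUHP w)
    rw [sideForm_zero, sideForm_zero] at e e'
    rcases le_total 0 (ofUHP w 2) with hre | hre
    · obtain ⟨y, hy, hyw⟩ := hw fun j hj => by
        rw [eq_of_mem_sideRegion hz hj]
        rw [e] at hre
        exact nonneg_of_mul_nonneg_left hre hPi
      exact ⟨(s.1, y), Or.inl hy.2, hy.1, by rw [hdR _ hy.2, hyw]⟩
    · obtain ⟨y, hy, hyw⟩ := hw' fun j hj => by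
        rw [eq_of_mem_sideRegion hzR'.2 hj]
        by_contra hneg
        have := mul_pos_of_neg_of_neg (not_le.1 hneg) hPi'
        linarith
      exact ⟨((D.glue s).1, y), Or.inr hy.2, hy.1, by rw [hdR' _ hy.2, hyw]⟩

end TriangularDecomposition

/-! ### The cyclic order of the corners at a vertex -/

namespace DartWalk

variable {α : Type*} {cross flip : α → α}

/-- The walk obtained by alternating two involutions. -/
def walk (cross flip : α → α) (d₀ : α) (a : ℕ) : α := (flip ∘ cross)^[a] d₀

theorem walk_zero (d₀ : α) : walk cross flip d₀ 0 = d₀ := rfl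

theorem walk_succ (d₀ : α) (a : ℕ) :
    walk cross flip d₀ (a + 1) = flip (cross (walk cross flip d₀ a)) :=
  Function.iterate_succ_apply' _ _ _

/-- If the walk met a dart and later its reverse, stepping inwards from both ends would give the
same coincidence with a gap shorter by two. The descent ends at a fixed point of `flip` or at a
forbidden fixed point of `cross`. -/
theorem walk_ne_flip (hc : Function.Involutive cross) (hf : Function.Involutive flip)
    (hne : ∀ d, flip d ≠ d) (d₀ : α) (l : ℕ) : ∀ a,
    (∀ c, a ≤ c → c < a + l → cross (walk cross flip d₀ c) ≠ walk cross flip d₀ c) →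
    walk cross flip d₀ a ≠ flip (walk cross flip d₀ (a + l)) := by
  induction l using Nat.twoStepInduction with
  | zero => exact fun a _ h => hne _ h.symm
  | one =>
    intro a h he
    rw [walk_succ, hf] at he
    exact h a le_rfl (Nat.lt_succ_self a) he.symm
  | more l ih _ =>
    intro a h he
    refine ih (a + 1) (fun c h1 h2 => h c (by omega) (by omega)) ?_
    rw [walk_succ, he, show a + (l + 2) = a + 1 + l + 1 by ring, walk_succ, hf, hc]

theorem walk_injective (hc : Function.Involutive cross) (hf : Function.Involutive flip) {d₀ : α}
    {a b : ℕ} (h : walk cross flip d₀ a = walk cross flip d₀ (a + b)) :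
    walk cross flip d₀ b = d₀ := by
  have hinj : Function.Injective (flip ∘ cross) := hf.injective.comp hc.injective
  apply hinj.iterate a
  rw [walk, walk, Function.iterate_add_apply] at h
  exact h.symm

theorem exists_period [Finite α] (hc : Function.Involutive cross) (hf : Function.Involutive flip)
    (d₀ : α) : ∃ n, 0 < n ∧ walk cross flip d₀ n = d₀ := by
  obtain ⟨a, b, hab, he⟩ := Finite.exists_ne_map_eq_of_infinite (walk cross flip d₀)
  rcases lt_or_gt_of_ne hab with h | h
  · refine ⟨b - a, by omega, walk_injective hc hf (a := a) ?_⟩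
    rw [he]; congr 1; omega
  · refine ⟨a - b, by omega, walk_injective hc hf (a := b) ?_⟩
    rw [← he]; congr 1; omega

/-- The step is a bijection of a finite set, so the orbit is periodic; the least period excludes
repetitions and `walk_ne_flip` excludes reversals. -/
theorem exists_cyclic [Finite α] (hc : Function.Involutive cross) (hf : Function.Involutive flip)
    (hne : ∀ d, flip d ≠ d) (d₀ : α)
    (h : ∀ a, cross (walk cross flip d₀ a) ≠ walk cross flip d₀ a) :
    ∃ n, 0 < n ∧ walk cross flip d₀ n = d₀ ∧ ∀ a b, a < b → b < n →
      walk cross flip d₀ a ≠ walk cross flip d₀ b ∧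
      walk cross flip d₀ a ≠ flip (walk cross flip d₀ b) := by
  classical
  have hex := exists_period hc hf d₀
  refine ⟨Nat.find hex, (Nat.find_spec hex).1, (Nat.find_spec hex).2, fun a b hab hb =>
    ⟨fun he => ?_, ?_⟩⟩
  · refine Nat.find_min hex (m := b - a) (by omega) ⟨by omega, walk_injective hc hf (a := a) ?_⟩
    rw [he]; congr 1; omega
  · have := walk_ne_flip hc hf hne d₀ (b - a) a fun c _ _ => h c
    rwa [show a + (b - a) = b by omega] at this

/-- Starting with its entry side on the boundary, the periodic walk can return to the start only by
bouncing off the boundary. The first bounce ends the path. -/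
theorem exists_path [Finite α] (hc : Function.Involutive cross) (hf : Function.Involutive flip)
    (hne : ∀ d, flip d ≠ d) {d₀ : α} (h₀ : cross (flip d₀) = flip d₀) :
    ∃ n, cross (walk cross flip d₀ n) = walk cross flip d₀ n ∧
      (∀ a < n, cross (walk cross flip d₀ a) ≠ walk cross flip d₀ a) ∧
      ∀ a b, a < b → b < n + 1 → walk cross flip d₀ a ≠ walk cross flip d₀ b ∧
        walk cross flip d₀ a ≠ flip (walk cross flip d₀ b) := by
  classical
  -- Returning to d₀ means having crossed onto its reverse, which `cross` fixes by hypothesis.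
  have back : ∀ c, walk cross flip d₀ (c + 1) = d₀ →
      cross (walk cross flip d₀ c) = walk cross flip d₀ c := by
    intro c he
    rw [walk_succ] at he
    have h1 : cross (walk cross flip d₀ c) = flip d₀ := by
      have := congrArg flip he
      rwa [hf] at this
    have h2 : walk cross flip d₀ c = cross (flip d₀) := by rw [← h1, hc]
    rw [h1, h2, h₀]
  have hex : ∃ n, cross (walk cross flip d₀ n) = walk cross flip d₀ n := by
    obtain ⟨n, hn, he⟩ := exists_period hc hf d₀
    obtain ⟨n, rfl⟩ := Nat.exists_eq_succ_of_ne_zero hn.ne'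
    exact ⟨n, back n he⟩
  refine ⟨Nat.find hex, Nat.find_spec hex, fun a ha => Nat.find_min hex ha, fun a b hab hb =>
    ⟨fun he => ?_, ?_⟩⟩
  · refine Nat.find_min hex (m := b - a - 1) (by omega) (back _ (walk_injective hc hf (a := a) ?_))
    rw [he]; congr 1; omega
  · have := walk_ne_flip hc hf hne d₀ (b - a) a fun c _ _ => Nat.find_min hex (by omega)
    rwa [show a + (b - a) = b by omega] at this

end DartWalk

namespace TriangularDecomposition

variable {M : Type u} [TopologicalSpace M] {T : Type v} (D : TriangularDecomposition M T)

/-- A corner of a triangle with an order of its two sides: the dart `(t, σ)` stands for the corner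
of `t` at the vertex `σ 0`, entered through the side opposite to `σ 2` and left through the side
opposite to `σ 1`. -/
abbrev Dart (T : Type v) : Type v := T × Equiv.Perm (Fin 3)

/-- The slot of a dart. -/
def Dart.slot (d : Dart T) : T × Fin 3 := (d.1, d.2 0)

/-- The side through which a dart leaves its triangle. -/
def Dart.exit (d : Dart T) : T × Fin 3 := (d.1, d.2 1)

/-- The side through which a dart enters its triangle. -/
def Dart.entry (d : Dart T) : T × Fin 3 := (d.1, d.2 2)

/-- The dart in the opposite direction. -/
def Dart.flip (d : Dart T) : Dart T := (d.1, d.2 * Equiv.swap 1 2)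

/-- The corner on the other side of the exit side. -/
def crossDart (d : Dart T) : Dart T := ((D.glue d.exit).1, D.perm d.exit * d.2)

theorem crossDart_exit (d : Dart T) : (D.crossDart d).exit = D.glue d.exit :=
  Prod.ext rfl (D.perm_side d.exit)

theorem crossDart_involutive : Function.Involutive D.crossDart := by
  intro d
  have e := D.crossDart_exit d
  refine Prod.ext ?_ ?_
  · change (D.glue (D.crossDart d).exit).1 = d.1
    rw [e, D.glue_glue]
    rfl
  · change D.perm (D.crossDart d).exit * (D.perm d.exit * d.2) = d.2
    rw [e, D.perm_glue, inv_mul_cancel_left]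

theorem crossDart_eq_iff (d : Dart T) : D.crossDart d = d ↔ D.glue d.exit = d.exit := by
  constructor
  · intro h
    rw [← D.crossDart_exit, h]
  · intro h
    refine Prod.ext ?_ ?_
    · change (D.glue d.exit).1 = d.1
      rw [h]
      rfl
    · change D.perm d.exit * d.2 = d.2
      rw [D.perm_boundary _ h, one_mul]

theorem flip_involutive : Function.Involutive (Dart.flip (T := T)) := by
  intro d
  refine Prod.ext rfl ?_
  change d.2 * Equiv.swap 1 2 * Equiv.swap 1 2 = d.2
  rw [mul_assoc, Equiv.swap_mul_self, mul_one]

theorem flip_ne (d : Dart T) : d.flip ≠ d := by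
  intro h
  have h1 := congrArg (fun d : Dart T => d.2 1) h
  simp only [Dart.flip, Equiv.Perm.mul_apply, Equiv.swap_apply_left] at h1
  exact absurd (d.2.injective h1) (by decide)

theorem flip_exit (d : Dart T) : d.flip.exit = d.entry := by
  simp [Dart.flip, Dart.exit, Dart.entry]

theorem eq_or_eq_flip_of_slot {d d' : Dart T} (h : d.slot = d'.slot) : d = d' ∨ d = d'.flip := by
  have h1 : d.slot.1 = d'.slot.1 := by rw [h]
  have h2 : d.slot.2 = d'.slot.2 := by rw [h]
  have key : ∀ σ τ : Equiv.Perm (Fin 3), σ 0 = τ 0 → σ = τ ∨ σ = τ * Equiv.swap 1 2 := by decide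
  exact (key _ _ h2).imp (fun h => Prod.ext h1 h) (fun h => Prod.ext h1 h)

/-- The next dart around the vertex. -/
def nextDart (d : Dart T) : Dart T := (D.crossDart d).flip

theorem nextDart_entry (d : Dart T) : (D.nextDart d).entry = D.glue d.exit := by
  rw [← D.crossDart_exit, nextDart, ← flip_exit, flip_involutive]

theorem nextDart_apply_zero (d : Dart T) : (D.nextDart d).2 0 = D.perm d.exit (d.2 0) := by
  have h : (Equiv.swap 1 2 : Equiv.Perm (Fin 3)) 0 = 0 := by decide
  simp [nextDart, crossDart, Dart.flip, h]

theorem nextDart_apply_one (d : Dart T) : (D.nextDart d).2 1 = D.perm d.exit (d.2 2) := by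
  simp [nextDart, crossDart, Dart.flip]

theorem slotVertex_nextDart (d : Dart T) :
    D.slotVertex (D.nextDart d).slot = D.slotVertex d.slot := by
  have h : d.2 0 ≠ d.exit.2 := d.2.injective.ne (by decide)
  refine Eq.trans (congrArg D.slotVertex (Prod.ext rfl ?_)) (D.slotVertex_perm d.exit h)
  exact D.nextDart_apply_zero d

/-- A sequence of darts running once around a vertex, or from boundary to boundary. -/
structure IsCornerWalk (n : ℕ) (d : ℕ → Dart T) : Prop where
  pos : 0 < n
  step : ∀ a, d (a + 1) = D.nextDart (d a)
  inj : ∀ a < n, ∀ b < n, (d a).slot = (d b).slot → a = b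
  ends : (d n = d 0 ∧ ∀ a < n, D.glue (d a).exit ≠ (d a).exit) ∨
    ((∀ a, a + 1 < n → D.glue (d a).exit ≠ (d a).exit) ∧
      D.glue (d (n - 1)).exit = (d (n - 1)).exit ∧ D.glue (d 0).entry = (d 0).entry)

/-- Corners with a direction form a finite set on which crossing a side and reversing are
involutions. The alternating walk is a chain between boundary sides at a boundary vertex and a cycle
at an interior one. -/
theorem exists_isCornerWalk [Finite T] {m : M} (hm : m ∈ D.vertices) :
    ∃ n d, D.IsCornerWalk n d ∧ D.slotVertex (d 0).slot = m ∧
      (m ∉ D.boundaryVertices → d n = d 0) ∧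
      (m ∈ D.boundaryVertices → D.glue (d (n - 1)).exit = (d (n - 1)).exit) := by
  have hperm : ∀ j k : Fin 3, j ≠ k → ∃ σ : Equiv.Perm (Fin 3), σ 0 = j ∧ σ 2 = k := by decide
  have hinj : ∀ (n : ℕ) (d : ℕ → Dart T), (∀ a b, a < b → b < n → d a ≠ d b ∧ d a ≠ (d b).flip) →
      ∀ a < n, ∀ b < n, (d a).slot = (d b).slot → a = b := by
    intro n d h a ha b hb he
    by_contra hne
    rcases lt_or_gt_of_ne hne with hab | hab
    · rcases eq_or_eq_flip_of_slot he with h' | h'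
      exacts [(h a b hab hb).1 h', (h a b hab hb).2 h']
    · rcases eq_or_eq_flip_of_slot he.symm with h' | h'
      exacts [(h b a hab ha).1 h', (h b a hab ha).2 h']
  by_cases hb : m ∈ D.boundaryVertices
  · obtain ⟨s, hs, j, hj, rfl⟩ := hb
    -- The first dart enters its corner through the boundary side.
    obtain ⟨σ, h0, h2⟩ := hperm j s.2 hj
    set d₀ : Dart T := (s.1, σ) with hd₀
    have hentry : d₀.entry = s := Prod.ext rfl h2
    obtain ⟨n, h1, h3, h4⟩ := DartWalk.exists_path D.crossDart_involutive
      (flip_involutive (T := T)) flip_ne (d₀ := d₀)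
      ((D.crossDart_eq_iff _).2 (by rw [flip_exit, hentry, hs]))
    rw [D.crossDart_eq_iff] at h1
    refine ⟨n + 1, DartWalk.walk D.crossDart Dart.flip d₀, ⟨n.succ_pos, DartWalk.walk_succ d₀,
      hinj _ _ h4, Or.inr ⟨fun a ha => ?_, ?_, ?_⟩⟩, ?_, fun h => absurd ⟨s, hs, j, hj, rfl⟩ h,
      fun _ => ?_⟩
    · exact fun h => h3 a (by omega) ((D.crossDart_eq_iff _).2 h)
    · exact h1
    · rw [DartWalk.walk_zero, hentry, hs]
    · rw [DartWalk.walk_zero, Dart.slot, h0]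
    · exact h1
  · obtain ⟨q, rfl⟩ := hm
    obtain ⟨k, hk⟩ : ∃ k : Fin 3, q.2 ≠ k := by
      generalize q.2 = i; revert i; decide
    obtain ⟨σ, h0, -⟩ := hperm q.2 k hk
    set d₀ : Dart T := (q.1, σ) with hd₀
    have hq : d₀.slot = q := Prod.ext rfl h0
    have hv : ∀ a, D.slotVertex (DartWalk.walk D.crossDart Dart.flip d₀ a).slot =
        D.slotVertex q := by
      intro a
      induction a with
      | zero => rw [DartWalk.walk_zero, hq]
      | succ a ih => rw [DartWalk.walk_succ, ← ih]; exact D.slotVertex_nextDart _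
    -- The walk stays at its vertex, so meeting a boundary side would make that vertex a boundary
    -- vertex.
    have hne : ∀ a, D.glue (DartWalk.walk D.crossDart Dart.flip d₀ a).exit ≠
        (DartWalk.walk D.crossDart Dart.flip d₀ a).exit := by
      intro a h
      refine hb ⟨_, h, (DartWalk.walk D.crossDart Dart.flip d₀ a).2 0,
        (DartWalk.walk D.crossDart Dart.flip d₀ a).2.injective.ne (by decide), ?_⟩
      exact (hv a).symm
    obtain ⟨n, hn, h1, h2⟩ := DartWalk.exists_cyclic D.crossDart_involutive
      (flip_involutive (T := T)) flip_ne d₀ fun a h => hne a ((D.crossDart_eq_iff _).1 h)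
    exact ⟨n, DartWalk.walk D.crossDart Dart.flip d₀, ⟨hn, DartWalk.walk_succ d₀, hinj _ _ h2,
      Or.inl ⟨h1, fun a _ => hne a⟩⟩, hv 0, fun _ => h1, fun h => absurd h hb⟩

/-! ### The star of a vertex -/

namespace IsCornerWalk

variable {D} {n : ℕ} {d : ℕ → Dart T}

/-- The corner with index `b` comes after the one with index `a`. -/
def Follows (d : ℕ → Dart T) (n a b : ℕ) : Prop :=
  b = a + 1 ∨ (a + 1 = n ∧ b = 0 ∧ d n = d 0)

theorem dart_eq_of_follows (h : D.IsCornerWalk n d) {a b : ℕ} (hab : Follows d n a b) :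
    d b = D.nextDart (d a) := by
  rcases hab with rfl | ⟨rfl, rfl, he⟩
  · exact h.step a
  · rw [← he]; exact h.step a

theorem exists_next (h : D.IsCornerWalk n d) {a : ℕ} (ha : a < n)
    (hne : D.glue (d a).exit ≠ (d a).exit) : ∃ b < n, Follows d n a b := by
  by_cases hn : a + 1 < n
  · exact ⟨a + 1, hn, Or.inl rfl⟩
  · have hn' : a + 1 = n := by omega
    rcases h.ends with ⟨he, -⟩ | ⟨-, he, -⟩
    · exact ⟨0, h.pos, Or.inr ⟨hn', rfl, he⟩⟩
    · rw [← hn', Nat.add_sub_cancel] at he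
      exact absurd he hne

theorem exists_prev (h : D.IsCornerWalk n d) {b : ℕ} (hb : b < n)
    (hne : D.glue (d b).entry ≠ (d b).entry) : ∃ a < n, Follows d n a b := by
  rcases Nat.eq_zero_or_pos b with rfl | hb0
  · rcases h.ends with ⟨he, -⟩ | ⟨-, -, he⟩
    · exact ⟨n - 1, by omega, Or.inr ⟨by omega, rfl, he⟩⟩
    · exact absurd he hne
  · exact ⟨b - 1, by omega, Or.inl (by omega)⟩

/-- The star of the vertex. -/
def star (n : ℕ) (d : ℕ → Dart T) : Set (T × StdTriangle) :=
  -- Two barycentric coordinates cannot both exceed 1/2, so corners of the same triangle at one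
  -- vertex occupy disjoint regions. The bound also excludes the opposite side.
  {p | ∃ a < n, (d a).1 = p.1 ∧ 1 / 2 < p.2.1 ((d a).2 0)}

theorem perm_cases (σ : Equiv.Perm (Fin 3)) (i : Fin 3) : i = σ 0 ∨ i = σ 1 ∨ i = σ 2 := by
  revert σ i; decide

/-- The transitions in the star. -/
theorem side_cases (h : D.IsCornerWalk n d) {a : ℕ} (ha : a < n) {p q : T × StdTriangle}
    (hp : (d a).1 = p.1) (hpa : 1 / 2 < p.2.1 ((d a).2 0)) {i : Fin 3} (h0 : p.2.1 i = 0)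
    (hne : D.glue (p.1, i) ≠ (p.1, i)) (h1 : q.1 = (D.glue (p.1, i)).1)
    (h2 : ∀ j, q.2.1 (D.perm (p.1, i) j) = p.2.1 j) :
    ∃ b < n, (d b).1 = q.1 ∧ 1 / 2 < q.2.1 ((d b).2 0) ∧
      ((Follows d n a b ∧ (p.1, i) = (d a).exit) ∨ (Follows d n b a ∧ (p.1, i) = (d a).entry)) := by
  rcases perm_cases (d a).2 i with rfl | rfl | rfl
  · rw [h0] at hpa; norm_num at hpa
  · have hs : (p.1, (d a).2 1) = (d a).exit := Prod.ext hp.symm rfl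
    rw [hs] at hne h1 h2
    obtain ⟨b, hb, hab⟩ := h.exists_next ha hne
    have e := h.dart_eq_of_follows hab
    refine ⟨b, hb, by rw [e, h1]; rfl, ?_, Or.inl ⟨hab, hs⟩⟩
    have e0 : (d b).2 0 = D.perm (d a).exit ((d a).2 0) := by
      rw [e, nextDart_apply_zero]
    rw [e0, h2]
    exact hpa
  · have hs : (p.1, (d a).2 2) = (d a).entry := Prod.ext hp.symm rfl
    rw [hs] at hne h1 h2
    obtain ⟨b, hb, hab⟩ := h.exists_prev ha hne
    have e := h.dart_eq_of_follows hab
    have he : (d a).entry = D.glue (d b).exit := by rw [e, nextDart_entry]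
    refine ⟨b, hb, ?_, ?_, Or.inr ⟨hab, hs⟩⟩
    · rw [h1, he, D.glue_glue]; rfl
    · have e0 : (d a).2 0 = D.perm (d b).exit ((d b).2 0) := by
        rw [e, nextDart_apply_zero]
      have e1 : (d b).2 0 = D.perm (d a).entry ((d a).2 0) := by
        rw [he, D.perm_glue, e0]; simp
      rw [e1, h2]
      exact hpa

theorem glue_mem_star (h : D.IsCornerWalk n d) (p q : T × StdTriangle)
    (hpq : SideGluing D.glue D.perm p q) (hp : p ∈ star n d) : q ∈ star n d := by
  obtain ⟨i, h0, h1, h2⟩ := hpq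
  by_cases hi : D.glue (p.1, i) = (p.1, i)
  · rw [eq_of_sideGluing_of_glue_eq hi h1 h2]
    exact hp
  · obtain ⟨a, ha, hpa, hpa'⟩ := hp
    obtain ⟨b, hb, hq, hq', -⟩ := h.side_cases ha hpa hpa' h0 hi h1 h2
    exact ⟨b, hb, hq, hq'⟩

theorem vertex_mem_star {q : T × Fin 3} : (q.1, StdTriangle.vertex q.2) ∈ star n d ↔
    ∃ a < n, (d a).slot = q := by
  constructor
  · rintro ⟨a, ha, h1, h2⟩
    refine ⟨a, ha, Prod.ext h1 ?_⟩
    by_contra hne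
    have hne' : (d a).2 0 ≠ q.2 := hne
    simp only [StdTriangle.vertex, Pi.single_apply, hne', if_false] at h2
    norm_num at h2
  · rintro ⟨a, ha, rfl⟩
    refine ⟨a, ha, rfl, ?_⟩
    simp [StdTriangle.vertex, Dart.slot]
    norm_num

/-- The walk visits all the corners at the vertex. -/
theorem slotVertex_eq_iff (h : D.IsCornerWalk n d) (q : T × Fin 3) :
    D.slotVertex q = D.slotVertex (d 0).slot ↔ ∃ a < n, (d a).slot = q := by
  constructor
  · intro he
    -- The star is invariant under gluing, so it contains every representative of the vertex.
    rw [← vertex_mem_star]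
    exact D.of_char_eq (Ω := (· ∈ star n d)) h.glue_mem_star
      (p := ((d 0).slot.1, StdTriangle.vertex (d 0).slot.2)) he.symm
      (vertex_mem_star.2 ⟨0, h.pos, rfl⟩)
  · rintro ⟨a, -, rfl⟩
    induction a with
    | zero => rfl
    | succ a ih => rw [h.step, slotVertex_nextDart, ih]

/-- After a bounce at the last corner the next dart is its reverse. If that were the first dart, the
first and last slots would coincide, so n = 1 and a dart would equal its own reverse. -/
theorem ne_of_boundary (hw : D.IsCornerWalk n d)
    (hb : D.glue (d (n - 1)).exit = (d (n - 1)).exit) : d n ≠ d 0 := by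
  intro he
  have hn := hw.pos
  have h1 : d n = (d (n - 1)).flip := by
    have := hw.step (n - 1)
    rw [Nat.sub_add_cancel hn] at this
    rw [this, nextDart, (D.crossDart_eq_iff _).2 hb]
  have h2 : (d (n - 1)).slot = (d 0).slot := by
    rw [← he, h1]
    have h : (Equiv.swap 1 2 : Equiv.Perm (Fin 3)) 0 = 0 := by decide
    simp [Dart.slot, Dart.flip, h]
  have h3 := hw.inj _ (by omega) _ hn h2
  rw [h3] at h1
  exact flip_ne (d 0) (h1.symm.trans he)

theorem vertexSum_eq [Fintype T] (h : D.IsCornerWalk n d) (x : T × Fin 3 → ℝ) :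
    D.vertexSum (D.slotVertex (d 0).slot) x = ∑ a ∈ Finset.range n, x (d a).slot := by
  classical
  rw [vertexSum]
  symm
  refine Finset.sum_bij (fun a _ => (d a).slot) (fun a ha => ?_) (fun a ha b hb he => ?_)
    (fun q hq => ?_) fun _ _ => rfl
  · rw [Finset.mem_filter]
    exact ⟨Finset.mem_univ _, (h.slotVertex_eq_iff _).2 ⟨a, Finset.mem_range.1 ha, rfl⟩⟩
  · exact h.inj a (Finset.mem_range.1 ha) b (Finset.mem_range.1 hb) he
  · obtain ⟨a, ha, he⟩ := (h.slotVertex_eq_iff q).1 (Finset.mem_filter.1 hq).2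
    exact ⟨a, Finset.mem_range.2 ha, he⟩

end IsCornerWalk

end TriangularDecomposition

/-! ### Polar coordinates -/

theorem exists_polar (a b : ℝ) : ∃ ρ φ : ℝ, 0 ≤ ρ ∧ a = ρ * Real.cos φ ∧ b = ρ * Real.sin φ ∧
    0 ≤ φ ∧ φ ≤ 2 * Real.pi ∧ (0 ≤ b → φ ≤ Real.pi) := by
  set z : ℂ := ⟨a, b⟩ with hz
  have h1 := Complex.norm_mul_cos_arg z
  have h2 := Complex.norm_mul_sin_arg z
  have h3 := Complex.neg_pi_lt_arg z
  have h4 := Complex.arg_le_pi z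
  rcases le_or_gt 0 b with hb | hb
  · exact ⟨‖z‖, z.arg, norm_nonneg _, h1.symm, h2.symm, Complex.arg_nonneg_iff.2 hb,
      by linarith [Real.pi_pos], fun _ => h4⟩
  · have h5 : z.arg < 0 := Complex.arg_neg_iff.2 hb
    refine ⟨‖z‖, z.arg + 2 * Real.pi, norm_nonneg _, ?_, ?_, by linarith, by linarith,
      fun h => absurd hb (not_lt.2 h)⟩
    · rw [Real.cos_add_two_pi]; exact h1.symm
    · rw [Real.sin_add_two_pi]; exact h2.symm

/-- Polar coordinates in the cone spanned by two directions. -/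
theorem exists_polar_of_cone {α A μ ν : ℝ} (hA0 : 0 < A) (hA : A < Real.pi) (hμ : 0 ≤ μ)
    (hν : 0 ≤ ν) : ∃ ρ φ : ℝ, 0 ≤ ρ ∧ α ≤ φ ∧ φ ≤ α + A ∧
      μ * Real.cos α + ν * Real.cos (α + A) = ρ * Real.cos φ ∧
      μ * Real.sin α + ν * Real.sin (α + A) = ρ * Real.sin φ ∧
      (ρ = 0 → μ = 0 ∧ ν = 0) ∧ (φ = α → ν = 0) ∧ (φ = α + A → μ = 0) := by
  have hs := Real.sin_pos_of_pos_of_lt_pi hA0 hA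
  obtain ⟨ρ, φ, hρ, hc, hd, h0, -, hπ⟩ := exists_polar (μ + ν * Real.cos A) (ν * Real.sin A)
  have hφ := hπ (by positivity)
  have hm : μ * Real.sin A = ρ * Real.sin (A - φ) := by
    rw [Real.sin_sub]; linear_combination Real.sin A * hc - Real.cos A * hd
  have h1 : ρ = 0 → μ = 0 ∧ ν = 0 := by
    rintro rfl
    rw [zero_mul] at hm hd
    exact ⟨(mul_eq_zero.1 hm).resolve_right hs.ne', (mul_eq_zero.1 hd).resolve_right hs.ne'⟩
  rcases hρ.eq_or_lt with rfl | hρ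
  · obtain ⟨rfl, rfl⟩ := h1 rfl
    exact ⟨0, α, le_rfl, le_rfl, by linarith, by simp, by simp, fun _ => ⟨rfl, rfl⟩, fun _ => rfl,
      fun _ => rfl⟩
  refine ⟨ρ, α + φ, hρ.le, by linarith, ?_, ?_, ?_, h1, fun h => ?_, fun h => ?_⟩
  · by_contra h
    have h2 : 0 < Real.sin (φ - A) := Real.sin_pos_of_pos_of_lt_pi (by linarith) (by linarith)
    rw [← neg_sub, Real.sin_neg] at h2
    have h3 : 0 ≤ μ * Real.sin A := by positivity
    rw [hm] at h3
    have := mul_neg_of_pos_of_neg hρ (neg_pos.1 h2)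
    linarith
  · rw [Real.cos_add, Real.cos_add]
    linear_combination Real.cos α * hc - Real.sin α * hd
  · rw [Real.sin_add, Real.sin_add]
    linear_combination Real.sin α * hc + Real.cos α * hd
  · have : φ = 0 := by linarith
    rw [this, Real.sin_zero, mul_zero] at hd
    exact (mul_eq_zero.1 hd).resolve_right hs.ne'
  · have : A - φ = 0 := by linarith
    rw [this, Real.sin_zero, mul_zero] at hm
    exact (mul_eq_zero.1 hm).resolve_right hs.ne'

theorem eq_or_eq_add_two_pi_of_polar {ρ ρ' φ φ' : ℝ} (hρ : 0 < ρ) (hρ' : 0 ≤ ρ')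
    (hc : ρ * Real.cos φ = ρ' * Real.cos φ') (hs : ρ * Real.sin φ = ρ' * Real.sin φ')
    (h : φ ≤ φ') (h' : φ' ≤ φ + 2 * Real.pi) : φ' = φ ∨ φ' = φ + 2 * Real.pi := by
  have e : ρ ^ 2 = ρ' ^ 2 := by
    have h1 := Real.sin_sq_add_cos_sq φ
    have h2 := Real.sin_sq_add_cos_sq φ'
    linear_combination (ρ * Real.cos φ + ρ' * Real.cos φ') * hc +
      (ρ * Real.sin φ + ρ' * Real.sin φ') * hs - ρ ^ 2 * h1 + ρ' ^ 2 * h2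
  obtain rfl : ρ = ρ' := (pow_left_inj₀ hρ.le hρ' two_ne_zero).1 e
  have hc' := mul_left_cancel₀ hρ.ne' hc
  have hs' := mul_left_cancel₀ hρ.ne' hs
  have h1 : Real.cos (φ' - φ) = 1 := by
    rw [Real.cos_sub, ← hc', ← hs']
    linear_combination Real.sin_sq_add_cos_sq φ
  obtain ⟨k, hk⟩ := (Real.cos_eq_one_iff _).1 h1
  have hπ := Real.pi_pos
  have k0 : (-1 : ℝ) < k := by
    by_contra hk'
    nlinarith
  have k1 : (k : ℝ) < 2 := by
    by_contra hk'
    nlinarith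
  have k0' : -1 < k := by exact_mod_cast k0
  have k1' : k < 2 := by exact_mod_cast k1
  interval_cases k
  · left; norm_num at hk; linarith
  · right; norm_num at hk; linarith

theorem exists_mem_Icc_of_steps {α : ℕ → ℝ} {φ : ℝ} (h0 : α 0 ≤ φ) {n : ℕ} (hn : 0 < n)
    (h : φ ≤ α n) : ∃ a < n, α a ≤ φ ∧ φ ≤ α (a + 1) := by
  induction n with
  | zero => exact absurd hn (lt_irrefl 0)
  | succ n ih =>
    rcases le_or_gt (α n) φ with h1 | h1
    · exact ⟨n, n.lt_succ_self, h1, h⟩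
    · rcases Nat.eq_zero_or_pos n with rfl | hn
      · exact absurd h0 (not_le.2 h1)
      · obtain ⟨a, ha, h2⟩ := ih hn h1.le
        exact ⟨a, ha.trans n.lt_succ_self, h2⟩

/-! ### Sectors -/

theorem StdTriangle.eq_vertex {i j k : Fin 3} (hij : i ≠ j) (hik : i ≠ k) (hjk : j ≠ k)
    {y : StdTriangle} (hj : y.1 j = 0) (hk : y.1 k = 0) : y = StdTriangle.vertex i := by
  have hl : ∀ l, l = i ∨ l = j ∨ l = k := by
    clear * - hij hik hjk; revert i j k; decide
  have hsum : y.1 i = 1 := by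
    rw [← y.2.2, Finset.sum_eq_single i]
    · intro l _ hl'
      rcases hl l with rfl | rfl | rfl
      exacts [absurd rfl hl', hj, hk]
    · simp
  refine Subtype.ext (funext fun l => ?_)
  rcases hl l with rfl | rfl | rfl
  · simp [StdTriangle.vertex, hsum]
  · simp [StdTriangle.vertex, hj, hij]
  · simp [StdTriangle.vertex, hk, hik]

namespace Mink

variable {A : Fin 3 → ℝ} {i j k : Fin 3} {α : ℝ}

theorem polar_add_two_pi (c s α : ℝ) : polar c s (α + 2 * Real.pi) = polar c s α := by
  simp [polar]

theorem place_add_two_pi (A : Fin 3 → ℝ) (i j : Fin 3) (α ε : ℝ) :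
    place A i j (α + 2 * Real.pi) ε = place A i j α ε := by
  ext1 l
  simp only [place, polar_add_two_pi, add_right_comm]

/-- The spatial part of a hyperboloid point gives polar coordinates about the base point. The
triangle lies in the cone between the directions of its two sides there, and the extreme directions
are reached only on these sides. -/
theorem exists_polar_point (hA : IsHypAngles A) (hij : i ≠ j) (hik : i ≠ k) (hjk : j ≠ k) (α : ℝ)
    (y : StdTriangle) : ∃ ρ φ : ℝ, 0 ≤ ρ ∧ α ≤ φ ∧ φ ≤ α + A i ∧
      ofUHP (point (place A i j α 1) y.1) 1 = ρ * Real.cos φ ∧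
      ofUHP (point (place A i j α 1) y.1) 2 = ρ * Real.sin φ ∧
      (ρ = 0 → y = StdTriangle.vertex i) ∧ (φ = α → y.1 k = 0) ∧ (φ = α + A i → y.1 j = 0) := by
  obtain ⟨s, hs, e⟩ := ofUHP_point (hasAngles_place hA hij α (Or.inl rfl)).toIsTriple y
  rw [comb_eq _ _ hij hik hjk, place_fst, place_snd A hij hik hjk, place_third A hik hjk,
    one_mul] at e
  have hj := hA.sideSinh_pos j
  have hk := hA.sideSinh_pos k
  have yj := y.2.1 j
  have yk := y.2.1 k
  obtain ⟨ρ, φ, h1, h2, h3, h4, h5, h6, h7, h8⟩ := exists_polar_of_cone (α := α) (hA.pos i)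
    (hA.lt_pi i) (μ := s * y.1 j * sideSinh A k) (ν := s * y.1 k * sideSinh A j) (by positivity)
    (by positivity)
  have e0 : ∀ {a b : ℝ}, 0 < b → s * a * b = 0 → a = 0 := by
    intro a b hb h
    simpa [hs.ne', hb.ne'] using h
  refine ⟨ρ, φ, h1, h2, h3, ?_, ?_, fun h => ?_, fun h => e0 hj (h7 h), fun h => e0 hk (h8 h)⟩
  · rw [e, ← h4]
    simp [polar]; ring
  · rw [e, ← h5]
    simp [polar]; ring
  · have y1 := e0 hk (h6 h).1
    have y2 := e0 hj (h6 h).2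
    exact StdTriangle.eq_vertex hij hik hjk y1 y2

/-- This is the converse for the sector: each coordinate is, up to a positive factor, ρ times the
sine of the angle to one bounding side, and that angle is below π. -/
theorem coord_nonneg_of_polar (hA : IsHypAngles A) (hij : i ≠ j) (hik : i ≠ k) (hjk : j ≠ k)
    {v : Fin 3 → ℝ} {ρ φ : ℝ} (hρ : 0 ≤ ρ) (h1 : α ≤ φ) (h2 : φ ≤ α + A i)
    (hv1 : v 1 = ρ * Real.cos φ) (hv2 : v 2 = ρ * Real.sin φ) {l : Fin 3} (hl : l ≠ i) :
    0 ≤ coord (place A i j α 1) v l := by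
  have hP := (hasAngles_place hA hij α (Or.inl rfl)).toIsTriple
  have e1 := place_fst A i j α 1
  have e2 := place_snd A hij hik hjk α 1
  have e3 := place_third A hik hjk α 1
  rw [one_mul] at e3
  set P := place A i j α 1
  have hj := hA.sideSinh_pos j
  have hk := hA.sideSinh_pos k
  have hs := hA.sin_pos i
  have hπ := hA.lt_pi i
  have hv : ∀ β, sideForm β v = ρ * Real.sin (φ - β) := by
    intro β
    rw [sideForm, hv1, hv2, Real.sin_sub]; ring
  have hl' : ∀ l m, l ≠ m → l = i ∨ (l = j ∧ m = k) ∨ (l = k ∧ m = j) ∨ m = i := by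
    clear * - hij hik hjk; revert i j k; decide
  have hlc : l = j ∨ l = k := by
    clear * - hij hik hjk hl; revert i j k l; decide
  have hi0 : ∀ β, sideForm β (P i) = 0 := by
    intro β
    rw [e1, sideForm_polar, zero_mul]
  rcases hlc with rfl | rfl
  · have e := sideForm_eq_coord (β := α + A i) hP (i := l) (fun m hm => by
      rcases hl' m l hm with rfl | ⟨rfl, rfl⟩ | ⟨rfl, -⟩ | rfl
      · exact hi0 _
      · exact absurd rfl hm
      · rw [e3, sideForm_polar, sub_self, Real.sin_zero, mul_zero]
      · exact absurd rfl hl) v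
    rw [hv, e2, sideForm_polar] at e
    have h3 : 0 ≤ Real.sin (α + A i - φ) :=
      Real.sin_nonneg_of_nonneg_of_le_pi (by linarith) (by linarith)
    have e' : ρ * Real.sin (α + A i - φ) = coord P v l * (sideSinh A k * Real.sin (A i)) := by
      rw [← neg_sub, Real.sin_neg, show α - (α + A i) = -A i by ring, Real.sin_neg] at e
      linarith
    exact nonneg_of_mul_nonneg_left (e' ▸ mul_nonneg hρ h3) (by positivity)
  · have e := sideForm_eq_coord (β := α) hP (i := l) (fun m hm => by
      rcases hl' m l hm with rfl | ⟨rfl, -⟩ | ⟨rfl, rfl⟩ | rfl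
      · exact hi0 _
      · rw [e2, sideForm_polar, sub_self, Real.sin_zero, mul_zero]
      · exact absurd rfl hm
      · exact absurd rfl hl) v
    rw [hv, e3, sideForm_polar, add_sub_cancel_left] at e
    have h3 : 0 ≤ Real.sin (φ - α) :=
      Real.sin_nonneg_of_nonneg_of_le_pi (by linarith) (by linarith)
    exact nonneg_of_mul_nonneg_left (e ▸ mul_nonneg hρ h3) (by positivity)

end Mink

/-! ### Charts at the vertices -/

namespace TriangularDecomposition

open Mink

variable {M : Type u} [TopologicalSpace M] {T : Type v} (D : TriangularDecomposition M T)

theorem exists_sideGluing {p : T × StdTriangle} {i : Fin 3} (h0 : p.2.1 i = 0) :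
    ∃ q, SideGluing D.glue D.perm p q ∧ q.1 = (D.glue (p.1, i)).1 ∧
      ∀ j, q.2.1 (D.perm (p.1, i) j) = p.2.1 j := by
  have h : ∀ j, p.2.1 ((D.perm (p.1, i))⁻¹ (D.perm (p.1, i) j)) = p.2.1 j := fun j => by simp
  exact ⟨((D.glue (p.1, i)).1, ⟨fun j => p.2.1 ((D.perm (p.1, i))⁻¹ j), fun j => p.2.2.1 _, by
    rw [Equiv.sum_comp (D.perm (p.1, i))⁻¹ p.2.1]; exact p.2.2.2⟩), ⟨i, h0, rfl, h⟩, rfl, h⟩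

/-- The direction in which the walk enters its `a`-th triangle. -/
def cornerAngle (x : T × Fin 3 → ℝ) (d : ℕ → Dart T) (a : ℕ) : ℝ :=
  ∑ b ∈ Finset.range a, x (d b).slot

theorem cornerAngle_succ (x : T × Fin 3 → ℝ) (d : ℕ → Dart T) (a : ℕ) :
    cornerAngle x d (a + 1) = cornerAngle x d a + x ((d a).1, (d a).2 0) :=
  Finset.sum_range_succ _ _

/-- The triangle of a dart, placed with the vertex of the dart at the base point and with its entry
side in the direction `α`. -/
def dartTriple (x : T × Fin 3 → ℝ) (e : Dart T) (α : ℝ) : Fin 3 → Fin 3 → ℝ :=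
  place (fun i => x (e.1, i)) (e.2 0) (e.2 1) α 1

theorem dart_ne (e : Dart T) : e.2 0 ≠ e.2 1 ∧ e.2 0 ≠ e.2 2 ∧ e.2 1 ≠ e.2 2 :=
  ⟨e.2.injective.ne (by decide), e.2.injective.ne (by decide), e.2.injective.ne (by decide)⟩

variable {D} {x : T × Fin 3 → ℝ}

/-- The exit side of a dart and the entry side of the next have the same direction and, by matching,
the same length; the remaining vertices lie at smaller and larger directions, on opposite sides. -/
theorem adjacent_dartTriple (hA : ∀ t, IsHypAngles fun i => x (t, i)) (h : D.SidesMatch x)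
    (e : Dart T) (α : ℝ) : Adjacent e.exit.2 (D.perm e.exit) (dartTriple x e α)
      (dartTriple x (D.nextDart e) (α + x (e.1, e.2 0))) := by
  obtain ⟨h01, h02, h12⟩ := dart_ne e
  have hs := h e.exit
  rw [← D.perm_side] at hs
  change Adjacent (e.2 1) _ _ _
  change sideCosh (fun i => x (e.1, i)) (e.2 1) =
    sideCosh (fun i => x ((D.nextDart e).1, i)) (D.perm e.exit (e.2 1)) at hs
  have hs' : sideSinh (fun i => x (e.1, i)) (e.2 1) =
      sideSinh (fun i => x ((D.nextDart e).1, i)) (D.perm e.exit (e.2 1)) := by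
    rw [sideSinh, sideSinh, hs]
  have inj := (D.perm e.exit).injective
  have hP := hasAngles_place (hA e.1) h01 α (ε := 1) (Or.inl rfl)
  have e1 := place_fst (fun i => x (e.1, i)) (e.2 0) (e.2 1) α 1
  have e2 := place_snd (fun i => x (e.1, i)) h01 h02 h12 α 1
  have e3 := place_third (fun i => x (e.1, i)) h02 h12 α 1
  set β := α + x (e.1, e.2 0) with hβ
  have f1 := place_fst (fun i => x ((D.nextDart e).1, i)) (D.perm e.exit (e.2 0))
    (D.perm e.exit (e.2 2)) β 1
  have f2 := place_snd (fun i => x ((D.nextDart e).1, i)) (inj.ne h02) (inj.ne h01)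
    (inj.ne h12.symm) β 1
  have f3 := place_third (fun i => x ((D.nextDart e).1, i)) (inj.ne h01)
    (inj.ne h12.symm) β 1
  rw [dartTriple, dartTriple, D.nextDart_apply_zero, D.nextDart_apply_one]
  rw [one_mul] at e3 f3
  set P := place (fun i => x (e.1, i)) (e.2 0) (e.2 1) α 1
  set P' := place (fun i => x ((D.nextDart e).1, i)) (D.perm e.exit (e.2 0))
    (D.perm e.exit (e.2 2)) β 1
  have hl : ∀ l, l ≠ e.2 1 → l = e.2 0 ∨ l = e.2 2 := by
    intro l hl
    rcases IsCornerWalk.perm_cases e.2 l with h | h | h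
    exacts [Or.inl h, absurd h hl, Or.inr h]
  refine adjacent_of_sideForm (β := β) hP.toIsTriple (fun l hl' => ?_) (fun l hl' => ?_) ?_
  · rcases hl l hl' with rfl | rfl
    · rw [e1, f1]
    · rw [e3, f2, hs, hs']
  · rcases hl l hl' with rfl | rfl
    · rw [e1, sideForm_polar, zero_mul]
    · rw [e3, sideForm_polar, sub_self, Real.sin_zero, mul_zero]
  · rw [f3, e2, sideForm_polar, sideForm_polar, add_sub_cancel_left,
      show α - β = -x (e.1, e.2 0) by rw [hβ]; ring, Real.sin_neg, mul_neg, mul_neg]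
    refine neg_lt_zero.2 (mul_pos (mul_pos ((hA _).sideSinh_pos _) ((hA _).sin_pos _))
      (mul_pos ((hA _).sideSinh_pos _) ((hA e.1).sin_pos _)))

variable {n : ℕ} {d : ℕ → Dart T}

open Classical in
/-- The index of the corner of the star containing a point. -/
def starIndex (n : ℕ) (d : ℕ → Dart T) (p : T × StdTriangle) : ℕ :=
  if h : ∃ a, a < n ∧ (d a).1 = p.1 ∧ 1 / 2 < p.2.1 ((d a).2 0) then h.choose else 0

theorem IsCornerWalk.starIndex_eq (hw : D.IsCornerWalk n d) {p : T × StdTriangle} {a : ℕ}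
    (ha : a < n) (h1 : (d a).1 = p.1) (h2 : 1 / 2 < p.2.1 ((d a).2 0)) : starIndex n d p = a := by
  have hex : ∃ a, a < n ∧ (d a).1 = p.1 ∧ 1 / 2 < p.2.1 ((d a).2 0) := ⟨a, ha, h1, h2⟩
  rw [starIndex, dif_pos hex]
  obtain ⟨hb, h3, h4⟩ := hex.choose_spec
  refine hw.inj _ hb _ ha (Prod.ext (h3.trans h1.symm) ?_)
  by_contra hne
  change ¬(d hex.choose).2 0 = (d a).2 0 at hne
  have h5 : p.2.1 ((d hex.choose).2 0) + p.2.1 ((d a).2 0) ≤ ∑ i, p.2.1 i := by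
    rw [← Finset.sum_pair hne]
    exact Finset.sum_le_sum_of_subset_of_nonneg (Finset.subset_univ _) fun i _ _ => p.2.2.1 i
  rw [p.2.2.2] at h5
  linarith

/-- The placement of the triangles of the star around the base point. -/
def starPlacement (x : T × Fin 3 → ℝ) (n : ℕ) (d : ℕ → Dart T) (p : T × StdTriangle) : ℍ ≃ᵢ ℍ :=
  moveTo (baseTriple x p.1)
    (dartTriple x (d (starIndex n d p)) (cornerAngle x d (starIndex n d p)))

variable [Fintype T] {G : T × Fin 3 → ℍ ≃ᵢ ℍ}

theorem hasAngles_dartTriple (hx : x ∈ D.angleSystems) (e : Dart T) {t : T} (ht : e.1 = t) (α : ℝ) :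
    HasAngles (fun i => x (t, i)) (dartTriple x e α) := by
  subst ht
  exact hasAngles_place (D.isHypAngles hx e.1) (dart_ne e).1 α (Or.inl rfl)

/-! ### Developing the star around the base point -/

namespace IsCornerWalk

theorem develop_starPlacement (hw : D.IsCornerWalk n d) (hx : x ∈ D.angleSystems)
    {p : T × StdTriangle} {a : ℕ}
    (ha : a < n) (h1 : (d a).1 = p.1) (h2 : 1 / 2 < p.2.1 ((d a).2 0)) :
    develop (baseRealization x) (starPlacement x n d) p =
      point (dartTriple x (d a) (cornerAngle x d a)) p.2.1 := by
  rw [develop, starPlacement, hw.starIndex_eq ha h1 h2, baseRealization,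
    moveTo_point (D.hasAngles_baseTriple hx p.1) (hasAngles_dartTriple hx _ h1 _)]

/-- From the last corner back to the first, the directions differ by the total angle 2π, which does
not change the placement. -/
theorem adjacent_of_follows (hw : D.IsCornerWalk n d) (hx : x ∈ D.angleSystems)
    (h : D.SidesMatch x) (hcl : d n = d 0 → cornerAngle x d n = 2 * Real.pi) {a b : ℕ}
    (hab : Follows d n a b) : Adjacent (d a).exit.2 (D.perm (d a).exit)
      (dartTriple x (d a) (cornerAngle x d a)) (dartTriple x (d b) (cornerAngle x d b)) := by
  have key := adjacent_dartTriple (D.isHypAngles hx) h (d a) (cornerAngle x d a)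
  rw [← hw.dart_eq_of_follows hab, ← cornerAngle_succ] at key
  rcases hab with rfl | ⟨rfl, rfl, he⟩
  · exact key
  · rw [hcl he, ← zero_add (2 * Real.pi), dartTriple.eq_1 _ (d 0), place_add_two_pi] at key
    exact key

theorem isConsistent_star (hw : D.IsCornerWalk n d) (hx : x ∈ D.angleSystems)
    (h : D.SidesMatch x) (hG : D.IsSideIsometry x G)
    (hcl : d n = d 0 → cornerAngle x d n = 2 * Real.pi) :
    D.IsConsistent G (star n d) (starPlacement x n d) := by
  have hopen : ∀ t a, IsOpen {y : StdTriangle | (d a).1 = t ∧ 1 / 2 < y.1 ((d a).2 0)} := fun t a =>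
    isOpen_setOf_fst (isOpen_lt continuous_const
      ((continuous_apply _).comp continuous_subtype_val))
  refine ⟨fun t => ?_, hw.glue_mem_star, ?_, ?_⟩
  · have e : {y | (t, y) ∈ star n d} =
        ⋃ a, ⋃ _ : a < n, {y : StdTriangle | (d a).1 = t ∧ 1 / 2 < y.1 ((d a).2 0)} := by
      ext y
      simp only [star, mem_ofPred_eq, mem_iUnion, exists_prop]
    rw [e]
    exact isOpen_iUnion fun a => isOpen_iUnion fun _ => hopen t a
  · rintro t z ⟨a, ha, h1, h2⟩
    filter_upwards [(hopen t a).mem_nhds ⟨h1, h2⟩] with y hy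
    rw [starPlacement, starPlacement, hw.starIndex_eq (p := (t, y)) ha h1 hy.2,
      hw.starIndex_eq (p := (t, z)) ha h1 h2]
  · rintro p ⟨a, ha, h1, h2⟩ i h0 hi q hq1 hq2
    obtain ⟨b, hb, h3, h4, hab⟩ := hw.side_cases ha h1 h2 h0 hi hq1 hq2
    rw [starPlacement, starPlacement, hw.starIndex_eq ha h1 h2, hw.starIndex_eq hb h3 h4]
    have hPa := hasAngles_dartTriple hx (d a) h1 (cornerAngle x d a)
    have hPb := hasAngles_dartTriple hx (d b) h3 (cornerAngle x d b)
    rcases hab with ⟨hab, hs⟩ | ⟨hab, hs⟩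
    · have := hw.adjacent_of_follows hx h hcl hab
      rw [← hs] at this
      exact hG.adj hq1 hPa hPb this
    · have e : (d a).entry = D.glue (d b).exit := by
        rw [hw.dart_eq_of_follows hab, nextDart_entry]
      have := (hw.adjacent_of_follows hx h hcl hab).symm hPb.toIsTriple hPa.toIsTriple
      rw [← D.perm_glue, D.perm_side, ← e, ← hs] at this
      exact hG.adj hq1 hPa hPb this

theorem strictMono_cornerAngle (hx : x ∈ D.angleSystems) : StrictMono (cornerAngle x d) :=
  strictMono_nat_of_lt_succ fun a => by
    rw [cornerAngle_succ]
    exact lt_add_of_pos_right _ (hx.2.2 _).1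

/-- Polar coordinates in the star. -/
theorem exists_polar_develop (hw : D.IsCornerWalk n d) (hx : x ∈ D.angleSystems)
    {p : T × StdTriangle} {a : ℕ}
    (ha : a < n) (h1 : (d a).1 = p.1) (h2 : 1 / 2 < p.2.1 ((d a).2 0)) :
    ∃ ρ φ : ℝ, 0 ≤ ρ ∧ cornerAngle x d a ≤ φ ∧ φ ≤ cornerAngle x d (a + 1) ∧
      ofUHP (develop (baseRealization x) (starPlacement x n d) p) 1 = ρ * Real.cos φ ∧
      ofUHP (develop (baseRealization x) (starPlacement x n d) p) 2 = ρ * Real.sin φ ∧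
      (ρ = 0 → p.2 = StdTriangle.vertex ((d a).2 0)) ∧
      (φ = cornerAngle x d a → p.2.1 ((d a).2 2) = 0) ∧
      (φ = cornerAngle x d (a + 1) → p.2.1 ((d a).2 1) = 0) := by
  obtain ⟨h01, h02, h12⟩ := dart_ne (d a)
  rw [hw.develop_starPlacement hx ha h1 h2, cornerAngle_succ]
  exact exists_polar_point (D.isHypAngles hx (d a).1) h01 h02 h12 (cornerAngle x d a) p.2

/-- Points with the same image on the side between consecutive corners are identified. -/
theorem char_eq_of_follows (hw : D.IsCornerWalk n d) (hx : x ∈ D.angleSystems)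
    (h : D.SidesMatch x) (hG : D.IsSideIsometry x G)
    (hcl : d n = d 0 → cornerAngle x d n = 2 * Real.pi) {a b : ℕ} (ha : a < n) (hb : b < n)
    (hab : Follows d n a b) {p q : T × StdTriangle}
    (hp : (d a).1 = p.1) (hp' : 1 / 2 < p.2.1 ((d a).2 0)) (hq : (d b).1 = q.1)
    (hq' : 1 / 2 < q.2.1 ((d b).2 0)) (h0 : p.2.1 ((d a).2 1) = 0)
    (he : develop (baseRealization x) (starPlacement x n d) p =
      develop (baseRealization x) (starPlacement x n d) q) : D.char p.1 p.2 = D.char q.1 q.2 := by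
  obtain ⟨r, hr, hr1, hr2⟩ := D.exists_sideGluing h0
  have hs : (p.1, (d a).2 1) = (d a).exit := Prod.ext hp.symm rfl
  rw [hs] at hr1 hr2
  have e := hw.dart_eq_of_follows hab
  have hbr : (d b).1 = r.1 := by rw [e, hr1]; rfl
  have hbr' : 1 / 2 < r.2.1 ((d b).2 0) := by
    rw [e, D.nextDart_apply_zero, hr2]; exact hp'
  have hd := (hw.isConsistent_star hx h hG hcl).develop_eq_of_sideGluing (hG.realizesGluing hx h)
    hr ⟨a, ha, hp, hp'⟩
  rw [he, hw.develop_starPlacement hx hb hq hq', hw.develop_starPlacement hx hb hbr hbr'] at hd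
  have hqr : q.2 = r.2 := point_injective (hasAngles_dartTriple hx (d b) hq _).toIsTriple hd
  rw [D.char_eq_of_sideGluing hr, hqr, ← hbr, ← hq]

/-- Equal images have equal radii and directions equal up to a turn. Radius 0 means that both points
are the vertex. Equal directions in different corners force consecutive corners and a point on their
common side. A difference of 2π forces the first and last corners of a full turn, which are glued.
-/
theorem char_eq_of_develop_eq (hw : D.IsCornerWalk n d) (hx : x ∈ D.angleSystems)
    (h : D.SidesMatch x) (hG : D.IsSideIsometry x G)
    (hcl : d n = d 0 → cornerAngle x d n = 2 * Real.pi) (hle : cornerAngle x d n ≤ 2 * Real.pi)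
    (hop : cornerAngle x d n = 2 * Real.pi → d n = d 0) {p q : T × StdTriangle}
    (hp : p ∈ star n d) (hq : q ∈ star n d)
    (he : develop (baseRealization x) (starPlacement x n d) p =
      develop (baseRealization x) (starPlacement x n d) q) : D.char p.1 p.2 = D.char q.1 q.2 := by
  obtain ⟨a, ha, hp1, hp2⟩ := hp
  obtain ⟨b, hb, hq1, hq2⟩ := hq
  wlog hab : a ≤ b generalizing p q a b
  · exact (this he.symm b hb hq1 hq2 a ha hp1 hp2 (le_of_not_ge hab)).symm
  rcases hab.eq_or_lt with rfl | hab
  · rw [hw.develop_starPlacement hx ha hp1 hp2, hw.develop_starPlacement hx hb hq1 hq2] at he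
    have hpq : p.2 = q.2 := point_injective (hasAngles_dartTriple hx (d a) rfl _).toIsTriple he
    rw [hpq, ← hp1, ← hq1]
  have hmono := strictMono_cornerAngle (d := d) hx
  obtain ⟨ρ, φ, h1, h2, h3, h4, h5, h6, h7, h8⟩ := hw.exists_polar_develop hx ha hp1 hp2
  obtain ⟨ρ', φ', k1, k2, k3, k4, k5, k6, k7, k8⟩ := hw.exists_polar_develop hx hb hq1 hq2
  rw [← he] at k4 k5
  have m1 : cornerAngle x d (a + 1) ≤ cornerAngle x d b := hmono.monotone hab
  have m2 : cornerAngle x d (b + 1) ≤ cornerAngle x d n := hmono.monotone hb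
  have m3 : cornerAngle x d 0 ≤ cornerAngle x d a := hmono.monotone (Nat.zero_le a)
  have m0 : cornerAngle x d 0 = 0 := by simp [cornerAngle]
  rcases h1.eq_or_lt with rfl | hρ
  · have hρ' : ρ' = 0 := by
      rw [h4] at k4
      rw [h5] at k5
      have := Real.sin_sq_add_cos_sq φ'
      have h9 : ρ' ^ 2 = 0 := by
        linear_combination (-ρ' ^ 2) * this - (ρ' * Real.cos φ') * k4 - (ρ' * Real.sin φ') * k5
      exact pow_eq_zero_iff two_ne_zero |>.1 h9
    rw [h6 rfl, k6 hρ', ← hp1, ← hq1]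
    exact ((hw.slotVertex_eq_iff (d a).slot).2 ⟨a, ha, rfl⟩).trans
      ((hw.slotVertex_eq_iff (d b).slot).2 ⟨b, hb, rfl⟩).symm
  rcases eq_or_eq_add_two_pi_of_polar hρ k1 (h4.symm.trans k4) (h5.symm.trans k5)
    (by linarith) (by linarith) with hφ | hφ
  · have e1 : φ = cornerAngle x d (a + 1) := by linarith
    have e2 : a + 1 = b := hmono.injective (by linarith)
    exact hw.char_eq_of_follows hx h hG hcl ha hb (Or.inl e2.symm) hp1 hp2 hq1 hq2 (h8 e1) he
  · have e1 : cornerAngle x d n = 2 * Real.pi := by linarith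
    have e2 : b + 1 = n := hmono.injective (by linarith)
    have e3 : a = 0 := hmono.injective (by linarith)
    have e4 : φ' = cornerAngle x d (b + 1) := by linarith
    exact (hw.char_eq_of_follows hx h hG hcl hb ha (Or.inr ⟨e2, e3, hop e1⟩) hq1 hq2 hp1 hp2
      (k8 e4) he.symm).symm

theorem half_lt_vertex (i : Fin 3) : 1 / 2 < (StdTriangle.vertex i).1 i := by
  simp [StdTriangle.vertex]
  norm_num

/-- Each corner covers its sector near the base point, and the finitely many sectors cover all
directions from 0 to the total angle. -/
theorem eventually_exists_develop (hw : D.IsCornerWalk n d) (hx : x ∈ D.angleSystems) {U : Set M}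
    (hU : U ∈ 𝓝 (D.slotVertex (d 0).slot)) :
    ∀ᶠ w in 𝓝 (develop (baseRealization x) (starPlacement x n d)
        ((d 0).1, StdTriangle.vertex ((d 0).2 0))),
      (∃ ρ φ : ℝ, 0 ≤ ρ ∧ ofUHP w 1 = ρ * Real.cos φ ∧ ofUHP w 2 = ρ * Real.sin φ ∧ 0 ≤ φ ∧
        φ ≤ cornerAngle x d n) →
      ∃ p ∈ star n d, D.char p.1 p.2 ∈ U ∧
        develop (baseRealization x) (starPlacement x n d) p = w := by
  have hbase : ∀ a < n, point (dartTriple x (d a) (cornerAngle x d a))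
      (StdTriangle.vertex ((d a).2 0)).1 = toUHP (polar 1 0 0) := by
    intro a _
    rw [point, StdTriangle.vertex, comb_single, dartTriple, place_fst]
  rw [hw.develop_starPlacement hx hw.pos rfl (half_lt_vertex _), hbase 0 hw.pos]
  have key : ∀ a ∈ Finset.range n, ∀ᶠ w in 𝓝 (toUHP (polar 1 0 0)),
      (∀ j, (StdTriangle.vertex ((d a).2 0)).1 j = 0 →
        0 ≤ coord (dartTriple x (d a) (cornerAngle x d a)) (ofUHP w) j) →
      ∃ p ∈ star n d, D.char p.1 p.2 ∈ U ∧
        develop (baseRealization x) (starPlacement x n d) p = w := by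
    intro a ha
    have ha := Finset.mem_range.1 ha
    have hN : D.char (d a).1 ⁻¹' U ∩ {y | 1 / 2 < y.1 ((d a).2 0)} ∈
        𝓝 (StdTriangle.vertex ((d a).2 0)) := by
      refine inter_mem ((D.char _).continuous.continuousAt ?_) (IsOpen.mem_nhds ?_
        (half_lt_vertex _))
      · rw [← (hw.slotVertex_eq_iff (d a).slot).2 ⟨a, ha, rfl⟩] at hU
        exact hU
      · exact isOpen_lt continuous_const ((continuous_apply _).comp continuous_subtype_val)
    rw [← hbase a ha]
    filter_upwards [eventually_exists_point
      (hasAngles_dartTriple hx (d a) rfl (cornerAngle x d a)).toIsTriple hN] with w hw' hc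
    obtain ⟨y, hy, hyw⟩ := hw' hc
    refine ⟨((d a).1, y), ⟨a, ha, rfl, hy.2⟩, hy.1, ?_⟩
    rw [hw.develop_starPlacement (p := ((d a).1, y)) hx ha rfl hy.2, hyw]
  filter_upwards [(Finset.eventually_all _).2 key] with w hw'
  rintro ⟨ρ, φ, hρ, h1, h2, h3, h4⟩
  obtain ⟨a, ha, h5, h6⟩ := exists_mem_Icc_of_steps (α := cornerAngle x d) (by simpa [cornerAngle])
    hw.pos h4
  obtain ⟨h01, h02, h12⟩ := dart_ne (d a)
  rw [cornerAngle_succ] at h6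
  refine hw' a (Finset.mem_range.2 ha) fun j hj => ?_
  refine coord_nonneg_of_polar (D.isHypAngles hx (d a).1) h01 h02 h12 hρ h5 h6 h1 h2 ?_
  rintro rfl
  have := half_lt_vertex ((d a).2 0)
  rw [hj] at this
  norm_num at this

end IsCornerWalk

variable [T2Space M] [CompactSpace M]

/-- Here the vertex conditions of the flat enter: total angle 2π makes the star fill a disk, and
total angle π makes it fill the half disk sin φ ≥ 0, that is re ≥ 0. -/
theorem exists_chart_of_vertex (hx : x ∈ D.angleSystems) (h : D.SidesMatch x)
    (hG : D.IsSideIsometry x G) {m : M} (hm : m ∈ D.vertices) :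
    ∃ e g, D.IsGeodesicChart (baseRealization x) G e g ∧ m ∈ e.source := by
  obtain ⟨n, d, hw, rfl, hint, hbd⟩ := D.exists_isCornerWalk hm
  have hsum : cornerAngle x d n = D.vertexSum (D.slotVertex (d 0).slot) x :=
    (hw.vertexSum_eq x).symm
  have hp₀ : ((d 0).1, StdTriangle.vertex ((d 0).2 0)) ∈ IsCornerWalk.star n d :=
    ⟨0, hw.pos, rfl, IsCornerWalk.half_lt_vertex _⟩
  have hπ := Real.pi_pos
  have hRG := hG.realizesGluing hx h
  by_cases hb : D.slotVertex (d 0).slot ∈ D.boundaryVertices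
  · rw [hx.1.2 _ hb] at hsum
    have hne := hw.ne_of_boundary (hbd hb)
    have hcl : d n = d 0 → cornerAngle x d n = 2 * Real.pi := fun h => absurd h hne
    have hinj := fun p hp q hq => hw.char_eq_of_develop_eq hx h hG hcl (by linarith)
      (fun h => by linarith) (p := p) (q := q) hp hq
    refine Exists.imp (fun e he => ⟨_, he⟩) ((hw.isConsistent_star hx h hG hcl).exists_chart hRG
      ?_ hinj hp₀ fun U hU => ?_)
    · rintro p ⟨a, ha, h1, h2⟩
      obtain ⟨ρ, φ, k1, k2, k3, -, k5, -⟩ := hw.exists_polar_develop hx ha h1 h2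
      have hmono := (IsCornerWalk.strictMono_cornerAngle (d := d) hx).monotone
      have m0 : cornerAngle x d 0 ≤ cornerAngle x d a := hmono (Nat.zero_le a)
      have m1 : cornerAngle x d (a + 1) ≤ cornerAngle x d n := hmono ha
      have e0 : cornerAngle x d 0 = 0 := by simp [cornerAngle]
      rw [ofUHP_two, div_eq_iff (UpperHalfPlane.im_ne_zero _)] at k5
      rw [k5]
      exact mul_nonneg (mul_nonneg k1 (Real.sin_nonneg_of_nonneg_of_le_pi (by linarith)
        (by linarith))) (UpperHalfPlane.im_pos _).le
    · filter_upwards [hw.eventually_exists_develop hx hU] with w hw' hre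
      -- For re ≥ 0 the direction can be chosen in [0, π], the range filled by the corners.
      obtain ⟨ρ, φ, k1, k2, k3, k4, -, k6⟩ := exists_polar (ofUHP w 1) (ofUHP w 2)
      refine hw' ⟨ρ, φ, k1, k2, k3, k4, ?_⟩
      rw [hsum]
      exact k6 (by rw [ofUHP_two]; exact div_nonneg hre w.im_pos.le)
  · rw [hx.1.1 _ ⟨hm, hb⟩] at hsum
    refine (hw.isConsistent_star hx h hG fun _ => hsum).exists_chart_interior hRG
      (fun p hp q hq => hw.char_eq_of_develop_eq hx h hG (fun _ => hsum) hsum.le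
        (fun _ => hint hb) hp hq) hp₀ fun U hU => ?_
    filter_upwards [hw.eventually_exists_develop hx hU] with w hw'
    obtain ⟨ρ, φ, k1, k2, k3, k4, k5, -⟩ := exists_polar (ofUHP w 1) (ofUHP w 2)
    exact hw' ⟨ρ, φ, k1, k2, k3, k4, hsum ▸ k5⟩

/-- If the glued sides have equal lengths, then the triangles fit together. -/
theorem isUniform_of_sidesMatch (hx : x ∈ D.angleSystems) (h : D.SidesMatch x) :
    D.IsUniform x := by
  obtain ⟨G, hG⟩ := D.exists_isSideIsometry hx h
  refine isUniform_of_charts (r := baseRealization x) (G := G) hx (fun t =>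
    HasAngles.isHypRealization (D.isHypAngles hx t) (D.hasAngles_baseTriple hx t)) ?_
  rintro ⟨t, z⟩
  have hpos : ∀ {j}, z.1 j ≠ 0 → 0 < z.1 j := fun hj => lt_of_le_of_ne (z.2.1 _) (Ne.symm hj)
  -- The kind of chart depends on how many barycentric coordinates vanish: none in the interior, one
  -- on a side, two at a vertex.
  by_cases h0 : ∃ i, z.1 i = 0
  · obtain ⟨i, hi⟩ := h0
    by_cases h1 : ∃ j, j ≠ i ∧ z.1 j = 0
    · obtain ⟨j, hji, hj⟩ := h1
      obtain ⟨k, hjk, hik⟩ := IsHypAngles.exists_third hji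
      obtain rfl := StdTriangle.eq_vertex hik.symm hjk.symm hji.symm hi hj
      exact exists_chart_of_vertex hx h hG ⟨(t, k), rfl⟩
    · push Not at h1
      have hz : z ∈ sideRegion i := fun j hj => by rw [hi]; exact hpos (h1 j hj)
      by_cases hs : D.glue (t, i) = (t, i)
      · exact exists_chart_of_boundary_side hx h hG hs hz
      · exact exists_chart_of_interior_side hx h hG hs hi hz
  · push Not at h0
    exact exists_chart_of_pos hx h hG fun i => hpos (h0 i)

end TriangularDecomposition

end

/-! ### Uniqueness and existence of uniform angle systems -/

theorem theorem2p1 {M : Type u} [TopologicalSpace M] [T2Space M] [CompactSpace M]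
    [ConnectedSpace M] [ChartedSpace (EuclideanHalfSpace 2) M]
    {T : Type v} [Fintype T] (D : TriangularDecomposition M T) (hχ : D.eulerChar < 0) :
    (∀ x u u' : T × Fin 3 → ℝ, D.IsUniform u → D.IsUniform u' →
      D.ConformallyEquivalent u x → D.ConformallyEquivalent u' x → u = u') ∧
    (∀ x ∈ D.angleSystems,
      {y | D.ConformallyEquivalent y x} ∩ D.badSet = ∅ →
        ∃ u, D.IsUniform u ∧ D.ConformallyEquivalent u x) := by
  refine ⟨fun x u u' hu hu' h h' => ?_, fun x hx hB => ?_⟩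
  · refine D.eq_of_sidesMatch hu.1 hu'.1 hu.sidesMatch hu'.sidesMatch ?_
    have := D.conformalDeformations.sub_mem h' h
    rwa [sub_sub_sub_cancel_right] at this
  · obtain ⟨u, hu, hs, hc⟩ := D.exists_sidesMatch hx hB
    exact ⟨u, TriangularDecomposition.isUniform_of_sidesMatch hu hs, hc⟩
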